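/- All graphs are finite and undirected, without loops or parallel edges. A graph is claw-free if it has no induced subgraph isomorphic to $K_{1,3}$. A graph is 2-connected if it has at least three vertices, is connected, and remains connected after the deletion of any single vertex. Let $\Lambda$ denote the path with three vertices. A $\Lambda$-factor of a graph $H$ is a subgraph $P$ of $H$ with $V(P) = V(H)$, every component of which is isomorphic to $\Lambda$. Let $G$ be a 2-connected claw-free graph whose number of vertices $v(G)$ satisfies $v(G) \equiv 0 \pmod 3$, and let $e \in E(G)$. Then $G - e$ (the graph obtained from $G$ by deleting the edge $e$ and keeping all vertices) has a $\Lambda$-factor. -/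

import Mathlib

/-- `G` is claw-free: no induced subgraph of `G` is isomorphic to the claw `K_{1,3}`. -/
def IsClawFree {V : Type*} (G : SimpleGraph V) : Prop :=
  ¬ (completeBipartiteGraph (Fin 1) (Fin 3)).IsIndContained G

/-- `G` is 2-connected: it has at least three vertices, it is connected, and it stays connected
after the removal of any one vertex. -/
def IsTwoConnected {V : Type*} [Fintype V] (G : SimpleGraph V) : Prop :=
  3 ≤ Fintype.card V ∧ G.Connected ∧ ∀ x : V, (G.induce {x}ᶜ).Connected

/-- The subgraph `P` of `G` is an `H`-packing: every component of `P` is isomorphic to `H`. -/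
def IsPacking {V W : Type*} {G : SimpleGraph V} (H : SimpleGraph W) (P : G.Subgraph) : Prop :=
  ∀ C : P.coe.ConnectedComponent, Nonempty (C.toSimpleGraph ≃g H)

/-- `G` has an `H`-factor: an `H`-packing that contains all vertices of `G`. -/
def HasFactor {V W : Type*} (H : SimpleGraph W) (G : SimpleGraph V) : Prop :=
  ∃ P : G.Subgraph, IsPacking H P ∧ P.verts = Set.univ

/-- `Λ` is the path with three vertices. -/
def Lambda : SimpleGraph (Fin 3) := SimpleGraph.pathGraph 3

/-! ### Connectivity, chains of blocks and path factors on finite vertex sets -/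

open Finset

/-! Call a connected graph with at most two end-blocks a chain. Two statements are proved together
by induction on the number of vertices, assumed divisible by three: (A) a claw-free chain has a
Λ-factor; (B) a 2-connected claw-free graph has a Λ-factor avoiding any prescribed edge. Statement
(B) is the theorem.

Chains are the right class because deleting a vertex of a 2-connected claw-free graph leaves a chain
(`TwoConnOn.erase_chainOn`): three end-blocks would all see the deleted vertex and give a claw. The
pieces left by a cut vertex or a 2-cut, with suitable cut vertices kept, are again chains, since
claw-freeness makes the neighbours of a cut vertex on one side a clique. So the method is to cut, to
distribute the cut vertices until both parts have size divisible by three, and to use induction on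
the parts.

For (A), the 2-connected case is (B). A cut vertex settles every residue unless one side is a single
pendant vertex (`CutSplit.pathFactor_or`). What finally remains is a 2-connected core with a pendant
path `p c` and a pendant vertex `q`: either a path `p c z` can be removed, or a 2-cut `{z, m}` with
one side chosen maximal splits the graph (`pathFactor_of_two_pendants`).

For (B) with the edge `x y`, the graph is split at a cut vertex of `S - x`, or, if there is none, at
one of `S - x - a` for a second neighbour `a` of `x`; an extremal choice of a side handles the
awkward residues. In one remaining case a 2-cut `{a, d}` has both sides of size 2 modulo 3, with `x
y` inside one of them; there `a` is made to absorb the neighbours of `d`, and (B) is applied to the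
smaller graph so obtained (`TwoCut.pathFactor_deleteEdge`). The induction ranges over all graphs on
`V`, because the absorbed graph and graphs with an edge deleted occur in it. -/

/-- Every neighbour in `S` of a vertex of `A` lies in `A` or equals `c`. -/
def ClosedUpTo {V : Type*} (G : SimpleGraph V) (S A : Finset V) (c : V) : Prop :=
  ∀ u ∈ A, ∀ w ∈ S, G.Adj u w → w ∈ A ∨ w = c

/-- `G` induces a connected (possibly empty) graph on `S`. -/
def ConnOn {V : Type*} (G : SimpleGraph V) (S : Finset V) : Prop :=
  ∀ A ⊆ S, A.Nonempty → (∀ u ∈ A, ∀ w ∈ S, G.Adj u w → w ∈ A) → S ⊆ A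

/-- `G[S]` is connected and has at most two end-blocks: there are no three pairwise disjoint
nonempty subsets each attached to the rest of `S` through at most one vertex. -/
def ChainOn {V : Type*} (G : SimpleGraph V) (S : Finset V) : Prop :=
  ConnOn G S ∧ ∀ (A₁ A₂ A₃ : Finset V) (c₁ c₂ c₃ : V), A₁ ⊆ S → A₂ ⊆ S → A₃ ⊆ S →
    A₁.Nonempty → A₂.Nonempty → A₃.Nonempty →
    Disjoint A₁ A₂ → Disjoint A₁ A₃ → Disjoint A₂ A₃ →
    ClosedUpTo G S A₁ c₁ → ClosedUpTo G S A₂ c₂ → ClosedUpTo G S A₃ c₃ → False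

/-- `G[S]` is 2-connected. -/
def TwoConnOn {V : Type*} [DecidableEq V] (G : SimpleGraph V) (S : Finset V) : Prop :=
  3 ≤ #S ∧ ∀ A ⊆ S, A.Nonempty → ∀ c, ClosedUpTo G S A c → S ⊆ insert c A

/-- `G[S]` is claw-free. -/
def ClawFreeOn {V : Type*} (G : SimpleGraph V) (S : Finset V) : Prop :=
  ∀ c ∈ S, ∀ x ∈ S, ∀ y ∈ S, ∀ z ∈ S, x ≠ y → x ≠ z → y ≠ z →
    G.Adj c x → G.Adj c y → G.Adj c z → G.Adj x y ∨ G.Adj x z ∨ G.Adj y z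

/-- `S` can be partitioned into vertex sets of three-vertex paths of `G`. -/
inductive PathFactor {V : Type*} [DecidableEq V] (G : SimpleGraph V) : Finset V → Prop
  | empty : PathFactor G ∅
  | cons (S : Finset V) (a b c : V) : PathFactor G S → a ∉ S → b ∉ S → c ∉ S → a ≠ c →
      G.Adj a b → G.Adj b c → PathFactor G (insert a (insert b (insert c S)))

/-- The set `M` is a clique of `G`. -/
def CliqueOn {V : Type*} (G : SimpleGraph V) (M : V → Prop) : Prop :=
  ∀ u v, M u → M v → u ≠ v → G.Adj u v

section

variable {V : Type*} [DecidableEq V] {G G' : SimpleGraph V} {S T Z : Finset V}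

theorem ClawFreeOn.mono (h : ClawFreeOn G S) (hT : T ⊆ S) : ClawFreeOn G T :=
  fun c hc x hx y hy z hz => h c (hT hc) x (hT hx) y (hT hy) z (hT hz)

namespace PathFactor

theorem union (hS : PathFactor G S) (hT : PathFactor G T) (hd : Disjoint S T) :
    PathFactor G (S ∪ T) := by
  induction hS with
  | empty => simpa using hT
  | cons S a b c _ ha hb hc hac hab hbc ih =>
    simp only [insert_union]
    rw [disjoint_left] at hd
    refine cons _ a b c (ih (disjoint_left.2 fun v hv => hd (by simp [hv]))) ?_ ?_ ?_ hac hab hbc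
    all_goals simp only [mem_union, not_or]
    · exact ⟨ha, hd (by simp)⟩
    · exact ⟨hb, hd (by simp)⟩
    · exact ⟨hc, hd (by simp)⟩

theorem of_split (hT : PathFactor G T) (hST : PathFactor G (S \ T)) (h : T ⊆ S) :
    PathFactor G S := by
  have := hT.union hST disjoint_sdiff
  rwa [union_sdiff_of_subset h] at this

theorem path {a b c : V} (hac : a ≠ c) (hab : G.Adj a b) (hbc : G.Adj b c) :
    PathFactor G {a, b, c} :=
  cons ∅ a b c empty (by simp) (by simp) (by simp) hac hab hbc

theorem congr (hS : PathFactor G S) (h : ∀ u ∈ S, ∀ v ∈ S, G.Adj u v → G'.Adj u v) :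
    PathFactor G' S := by
  induction hS with
  | empty => exact empty
  | cons S a b c _ ha hb hc hac hab hbc ih =>
    refine cons _ a b c (ih fun u hu v hv => h u (by simp [hu]) v (by simp [hv])) ha hb hc hac
      (h _ (by simp) _ (by simp) hab) (h _ (by simp) _ (by simp) hbc)

theorem exists_path (hS : PathFactor G S) {v : V} (hv : v ∈ S) :
    ∃ a b c, a ∈ S ∧ b ∈ S ∧ c ∈ S ∧ a ≠ c ∧ G.Adj a b ∧ G.Adj b c ∧ (v = a ∨ v = b ∨ v = c) ∧
      PathFactor G (S \ {a, b, c}) := by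
  induction hS with
  | empty => simp at hv
  | cons S a b c hS ha hb hc hac hab hbc ih =>
    by_cases hvS : v ∈ S
    · obtain ⟨p, q, r, hp, hq, hr, hpr, hpq, hqr, hvm, hF⟩ := ih hvS
      refine ⟨p, q, r, by simp [hp], by simp [hq], by simp [hr], hpr, hpq, hqr, hvm, ?_⟩
      have := cons _ a b c hF (by grind) (by grind) (by grind) hac hab hbc
      convert this using 1
      clear ih this hF
      ext w
      simp only [mem_insert, mem_sdiff, mem_singleton]
      grind
    · refine ⟨a, b, c, by simp, by simp, by simp, hac, hab, hbc, by grind, ?_⟩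
      convert hS using 1
      have := hab.ne
      have := hbc.ne
      grind

end PathFactor

/-! ### Chains: a criterion, and the deletion of a vertex -/

/-- There are no edges between two disjoint sets with one attachment each, unless they cover
everything. -/
theorem ConnOn.not_adj (hconn : ConnOn G S) {A B : Finset V} {a b d : V} (hA : A ⊆ S)
    (hB : B ⊆ S) (hd : d ∈ S) (hdA : d ∉ A) (hdB : d ∉ B) (hAB : Disjoint A B)
    (ha : ClosedUpTo G S A a) (hb : ClosedUpTo G S B b) {u v : V} (hu : u ∈ A) (hv : v ∈ B) :
    ¬ G.Adj u v := by
  intro huv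
  rw [disjoint_left] at hAB
  -- The edge makes `v` the attachment of `A` and `u` that of `B`, so no edge leaves `A ∪ B`, and
  -- connectivity puts `d` into it.
  have e1 : v = a := by have := ha u hu v (hB hv) huv; grind
  have e2 : u = b := by have := hb v hv u (hA hu) huv.symm; grind
  have := hconn (A ∪ B) (union_subset hA hB) ⟨u, by simp [hu]⟩ (by
    intro p hp q hq hpq
    rcases mem_union.1 hp with h | h
    · have := ha p h q hq hpq; grind
    · have := hb p h q hq hpq; grind)
  have := this hd
  grind

/-- By `ConnOn.not_adj`, two of three disjoint sets with one attachment each are not joined by an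
edge, so they cannot meet the same clique. Three sets and two cliques then contradict the pigeonhole
principle. The side conditions on `c` in the hypothesis are free, because the other two sets provide
vertices outside `T`. -/
theorem ChainOn.of_cliques (hconn : ConnOn G S) (M₁ M₂ : V → Prop) (h₁ : CliqueOn G M₁)
    (h₂ : CliqueOn G M₂)
    (h : ∀ T ⊆ S, T.Nonempty → ∀ c ∈ S, c ∉ T → ClosedUpTo G S T c → ¬ S ⊆ insert c T →
      (∃ u ∈ T, M₁ u) ∨ ∃ u ∈ T, M₂ u) : ChainOn G S := by
  refine ⟨hconn, ?_⟩
  have key2 : ∀ A B : Finset V, ∀ a b d, A ⊆ S → B ⊆ S → d ∈ S → d ∉ A → d ∉ B →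
      Disjoint A B → ClosedUpTo G S A a → ClosedUpTo G S B b →
      ∀ M, CliqueOn G M → (∃ u ∈ A, M u) → (∃ u ∈ B, M u) → False := by
    intro A B a b d hA hB hd hdA hdB hAB ha hb M hM ⟨u, hu, hu'⟩ ⟨v, hv, hv'⟩
    exact hconn.not_adj hA hB hd hdA hdB hAB ha hb hu hv
      (hM u v hu' hv' fun e => disjoint_left.1 hAB hu (e ▸ hv))
  have key3 : ∀ A : Finset V, ∀ a b d, A ⊆ S → A.Nonempty → b ∈ S → d ∈ S → b ∉ A → d ∉ A →
      b ≠ d → ClosedUpTo G S A a → (∃ u ∈ A, M₁ u) ∨ ∃ u ∈ A, M₂ u := by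
    intro A a b d hA hAn hb hd hbA hdA hbd ha
    have hne : ¬ S ⊆ insert a A := by
      intro hs
      have h1 := hs hb
      have h2 := hs hd
      simp only [mem_insert, hbA, hdA, or_false] at h1 h2
      exact hbd (h1.trans h2.symm)
    have hne' : a ∈ S ∧ a ∉ A := by
      by_contra hcon
      have := hconn A hA hAn (by
        intro p hp q hq hpq
        have := ha p hp q hq hpq; grind)
      exact hne (this.trans (subset_insert _ _))
    exact h A hA hAn a hne'.1 hne'.2 ha hne
  intro A B D a b d hA hB hD ⟨u, hu⟩ ⟨v, hv⟩ ⟨w, hw⟩ hAB hAD hBD ha hb hd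
  have uS := hA hu
  have vS := hB hv
  have wS := hD hw
  have uB := disjoint_left.1 hAB hu
  have uD := disjoint_left.1 hAD hu
  have vD := disjoint_left.1 hBD hv
  have vA := disjoint_right.1 hAB hv
  have wA := disjoint_right.1 hAD hw
  have wB := disjoint_right.1 hBD hw
  have kA := key3 A a v w hA ⟨u, hu⟩ vS wS vA wA (fun e => vD (e ▸ hw)) ha
  have kB := key3 B b u w hB ⟨v, hv⟩ uS wS uB wB (fun e => uD (e ▸ hw)) hb
  have kD := key3 D d u v hD ⟨w, hw⟩ uS vS uD vD (fun e => uB (e ▸ hv)) hd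
  have xAB := key2 A B a b w hA hB wS wA wB hAB ha hb
  have xAD := key2 A D a d v hA hD vS vA vD hAD ha hd
  have xBD := key2 B D b d u hB hD uS uB uD hBD hb hd
  rcases kA with kA | kA <;> rcases kB with kB | kB <;> rcases kD with kD | kD <;>
    first
      | exact xAB _ h₁ kA kB
      | exact xAB _ h₂ kA kB
      | exact xAD _ h₁ kA kD
      | exact xAD _ h₂ kA kD
      | exact xBD _ h₁ kB kD
      | exact xBD _ h₂ kB kD

theorem ConnOn.insert_adj (h : ConnOn G S) {x s : V} (hs : s ∈ S) (hx : G.Adj x s) :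
    ConnOn G (insert x S) := by
  intro A hA hn hcl
  have key : S ⊆ A := by
    by_cases hAS : (A ∩ S).Nonempty
    · have := h (A ∩ S) inter_subset_right hAS (by
        intro u hu w hw huw
        have := hcl u (mem_inter.1 hu).1 w (by simp [hw]) huw
        grind)
      grind
    · obtain ⟨a, ha⟩ := hn
      have hax : a = x := by
        have := hA ha
        by_contra hne
        exact hAS ⟨a, by grind⟩
      subst hax
      have := hcl a ha s (by simp [hs]) hx
      exact (hAS ⟨s, by grind⟩).elim
  have := hcl s (key hs) x (by simp) hx.symm
  grind

/-- Deleting a vertex of a 2-connected claw-free graph leaves a chain of blocks. -/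
theorem TwoConnOn.erase_chainOn (h : TwoConnOn G S) (hc : ClawFreeOn G S) {a : V} (ha : a ∈ S) :
    ChainOn G (S.erase a) := by
  have hconn : ConnOn G (S.erase a) := by
    intro A hA hn hcl
    have := h.2 A (hA.trans (erase_subset _ _)) hn a (by
      intro u hu w hw huw
      by_cases hwa : w = a
      · exact Or.inr hwa
      · exact Or.inl (hcl u hu w (by simp [hwa, hw]) huw))
    intro v hv
    have := this (mem_of_mem_erase hv)
    have := ne_of_mem_erase hv
    grind
  refine ⟨hconn, ?_⟩
  -- A set with one attachment in `S - a` that did not see `a` would have one attachment in `S`.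
  -- Hence three such sets provide the leaves of a claw at `a`.
  have key : ∀ A : Finset V, ∀ a' b d, A ⊆ S.erase a → A.Nonempty → b ∈ S.erase a → d ∈ S.erase a →
      b ∉ A → d ∉ A → b ≠ d → ClosedUpTo G (S.erase a) A a' → ∃ u ∈ A, G.Adj a u := by
    intro A a' b d hA hAn hb hd hbA hdA hbd hcl
    by_contra hno
    push Not at hno
    have := h.2 A (hA.trans (erase_subset _ _)) hAn a' (by
      intro u hu w hw huw
      by_cases hwa : w = a
      · exact (hno u hu (hwa ▸ huw.symm)).elim
      · exact hcl u hu w (by simp [hwa, hw]) huw)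
    have h1 := this (mem_of_mem_erase hb)
    have h2 := this (mem_of_mem_erase hd)
    simp only [mem_insert, hbA, hdA, or_false] at h1 h2
    exact hbd (h1.trans h2.symm)
  intro A B D a' b' d' hA hB hD ⟨u, hu⟩ ⟨v, hv⟩ ⟨w, hw⟩ hAB hAD hBD ha' hb' hd'
  have uS := hA hu
  have vS := hB hv
  have wS := hD hw
  have uB := disjoint_left.1 hAB hu
  have uD := disjoint_left.1 hAD hu
  have vD := disjoint_left.1 hBD hv
  have vA := disjoint_right.1 hAB hv
  have wA := disjoint_right.1 hAD hw
  have wB := disjoint_right.1 hBD hw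
  obtain ⟨p, hp, hap⟩ := key A a' v w hA ⟨u, hu⟩ vS wS vA wA (fun e => vD (e ▸ hw)) ha'
  obtain ⟨q, hq, haq⟩ := key B b' u w hB ⟨v, hv⟩ uS wS uB wB (fun e => uD (e ▸ hw)) hb'
  obtain ⟨r, hr, har⟩ := key D d' u v hD ⟨w, hw⟩ uS vS uD vD (fun e => uB (e ▸ hv)) hd'
  have x1 := hconn.not_adj hA hB wS wA wB hAB ha' hb' hp hq
  have x2 := hconn.not_adj hA hD vS vA vD hAD ha' hd' hp hr
  have x3 := hconn.not_adj hB hD uS uB uD hBD hb' hd' hq hr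
  have := hc a ha p (mem_of_mem_erase (hA hp)) q (mem_of_mem_erase (hB hq))
    r (mem_of_mem_erase (hD hr)) (fun e => disjoint_left.1 hAB hp (e ▸ hq))
    (fun e => disjoint_left.1 hAD hp (e ▸ hr)) (fun e => disjoint_left.1 hBD hq (e ▸ hr)) hap haq har
  tauto

theorem TwoConnOn.not_closedUpTo (h : TwoConnOn G S) {x d : V} (hT : T ⊆ S) (hn : T.Nonempty)
    (hx : x ∈ S) (hd : d ∈ S) (hxd : x ≠ d) (hxT : x ∉ T) (hdT : d ∉ T) (c : V) :
    ¬ ClosedUpTo G S T c := by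
  intro hcl
  have := h.2 T hT hn c hcl
  have h1 := this hx
  have h2 := this hd
  grind

/-! ### Two-vertex cuts and the pieces they leave -/

/-- `{x, d}` separates `Z` from the rest of `S`. -/
structure TwoCut (G : SimpleGraph V) (S Z : Finset V) (x d : V) : Prop where
  sub : Z ⊆ S
  nonempty : Z.Nonempty
  left_mem : x ∈ S
  right_mem : d ∈ S
  ne : x ≠ d
  left_notMem : x ∉ Z
  right_notMem : d ∉ Z
  closed : ∀ u ∈ Z, ∀ w ∈ S, G.Adj u w → w ∈ Z ∨ w = x ∨ w = d

namespace TwoCut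

variable {x d : V}

theorem symm (h : TwoCut G S Z x d) : TwoCut G S Z d x :=
  ⟨h.sub, h.nonempty, h.right_mem, h.left_mem, h.ne.symm, h.right_notMem, h.left_notMem,
    fun u hu w hw huw => by have := h.closed u hu w hw huw; tauto⟩

theorem not_closedUpTo (h : TwoCut G S Z x d) (hS : TwoConnOn G S) (hT : T ⊆ Z)
    (hn : T.Nonempty) (c : V) : ¬ ClosedUpTo G S T c :=
  hS.not_closedUpTo (hT.trans h.sub) hn h.left_mem h.right_mem h.ne
    (fun e => h.left_notMem (hT e)) (fun e => h.right_notMem (hT e)) c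

theorem exists_adj_left (h : TwoCut G S Z x d) (hS : TwoConnOn G S) : ∃ u ∈ Z, G.Adj x u := by
  by_contra hno
  push Not at hno
  refine h.not_closedUpTo hS subset_rfl h.nonempty d fun u hu w hw huw => ?_
  rcases h.closed u hu w hw huw with e | rfl | e
  · exact Or.inl e
  · exact (hno u hu huw.symm).elim
  · exact Or.inr e

theorem exists_adj_right (h : TwoCut G S Z x d) (hS : TwoConnOn G S) : ∃ u ∈ Z, G.Adj d u :=
  h.symm.exists_adj_left hS

theorem connOn_both (h : TwoCut G S Z x d) (hS : TwoConnOn G S) :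
    ConnOn G (insert x (insert d Z)) := by
  have hx := h.left_notMem
  have hd := h.right_notMem
  -- A union of components containing neither `x` nor `d`, or only `c` among them, becomes after
  -- removal of `c` a subset of `Z` attached to `S` through `c` alone; by 2-connectivity it is then
  -- empty.
  have key : ∀ T ⊆ insert x (insert d Z),
      (∀ u ∈ T, ∀ w ∈ insert x (insert d Z), G.Adj u w → w ∈ T) → ∀ c, c = x ∨ c = d →
      (∀ v, v = x ∨ v = d → v = c ∨ v ∉ T) → T ⊆ {c} := by
    intro T hT hcl c hc hv u hu
    by_contra huc
    have huc' : u ≠ c := by simpa using huc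
    refine h.not_closedUpTo hS (T := T.erase c) ?_ ⟨u, by simp [huc', hu]⟩ c ?_
    · intro w hw
      have := hT (mem_of_mem_erase hw)
      have := ne_of_mem_erase hw
      grind
    · intro p hp w hw hpw
      have hpT := mem_of_mem_erase hp
      have hpZ : p ∈ Z := by
        have := hT hpT
        have := ne_of_mem_erase hp
        grind
      have := h.closed p hpZ w hw hpw
      have := hcl p hpT w (by grind) hpw
      grind
  intro A hA hn hcl
  by_contra hno
  have hcl' : ∀ u ∈ insert x (insert d Z) \ A, ∀ w ∈ insert x (insert d Z), G.Adj u w →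
      w ∈ insert x (insert d Z) \ A := by
    intro u hu w hw huw
    by_contra hwA
    have := hcl w (by grind) u (by grind) huw.symm
    grind
  obtain ⟨z, hz⟩ := h.nonempty
  have hA' : insert x (insert d Z) \ A ⊆ insert x (insert d Z) := sdiff_subset
  have hne := h.ne
  have a1 := key A hA hcl
  have a2 := key _ hA' hcl'
  by_cases hxA : x ∈ A <;> by_cases hdA : d ∈ A
  · have e1 := a2 x (Or.inl rfl) (by grind)
    have e2 := a2 d (Or.inr rfl) (by grind)
    grind
  · have e1 := a1 x (Or.inl rfl) (by grind)
    have e2 := a2 d (Or.inr rfl) (by grind)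
    by_cases hzA : z ∈ A
    · have := e1 hzA
      grind
    · have := e2 (by grind : z ∈ _)
      grind
  · have e1 := a1 d (Or.inr rfl) (by grind)
    have e2 := a2 x (Or.inl rfl) (by grind)
    by_cases hzA : z ∈ A
    · have := e1 hzA
      grind
    · have := e2 (by grind : z ∈ _)
      grind
  · have e1 := a1 x (Or.inl rfl) (by grind)
    have e2 := a1 d (Or.inr rfl) (by grind)
    grind

theorem closedUpTo_of_subset (h : TwoCut G S Z x d) {W : Finset V} {c : V} (hT : T ⊆ Z)
    (hZW : Z ⊆ W) (hcl : ClosedUpTo G W T c) (hx : x ∈ W ∨ ∀ u ∈ T, ¬ G.Adj x u)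
    (hd : d ∈ W ∨ ∀ u ∈ T, ¬ G.Adj d u) : ClosedUpTo G S T c := by
  intro u hu w hw huw
  rcases h.closed u (hT hu) w hw huw with e | rfl | rfl
  · exact hcl u hu w (hZW e) huw
  · rcases hx with hx | hx
    · exact hcl u hu w hx huw
    · exact (hx u hu huw.symm).elim
  · rcases hd with hd | hd
    · exact hcl u hu w hd huw
    · exact (hd u hu huw.symm).elim

/-- The two ends of the chain are `x` and `d`: a set with one attachment that misses both lies in
`Z` and has the same single attachment in `S`, against 2-connectivity. -/
theorem chainOn_both (h : TwoCut G S Z x d) (hS : TwoConnOn G S) :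
    ChainOn G (insert x (insert d Z)) := by
  refine ChainOn.of_cliques (h.connOn_both hS) (· = x) (· = d) ?_ ?_ ?_
  · intro u v hu hv huv; exact (huv (hu.trans hv.symm)).elim
  · intro u v hu hv huv; exact (huv (hu.trans hv.symm)).elim
  intro T hT hn c hc hcT hcl _
  by_contra hno
  simp only [exists_eq_right, not_or] at hno
  have hTZ : T ⊆ Z := by
    intro u hu
    have := hT hu
    grind
  exact h.not_closedUpTo hS hTZ hn c
    (h.closedUpTo_of_subset hTZ (by grind) hcl (by simp) (by simp))

theorem connOn_left (h : TwoCut G S Z x d) (hS : TwoConnOn G S) : ConnOn G (insert x Z) := by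
  have key : ∀ T ⊆ insert x Z, (∀ u ∈ T, ∀ w ∈ insert x Z, G.Adj u w → w ∈ T) → x ∉ T →
      T = ∅ := by
    intro T hT hcl hx
    by_contra hne
    refine h.not_closedUpTo hS (T := T) (by grind) (nonempty_iff_ne_empty.2 hne) d ?_
    intro u hu w hw huw
    have := hcl u hu w
    have := h.closed u (by grind) w hw huw
    grind
  intro A hA hn hcl
  by_cases hx : x ∈ A
  · have := key (insert x Z \ A) sdiff_subset (by
      intro u hu w hw huw
      by_contra hwA
      have := hcl w (by grind) u (by grind) huw.symm
      grind) (by grind)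
    rwa [sdiff_eq_empty_iff_subset] at this
  · have := key A hA hcl hx
    grind

/-- With `d` removed, its neighbours in `Z` take over as the second end; being a clique, they can
serve in `ChainOn.of_cliques`. In `chainOn` the same happens at both ends. -/
theorem chainOn_left (h : TwoCut G S Z x d) (hS : TwoConnOn G S)
    (hcl : CliqueOn G fun u => u ∈ Z ∧ G.Adj d u) : ChainOn G (insert x Z) := by
  refine ChainOn.of_cliques (h.connOn_left hS) (· = x) _ ?_ hcl ?_
  · intro u v hu hv huv; exact (huv (hu.trans hv.symm)).elim
  intro T hT hn c hc hcT hcl _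
  by_contra hno
  simp only [exists_eq_right, not_or] at hno
  have hTZ : T ⊆ Z := by
    intro u hu
    have := hT hu
    grind
  exact h.not_closedUpTo hS hTZ hn c
    (h.closedUpTo_of_subset hTZ (by grind) hcl (by simp) (by grind))

theorem chainOn (h : TwoCut G S Z x d) (hS : TwoConnOn G S)
    (hcx : CliqueOn G fun u => u ∈ Z ∧ G.Adj x u)
    (hcd : CliqueOn G fun u => u ∈ Z ∧ G.Adj d u) : ChainOn G Z := by
  have key : ∀ T ⊆ Z, (∀ u ∈ T, ∀ w ∈ Z, G.Adj u w → w ∈ T) → T.Nonempty → ∃ u ∈ T, G.Adj x u := by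
    intro T hT hcl hn
    by_contra hne
    push Not at hne
    refine h.not_closedUpTo hS hT hn d ?_
    intro u hu w hw huw
    have := hcl u hu w
    have := hne u hu
    have := huw.symm
    have := h.closed u (hT hu) w hw huw
    grind
  refine ChainOn.of_cliques ?_ _ _ hcx hcd ?_
  · intro A hA hn hcl
    by_contra hno
    obtain ⟨u, hu, hxu⟩ := key A hA hcl hn
    obtain ⟨v, hv, hxv⟩ := key (Z \ A) sdiff_subset (by
      intro u hu w hw huw
      by_contra hwA
      have := hcl w (by grind) u (by grind) huw.symm
      grind) (sdiff_nonempty.2 hno)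
    have := hcx u v ⟨hA hu, hxu⟩ ⟨(mem_sdiff.1 hv).1, hxv⟩ (by grind)
    have := hcl u hu v (mem_sdiff.1 hv).1 this
    grind
  intro T hT hn c hc hcT hcl _
  by_contra hno
  exact h.not_closedUpTo hS hT hn c
    (h.closedUpTo_of_subset hT subset_rfl hcl (by grind) (by grind))

theorem card_both (h : TwoCut G S Z x d) : #(insert x (insert d Z)) = #Z + 2 := by
  have := h.left_notMem
  have := h.right_notMem
  have := h.ne
  rw [card_insert_of_notMem (by grind), card_insert_of_notMem (by grind)]

/-- The edge `x d` keeps `x` and `d` from lying on opposite sides of a cut vertex. One of the two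
sides therefore lies inside `Z` and would be cut off by one vertex in `S` as well. -/
theorem twoConnOn (h : TwoCut G S Z x d) (hS : TwoConnOn G S) (hxd : G.Adj x d) :
    TwoConnOn G (insert x (insert d Z)) := by
  refine ⟨by have := h.nonempty.card_pos; rw [h.card_both]; omega, ?_⟩
  have hx := h.left_notMem
  have hd := h.right_notMem
  have hne := h.ne
  have key : ∀ T ⊆ Z, ∀ c, ClosedUpTo G (insert x (insert d Z)) T c → T = ∅ := by
    intro T hT c hcl
    by_contra hne
    exact h.not_closedUpTo hS hT (nonempty_iff_ne_empty.2 hne) c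
      (h.closedUpTo_of_subset hT (by grind) hcl (by simp) (by simp))
  intro A hA hn c hcl
  have hcl' : ClosedUpTo G (insert x (insert d Z)) (insert x (insert d Z) \ insert c A) c := by
    intro u hu w hw huw
    by_contra hwA
    have := hcl w (by grind) u (by grind) huw.symm
    grind
  have k1 := key A
  have k2 := fun hs => key _ hs c hcl'
  have h1 := fun h => hcl x h d (by simp) hxd
  have h2 := fun h => hcl d h x (by simp) hxd.symm
  by_cases hxA : x ∈ A <;> by_cases hdA : d ∈ A
  · have := k2 (by grind)
    rwa [sdiff_eq_empty_iff_subset] at this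
  · have := k2 (by grind)
    rwa [sdiff_eq_empty_iff_subset] at this
  · have := k2 (by grind)
    rwa [sdiff_eq_empty_iff_subset] at this
  · have := k1 (by grind) c hcl
    grind

/-- Attaching a further vertex `v` to the end `x` of the chain. -/
theorem chainOn_both_insert (h : TwoCut G S Z x d) (hS : TwoConnOn G S) {v : V}
    (hvx : G.Adj v x) : ChainOn G (insert v (insert x (insert d Z))) := by
  by_cases hvW : v ∈ insert x (insert d Z)
  · rw [insert_eq_of_mem hvW]; exact h.chainOn_both hS
  have hconn := h.connOn_both hS
  refine ChainOn.of_cliques (hconn.insert_adj (by simp) hvx) (· = v) (· = d) ?_ ?_ ?_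
  · intro u v hu hv huv; exact (huv (hu.trans hv.symm)).elim
  · intro u v hu hv huv; exact (huv (hu.trans hv.symm)).elim
  intro T hT hn c hc hcT hcl hno'
  by_contra hno
  simp only [exists_eq_right, not_or] at hno
  have hT' : T ⊆ insert x (insert d Z) := by
    intro u hu
    have := hT hu
    grind
  by_cases hxT : x ∈ T
  · have hvc := (hcl x hxT v (by simp) hvx.symm).resolve_left hno.1
    subst hvc
    have := hconn T hT' hn fun p hp q hq hpq =>
      (hcl p hp q (mem_insert_of_mem hq) hpq).resolve_right fun e => hvW (e ▸ hq)
    exact hno' (insert_subset_insert _ this)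
  · have hTZ : T ⊆ Z := by
      intro u hu
      have := hT' hu
      grind
    exact h.not_closedUpTo hS hTZ hn c
      (h.closedUpTo_of_subset hTZ (by grind) hcl (by simp) (by simp))

theorem chainOn_left_insert (h : TwoCut G S Z x d) (hS : TwoConnOn G S)
    (hcd : CliqueOn G fun u => u ∈ Z ∧ G.Adj d u) {v : V}
    (hvx : G.Adj v x) : ChainOn G (insert v (insert x Z)) := by
  by_cases hvW : v ∈ insert x Z
  · rw [insert_eq_of_mem hvW]; exact h.chainOn_left hS hcd
  have hconn := h.connOn_left hS
  refine ChainOn.of_cliques (hconn.insert_adj (by simp) hvx) (· = v) _ ?_ hcd ?_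
  · intro u v hu hv huv; exact (huv (hu.trans hv.symm)).elim
  intro T hT hn c hc hcT hcl hno'
  by_contra hno
  simp only [exists_eq_right, not_or] at hno
  have hT' : T ⊆ insert x Z := by
    intro u hu
    have := hT hu
    grind
  by_cases hxT : x ∈ T
  · have hvc := (hcl x hxT v (by simp) hvx.symm).resolve_left hno.1
    subst hvc
    have := hconn T hT' hn fun p hp q hq hpq =>
      (hcl p hp q (mem_insert_of_mem hq) hpq).resolve_right fun e => hvW (e ▸ hq)
    exact hno' (insert_subset_insert _ this)
  · have hTZ : T ⊆ Z := by
      intro u hu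
      have := hT' hu
      grind
    exact h.not_closedUpTo hS hTZ hn c
      (h.closedUpTo_of_subset hTZ (by grind) hcl (by simp) (by grind))

/-- The path `x v d` plays the part of the edge `x d` in `twoConnOn`; only the cut vertex `v` itself
needs the connectivity of the remaining piece. -/
theorem twoConnOn_insert (h : TwoCut G S Z x d) (hS : TwoConnOn G S) {v : V} (hv : v ∉ S)
    (hvx : G.Adj v x) (hvd : G.Adj v d) : TwoConnOn G (insert v (insert x (insert d Z))) := by
  have hvW : v ∉ insert x (insert d Z) := by
    have := h.left_mem
    have := h.right_mem
    have := h.sub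
    grind
  refine ⟨by rw [card_insert_of_notMem hvW, h.card_both]; have := h.nonempty.card_pos; omega, ?_⟩
  have hconn := h.connOn_both hS
  have key : ∀ T ⊆ Z, ∀ c, ClosedUpTo G (insert v (insert x (insert d Z))) T c → T = ∅ := by
    intro T hT c hcl
    by_contra hne
    exact h.not_closedUpTo hS hT (nonempty_iff_ne_empty.2 hne) c
      (h.closedUpTo_of_subset hT (by grind) hcl (by simp) (by simp))
  intro A hA hn c hcl
  have hcl' : ClosedUpTo G (insert v (insert x (insert d Z)))
      (insert v (insert x (insert d Z)) \ insert c A) c := by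
    intro u hu w hw huw
    by_contra hwA
    have := hcl w (by grind) u (by grind) huw.symm
    grind
  by_cases hvc : v = c
  · subst hvc
    by_cases hvA : v ∈ A
    · have := hcl
      have hconn' := hconn.insert_adj (by simp) hvx
      have := hconn' A hA hn (by
        intro p hp q hq hpq
        have := hcl p hp q hq hpq
        grind)
      grind
    · have := hconn A (by grind) hn (by
        intro p hp q hq hpq
        have := hcl p hp q (by grind) hpq
        grind)
      grind
  by_cases hvA : v ∈ A
  · have h1 := hcl v hvA x (by simp) hvx
    have h2 := hcl v hvA d (by simp) hvd
    have := key _ (by grind) c hcl'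
    rwa [sdiff_eq_empty_iff_subset] at this
  · have hvB : v ∈ insert v (insert x (insert d Z)) \ insert c A := by grind
    have h1 := hcl' v hvB x (by simp) hvx
    have h2 := hcl' v hvB d (by simp) hvd
    have hcA : A = ∅ ∨ c ∈ A := by
      by_cases hc : c ∈ A
      · exact Or.inr hc
      · exact Or.inl (key A (by grind) c hcl)
    rcases hcA with rfl | hc
    · simp at hn
    · have hconn' := hconn.insert_adj (by simp) hvx
      have := hconn' A hA hn (by
        intro p hp q hq hpq
        have := hcl p hp q hq hpq
        grind)
      grind

theorem not_adj_of_disjoint {Y : Finset V} (h : TwoCut G S Z x d) (h' : TwoCut G S Y x d)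
    (hd : ∀ u ∈ Y, u ∉ Z) : ∀ u ∈ Z, ∀ v ∈ Y, ¬ G.Adj u v := by
  intro u hu v hv huv
  rcases h.closed u hu v (h'.sub hv) huv with e | rfl | rfl
  · exact hd v hv e
  · exact h'.left_notMem hv
  · exact h'.right_notMem hv

/-- By 2-connectivity `x` also has a neighbour in `Y`, which sees nothing of `Z`; together with two
nonadjacent neighbours of `x` in `Z` it would form a claw. -/
theorem cliqueOn_left {Y : Finset V} (h : TwoCut G S Z x d) (h' : TwoCut G S Y x d)
    (hd : ∀ u ∈ Y, u ∉ Z) (hS : TwoConnOn G S) (hc : ClawFreeOn G S) :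
    CliqueOn G fun u => u ∈ Z ∧ G.Adj x u := by
  obtain ⟨y, hy, hoy⟩ := h'.exists_adj_left hS
  rintro u v ⟨hu, hou⟩ ⟨hv, hov⟩ huv
  have h1 := h.not_adj_of_disjoint h' hd u hu y hy
  have h2 := h.not_adj_of_disjoint h' hd v hv y hy
  have := hc x h.left_mem u (h.sub hu) v (h.sub hv) y (h'.sub hy) huv
    (fun e => hd y hy (e ▸ hu)) (fun e => hd y hy (e ▸ hv)) hou hov hoy
  tauto

theorem cliqueOn_right {Y : Finset V} (h : TwoCut G S Z x d) (h' : TwoCut G S Y x d)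
    (hd : ∀ u ∈ Y, u ∉ Z) (hS : TwoConnOn G S) (hc : ClawFreeOn G S) :
    CliqueOn G fun u => u ∈ Z ∧ G.Adj d u :=
  h.symm.cliqueOn_left h'.symm hd hS hc

end TwoCut

/-! ### Cut vertices and the pieces they leave -/

/-- The vertex `c` separates `S` into the nonempty sides `A` and `B`. -/
structure CutSplit (G : SimpleGraph V) (S A : Finset V) (c : V) (B : Finset V) : Prop where
  eq : S = insert c (A ∪ B)
  left_nonempty : A.Nonempty
  right_nonempty : B.Nonempty
  disj : Disjoint A B
  notMem_left : c ∉ A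
  notMem_right : c ∉ B
  not_adj : ∀ u ∈ A, ∀ w ∈ B, ¬ G.Adj u w

/-- Serves to carry separated sets from a piece back to `S`: the set containing the cut vertex is
enlarged by the far side `B`, and of two disjoint sets at most one is enlarged. -/
theorem disjoint_ite_union {T T' B : Finset V} {p q : Prop} [Decidable p] [Decidable q]
    (h : Disjoint T T') (hp : p → Disjoint B T') (hq : q → Disjoint T B) (hpq : p → ¬ q) :
    Disjoint (if p then T ∪ B else T) (if q then T' ∪ B else T') := by
  split_ifs with h1 h2 h2
  · exact (hpq h1 h2).elim
  · exact disjoint_union_left.2 ⟨h, hp h1⟩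
  · exact disjoint_union_right.2 ⟨h, hq h2⟩
  · exact h

theorem ConnOn.exists_cutSplit (h : ConnOn G S) (hS : 3 ≤ #S) (hno : ¬ TwoConnOn G S) :
    ∃ A c B, CutSplit G S A c B := by
  unfold TwoConnOn at hno
  push Not at hno
  obtain ⟨A, hA, hn, c, hcl, hs⟩ := hno hS
  have hc : c ∈ S ∧ c ∉ A := by
    by_contra hcon
    have := h A hA hn (by
      intro u hu w hw huw
      have := hcl u hu w hw huw
      grind)
    exact hs (this.trans (subset_insert _ _))
  refine ⟨A, c, S \ insert c A, ?_, hn, sdiff_nonempty.2 hs, ?_, hc.2, by simp, ?_⟩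
  · grind
  · rw [disjoint_left]; grind
  · intro u hu w hw huw
    have := hcl u hu w (mem_sdiff.1 hw).1 huw
    grind

namespace CutSplit

variable {A B : Finset V} {c : V}

theorem symm (h : CutSplit G S A c B) : CutSplit G S B c A :=
  ⟨by rw [h.eq, union_comm], h.right_nonempty, h.left_nonempty, h.disj.symm, h.notMem_right,
    h.notMem_left, fun u hu w hw huw => h.not_adj w hw u hu huw.symm⟩

theorem card (h : CutSplit G S A c B) : #S = #A + #B + 1 := by
  have := h.notMem_left
  have := h.notMem_right
  rw [h.eq, card_insert_of_notMem (by grind), card_union_of_disjoint h.disj]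

theorem mem (h : CutSplit G S A c B) : c ∈ S := by rw [h.eq]; simp

theorem left_sub (h : CutSplit G S A c B) : A ⊆ S := by rw [h.eq]; grind

theorem right_sub (h : CutSplit G S A c B) : B ⊆ S := h.symm.left_sub

theorem mem_or (h : CutSplit G S A c B) {v : V} (hv : v ∈ S) : v = c ∨ v ∈ A ∨ v ∈ B := by
  rw [h.eq] at hv; simpa using hv

theorem closedUpTo (h : CutSplit G S A c B) : ClosedUpTo G S A c := by
  intro u hu w hw huw
  rcases h.mem_or hw with e | e | e
  · exact Or.inr e
  · exact Or.inl e
  · exact (h.not_adj u hu w e huw).elim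

theorem exists_adj (h : CutSplit G S A c B) (hS : ConnOn G S) : ∃ u ∈ A, G.Adj c u := by
  by_contra hno
  push Not at hno
  have := hS A h.left_sub h.left_nonempty (by
    intro u hu w hw huw
    rcases h.closedUpTo u hu w hw huw with e | rfl
    · exact e
    · exact (hno u hu huw.symm).elim)
  exact h.notMem_left (this h.mem)

theorem cliqueOn (h : CutSplit G S A c B) (hS : ConnOn G S) (hc : ClawFreeOn G S) :
    CliqueOn G fun u => u ∈ A ∧ G.Adj c u := by
  obtain ⟨b, hb, hcb⟩ := h.symm.exists_adj hS
  rintro u v ⟨hu, hcu⟩ ⟨hv, hcv⟩ huv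
  have h1 : u ≠ b := fun e => disjoint_left.1 h.disj hu (e ▸ hb)
  have h2 : v ≠ b := fun e => disjoint_left.1 h.disj hv (e ▸ hb)
  have := hc c h.mem u (h.left_sub hu) v (h.left_sub hv) b (h.right_sub hb) huv h1 h2 hcu hcv hcb
  have := h.not_adj u hu b hb
  have := h.not_adj v hv b hb
  tauto

theorem connOn_insert (h : CutSplit G S A c B) (hS : ConnOn G S) : ConnOn G (insert c A) := by
  intro C hC hn hcl
  by_cases hcC : c ∈ C
  · have := hS (C ∪ B) (by have := h.eq; grind) ⟨c, by simp [hcC]⟩ (by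
      intro u hu w hw huw
      rcases h.mem_or hw with rfl | e | e
      · simp [hcC]
      · rcases mem_union.1 hu with hu | hu
        · exact mem_union_left _ (hcl u hu w (by simp [e]) huw)
        · exact (h.not_adj w e u hu huw.symm).elim
      · exact mem_union_right _ e)
    intro u hu
    rcases mem_insert.1 hu with rfl | hu
    · exact hcC
    · have h2 := this (h.left_sub hu)
      have := disjoint_left.1 h.disj hu
      grind
  · have hCA : C ⊆ A := by
      intro u hu
      have := hC hu
      grind
    have := hS C (hCA.trans h.left_sub) hn (by
      intro u hu w hw huw
      rcases h.closedUpTo u (hCA hu) w hw huw with e | rfl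
      · exact hcl u hu w (by simp [e]) huw
      · exact hcl u hu w (by simp) huw)
    exact (hcC (this h.mem)).elim

/-- A set containing `c` keeps its single attachment in `S` once `B` is added to it, and a set
avoiding `c` keeps it unchanged. So three separated sets in the piece would give three in `S`. -/
theorem chainOn_insert (h : CutSplit G S A c B) (hS : ChainOn G S) : ChainOn G (insert c A) := by
  refine ⟨h.connOn_insert hS.1, ?_⟩
  have key : ∀ T ⊆ insert c A, ∀ t, ClosedUpTo G (insert c A) T t →
      ClosedUpTo G S (if c ∈ T then T ∪ B else T) t := by
    intro T hT t hcl
    split_ifs with hcT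
    · intro u hu w hw huw
      rcases h.mem_or hw with rfl | e | e
      · simp [hcT]
      · rcases mem_union.1 hu with hu | hu
        · have := hcl u hu w (by simp [e]) huw
          grind
        · exact (h.not_adj w e u hu huw.symm).elim
      · simp [e]
    · intro u hu w hw huw
      have huA : u ∈ A := by
        have := hT hu
        grind
      rcases h.closedUpTo u huA w hw huw with e | rfl
      · exact hcl u hu w (by simp [e]) huw
      · exact hcl u hu w (by simp) huw
  have sub : ∀ T ⊆ insert c A, (if c ∈ T then T ∪ B else T) ⊆ S := by
    intro T hT
    have := h.eq
    grind
  have ne : ∀ T : Finset V, T.Nonempty → (if c ∈ T then T ∪ B else T).Nonempty := by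
    rintro T ⟨t, ht⟩
    exact ⟨t, by grind⟩
  have dis : ∀ T T' : Finset V, T ⊆ insert c A → T' ⊆ insert c A → Disjoint T T' →
      Disjoint (if c ∈ T then T ∪ B else T) (if c ∈ T' then T' ∪ B else T') := by
    intro T T' hT hT' hd
    have h1 := h.notMem_right
    have h2 := disjoint_left.1 h.disj
    rw [disjoint_left] at hd
    refine disjoint_ite_union (disjoint_left.2 hd) (fun hc => disjoint_left.2 fun u hu hu' => ?_)
      (fun hc => disjoint_left.2 fun u hu hu' => ?_) fun hc => hd hc
    · have := hT' hu'
      grind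
    · have := hT hu
      grind
  intro T₁ T₂ T₃ t₁ t₂ t₃ h₁ h₂ h₃ n₁ n₂ n₃ d₁₂ d₁₃ d₂₃ cl₁ cl₂ cl₃
  exact hS.2 _ _ _ t₁ t₂ t₃ (sub _ h₁) (sub _ h₂) (sub _ h₃) (ne _ n₁) (ne _ n₂) (ne _ n₃)
    (dis _ _ h₁ h₂ d₁₂) (dis _ _ h₁ h₃ d₁₃) (dis _ _ h₂ h₃ d₂₃) (key _ h₁ _ cl₁) (key _ h₂ _ cl₂)
    (key _ h₃ _ cl₃)

/-- The far side `B` is shrunk to one pendant vertex `b`, and is restored by adding it to the set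
that contains `b`. -/
theorem chainOn_insert_insert (h : CutSplit G S A c B) (hS : ChainOn G S) {b : V} (hb : b ∈ B)
    (hcb : G.Adj c b) : ChainOn G (insert b (insert c A)) := by
  have hconn := (h.connOn_insert hS.1).insert_adj (mem_insert_self _ _) hcb.symm
  have hcB := h.notMem_right
  have hcA := h.notMem_left
  have hbA := disjoint_right.1 h.disj hb
  refine ⟨hconn, ?_⟩
  have key : ∀ T ⊆ insert b (insert c A), (c ∈ T → b ∈ T) → ∀ t,
      ClosedUpTo G (insert b (insert c A)) T t →
      ClosedUpTo G S (if b ∈ T then T ∪ B else T) t := by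
    intro T hT hbT t hcl
    split_ifs with hbT'
    · intro u hu w hw huw
      rcases h.mem_or hw with rfl | e | e
      · have := hcl b hbT' w (by simp) hcb.symm
        grind
      · rcases mem_union.1 hu with hu | hu
        · have := hcl u hu w (by simp [e]) huw
          grind
        · exact (h.not_adj w e u hu huw.symm).elim
      · simp [e]
    · intro u hu w hw huw
      have huA : u ∈ A := by
        have := hT hu
        grind
      rcases h.closedUpTo u huA w hw huw with e | rfl
      · exact hcl u hu w (by simp [e]) huw
      · exact hcl u hu w (by simp) huw
  have sub : ∀ T ⊆ insert b (insert c A), (if b ∈ T then T ∪ B else T) ⊆ S := by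
    intro T hT
    have := h.eq
    grind
  have ne : ∀ T : Finset V, T.Nonempty → (if b ∈ T then T ∪ B else T).Nonempty := by
    rintro T ⟨t, ht⟩
    exact ⟨t, by grind⟩
  have dis : ∀ T T' : Finset V, T ⊆ insert b (insert c A) → T' ⊆ insert b (insert c A) →
      Disjoint T T' →
      Disjoint (if b ∈ T then T ∪ B else T) (if b ∈ T' then T' ∪ B else T') := by
    intro T T' hT hT' hd
    have h2 := disjoint_left.1 h.disj
    rw [disjoint_left] at hd
    refine disjoint_ite_union (disjoint_left.2 hd) (fun hc => disjoint_left.2 fun u hu hu' => ?_)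
      (fun hc => disjoint_left.2 fun u hu hu' => ?_) fun hc => hd hc
    · have := hT' hu'
      grind
    · have := hT hu
      grind
  -- A set containing `c` but not `b` has `b` as its attachment. Adding the pendant `b` then
  -- exhausts the piece and leaves only `b` for two disjoint nonempty sets.
  have both : ∀ T T' T'' : Finset V, T ⊆ insert b (insert c A) → T' ⊆ insert b (insert c A) →
      T'' ⊆ insert b (insert c A) → T'.Nonempty → T''.Nonempty → Disjoint T T' → Disjoint T T'' →
      Disjoint T' T'' → ∀ t, ClosedUpTo G (insert b (insert c A)) T t → c ∈ T → b ∈ T := by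
    intro T T' T'' hT hT' hT'' ⟨p, hp⟩ ⟨q, hq⟩ d1 d2 d3 t hcl hcT
    by_contra hbT
    have := (hcl c hcT b (by simp) hcb).resolve_left hbT
    subst this
    have := hconn (insert b T) (by grind) (by simp) (by
      intro u hu w hw huw
      by_cases hwA : w = c
      · grind
      rcases mem_insert.1 hu with rfl | hu
      · have := fun e => h.not_adj w e u hb huw.symm
        grind
      · have := hcl u hu w hw huw
        grind)
    have h1 := this (hT' hp)
    have h2 := this (hT'' hq)
    rw [disjoint_left] at *
    grind
  intro T₁ T₂ T₃ t₁ t₂ t₃ h₁ h₂ h₃ n₁ n₂ n₃ d₁₂ d₁₃ d₂₃ cl₁ cl₂ cl₃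
  have b₁ := both T₁ T₂ T₃ h₁ h₂ h₃ n₂ n₃ d₁₂ d₁₃ d₂₃ t₁ cl₁
  have b₂ := both T₂ T₁ T₃ h₂ h₁ h₃ n₁ n₃ d₁₂.symm d₂₃ d₁₃ t₂ cl₂
  have b₃ := both T₃ T₁ T₂ h₃ h₁ h₂ n₁ n₂ d₁₃.symm d₂₃.symm d₁₂ t₃ cl₃
  exact hS.2 _ _ _ t₁ t₂ t₃ (sub _ h₁) (sub _ h₂) (sub _ h₃) (ne _ n₁) (ne _ n₂) (ne _ n₃)
    (dis _ _ h₁ h₂ d₁₂) (dis _ _ h₁ h₃ d₁₃) (dis _ _ h₂ h₃ d₂₃) (key _ h₁ b₁ _ cl₁)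
    (key _ h₂ b₂ _ cl₂) (key _ h₃ b₃ _ cl₃)

/-- The neighbours of `c` in `A` form a clique, so at most one of three separated sets meets them.
That set, enlarged by `c` and `B`, still has one attachment in `S`, and the other two are unaffected
by restoring `c`. -/
theorem chainOn (h : CutSplit G S A c B) (hS : ChainOn G S) (hc : ClawFreeOn G S) :
    ChainOn G A := by
  have hcl := h.cliqueOn hS.1 hc
  have hcA := h.notMem_left
  have hcB := h.notMem_right
  have key : ∀ T ⊆ A, ∀ t, ClosedUpTo G A T t → (∀ u ∈ T, ¬ G.Adj c u) → ClosedUpTo G S T t := by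
    intro T hT t ht hno u hu w hw huw
    rcases h.closedUpTo u (hT hu) w hw huw with e | rfl
    · exact ht u hu w e huw
    · exact (hno u hu huw.symm).elim
  have key2 : ∀ T ⊆ A, ∀ t, ClosedUpTo G A T t → (∃ u ∈ T, G.Adj c u) →
      ClosedUpTo G S (insert c (T ∪ B)) t := by
    rintro T hT t ht ⟨v, hv, hcv⟩ u hu w hw huw
    rcases h.mem_or hw with rfl | hwA | hwB
    · simp
    · by_cases hwT : w ∈ T
      · simp [hwT]
      rcases mem_insert.1 hu with rfl | hu
      · have := hcl v w ⟨hT hv, hcv⟩ ⟨hwA, huw⟩ (fun e => hwT (e ▸ hv))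
        have := ht v hv w hwA this
        tauto
      · rcases mem_union.1 hu with hu | hu
        · have := ht u hu w hwA huw
          tauto
        · exact (h.not_adj w hwA u hu huw.symm).elim
    · simp [hwB]
  have hconn : ConnOn G A := by
    have key3 : ∀ C ⊆ A, (∀ u ∈ C, ∀ w ∈ A, G.Adj u w → w ∈ C) → C.Nonempty →
        ∃ u ∈ C, G.Adj c u := by
      intro C hC hcC hn
      by_contra hno
      push Not at hno
      have := hS.1 C (hC.trans h.left_sub) hn (by
        intro u hu w hw huw
        rcases h.closedUpTo u (hC hu) w hw huw with e | rfl
        · exact hcC u hu w e huw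
        · exact (hno u hu huw.symm).elim)
      exact hcA (hC (this h.mem))
    intro C hC hn hcC
    by_contra hno
    obtain ⟨u, hu, hcu⟩ := key3 C hC hcC hn
    obtain ⟨v, hv, hcv⟩ := key3 (A \ C) sdiff_subset (by
      intro u hu w hw huw
      by_contra hwA
      have := hcC w (by grind) u (by grind) huw.symm
      grind) (sdiff_nonempty.2 hno)
    have hv' := mem_sdiff.1 hv
    have := hcl u v ⟨hC hu, hcu⟩ ⟨hv'.1, hcv⟩ (fun e => hv'.2 (e ▸ hu))
    exact hv'.2 (hcC u hu v hv'.1 this)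
  refine ⟨hconn, ?_⟩
  have atmost : ∀ T T' T'' : Finset V, T ⊆ A → T' ⊆ A → T'' ⊆ A → T''.Nonempty → Disjoint T T' →
      Disjoint T T'' → Disjoint T' T'' → ∀ t t', ClosedUpTo G A T t → ClosedUpTo G A T' t' →
      (∃ u ∈ T, G.Adj c u) → ∀ u ∈ T', ¬ G.Adj c u := by
    rintro T T' T'' hT hT' hT'' ⟨p, hp⟩ d1 d2 d3 t t' ht ht' ⟨u, hu, hcu⟩ v hv hcv
    exact hconn.not_adj hT hT' (hT'' hp) (disjoint_right.1 d2 hp) (disjoint_right.1 d3 hp) d1 ht ht'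
      hu hv (hcl u v ⟨hT hu, hcu⟩ ⟨hT' hv, hcv⟩ (fun e => disjoint_left.1 d1 hu (e ▸ hv)))
  have bad : ∀ T T' T'' : Finset V, T ⊆ A → T' ⊆ A → T'' ⊆ A → T.Nonempty → T'.Nonempty →
      T''.Nonempty → Disjoint T T' →
      Disjoint T T'' → Disjoint T' T'' → ∀ t t' t'', ClosedUpTo G A T t → ClosedUpTo G A T' t' →
      ClosedUpTo G A T'' t'' → (∃ u ∈ T, G.Adj c u) → False := by
    intro T T' T'' hT hT' hT'' hn hn' hn'' d1 d2 d3 t t' t'' ht ht' ht'' hm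
    have k1 := key T' hT' t' ht' (atmost T T' T'' hT hT' hT'' hn'' d1 d2 d3 t t' ht ht' hm)
    have k2 := key T'' hT'' t'' ht''
      (atmost T T'' T' hT hT'' hT' hn' d2 d1 d3.symm t t'' ht ht'' hm)
    refine hS.2 (insert c (T ∪ B)) T' T'' t t' t'' ?_ (hT'.trans h.left_sub)
      (hT''.trans h.left_sub) (by simp) hn' hn'' ?_ ?_ d3 (key2 T hT t ht hm) k1 k2
    · have := h.eq
      grind
    · have := h.disj
      rw [disjoint_left] at *
      grind
    · have := h.disj
      rw [disjoint_left] at *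
      grind
  intro T₁ T₂ T₃ t₁ t₂ t₃ h₁ h₂ h₃ n₁ n₂ n₃ d₁₂ d₁₃ d₂₃ cl₁ cl₂ cl₃
  have b₁ := bad T₁ T₂ T₃ h₁ h₂ h₃ n₁ n₂ n₃ d₁₂ d₁₃ d₂₃ t₁ t₂ t₃ cl₁ cl₂ cl₃
  have b₂ := bad T₂ T₁ T₃ h₂ h₁ h₃ n₂ n₁ n₃ d₁₂.symm d₂₃ d₁₃ t₂ t₁ t₃ cl₂ cl₁ cl₃
  have b₃ := bad T₃ T₁ T₂ h₃ h₁ h₂ n₃ n₁ n₂ d₁₃.symm d₂₃.symm d₁₂ t₃ t₁ t₂ cl₃ cl₁ cl₂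
  simp only [imp_false, not_exists, not_and] at b₁ b₂ b₃
  exact hS.2 T₁ T₂ T₃ t₁ t₂ t₃ (h₁.trans h.left_sub) (h₂.trans h.left_sub) (h₃.trans h.left_sub)
    n₁ n₂ n₃ d₁₂ d₁₃ d₂₃ (key _ h₁ _ cl₁ b₁) (key _ h₂ _ cl₂ b₂) (key _ h₃ _ cl₃ b₃)

end CutSplit

/-! ### Deleting an edge -/

theorem deleteEdge_adj {x y u v : V} : (G.deleteEdges {s(x, y)}).Adj u v ↔
    G.Adj u v ∧ ¬ (u = x ∧ v = y) ∧ ¬ (u = y ∧ v = x) := by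
  simp [SimpleGraph.deleteEdges_adj]

/-- Deleting an edge of a 2-connected graph leaves a chain of blocks. -/
theorem TwoConnOn.deleteEdge_chainOn (h : TwoConnOn G S) {x y : V} (hxy : G.Adj x y) (hx : x ∈ S)
    (hy : y ∈ S) : ChainOn (G.deleteEdges {s(x, y)}) S := by
  have hne := hxy.ne
  refine ChainOn.of_cliques ?_ (· = x) (· = y) ?_ ?_ ?_
  -- A union of components of the graph without `x y` that contains one end of the edge can be left
  -- in `G` only through the other end, so by 2-connectivity it misses at most that end.
  · have key : ∀ C : Finset V, (∀ u ∈ C, ∀ w ∈ S, (G.deleteEdges {s(x, y)}).Adj u w → w ∈ C) →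
        C ⊆ S → ∀ x' y', (x' = x ∧ y' = y ∨ x' = y ∧ y' = x) → x' ∈ C → S ⊆ insert y' C := by
      intro C hcl hC x' y' hx'y' hx'
      refine h.2 C hC ⟨x', hx'⟩ y' fun u hu w hw huw => ?_
      have := hcl u hu w hw
      rw [deleteEdge_adj] at this
      grind
    intro C hC hn hcl
    by_contra hno
    have hcl' : ∀ u ∈ S \ C, ∀ w ∈ S, (G.deleteEdges {s(x, y)}).Adj u w → w ∈ S \ C := by
      intro u hu w hw huw
      by_contra hwA
      have := hcl w (by grind) u (by grind) huw.symm
      grind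
    have hcard : ∃ v ∈ S, v ≠ x ∧ v ≠ y := by
      by_contra hcon
      push Not at hcon
      have : S ⊆ {x, y} := by intro v hv; have := hcon v hv; grind
      have := card_le_card this
      have := h.1
      have := card_le_two (a := x) (b := y)
      omega
    obtain ⟨v, hv, hvx, hvy⟩ := hcard
    have k1 := key C hcl hC
    have k2 := key (S \ C) hcl' sdiff_subset
    by_cases hxC : x ∈ C <;> by_cases hyC : y ∈ C
    · have := k1 x y (by simp) hxC
      grind
    · have e1 := k1 x y (by simp) hxC hv
      have e2 := k2 y x (by simp) (by grind) hv
      grind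
    · have e1 := k1 y x (by simp) hyC hv
      have e2 := k2 x y (by simp) (by grind) hv
      grind
    · have e1 := k2 x y (by simp) (by grind)
      obtain ⟨w, hw⟩ := hn
      have := e1 (hC hw)
      grind
  · intro u v hu hv huv; exact (huv (hu.trans hv.symm)).elim
  · intro u v hu hv huv; exact (huv (hu.trans hv.symm)).elim
  -- A set that avoids `x` and `y` has lost no edge, so its single attachment is one in `G` too.
  intro T hT hn c hc hcT hcl hno
  by_contra hcon
  simp only [exists_eq_right, not_or] at hcon
  refine hno (h.2 T hT hn c fun u hu w hw huw => hcl u hu w hw ?_)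
  rw [deleteEdge_adj]
  grind

/-! ### Splitting a chain at a cut vertex, by residues modulo 3 -/

/-- Since `b` is pendant at `c`, the path through `b` has `c` in the middle and its third vertex in
`A`. -/
theorem PathFactor.exists_erase {A : Finset V} {b c : V} (h : PathFactor G (insert b (insert c A)))
    (hbA : b ∉ A) (hcA : c ∉ A) (hbc : b ≠ c) (hb : ∀ u ∈ A, ¬ G.Adj b u) :
    ∃ a ∈ A, G.Adj c a ∧ PathFactor G (A.erase a) := by
  obtain ⟨u, v, w, hu, hv, hw, huw, huv, hvw, hm, hF⟩ := h.exists_path (mem_insert_self _ _)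
  have huv' := huv.ne
  have hvw' := hvw.ne
  have hb' : ∀ t ∈ insert b (insert c A), G.Adj b t → t = c := by
    intro t ht hbt
    have := hbt.ne
    have := hb t
    grind
  have hvc : v = c := by
    rcases hm with rfl | rfl | rfl
    · exact hb' v hv huv
    · have h1 := hb' w hw hvw
      have h2 := hb' u hu huv.symm
      exact (huw (h2.trans h1.symm)).elim
    · exact hb' v hv hvw.symm
  subst hvc
  have key : ∀ a, a ∈ insert b (insert v A) → a ≠ b → a ≠ v → ({u, v, w} : Finset V) = {b, v, a} →
      G.Adj v a → ∃ a ∈ A, G.Adj v a ∧ PathFactor G (A.erase a) := by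
    intro a ha hab hav he hva
    refine ⟨a, by grind, hva, ?_⟩
    rw [he] at hF
    convert hF using 1
    grind
  rcases hm with rfl | rfl | rfl
  · exact key w hw (by grind) (by grind) rfl hvw
  · exact (hbc rfl).elim
  · exact key u hu (by grind) (by grind) (by grind) huv.symm

/-- The sizes of the sides add up to 2 modulo 3. If one is 0, that side and the other side with `c`
are smaller chains. Otherwise both are 1: a neighbour `b` of `c` in `B` is attached as a pendant to
`A` and `c`, and the factor of this chain contains a path `b c a`, leaving a factor of `A - a`.
Doing the same in `B` and inserting one path `a c b` finishes. These auxiliary chains are smaller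
than `S` only if the far side has more than one vertex, whence the exception. -/
theorem CutSplit.pathFactor_or {A B : Finset V} {c : V} (h : CutSplit G S A c B)
    (hS : ChainOn G S) (hc : ClawFreeOn G S) (h3 : #S % 3 = 0)
    (ih : ∀ T : Finset V, #T < #S → ChainOn G T → ClawFreeOn G T → #T % 3 = 0 → PathFactor G T) :
    PathFactor G S ∨ (#A % 3 = 1 ∧ #B % 3 = 1 ∧ (#A = 1 ∨ #B = 1)) := by
  have hcard := h.card
  have hA := h.left_nonempty.card_pos
  have hB := h.right_nonempty.card_pos
  have hcA := h.notMem_left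
  have hcB := h.notMem_right
  have aux : ∀ {A B : Finset V}, CutSplit G S A c B → #A % 3 = 0 → PathFactor G S := by
    intro A B h hA3
    have hcard := h.card
    have hA := h.left_nonempty.card_pos
    have hB := h.right_nonempty.card_pos
    have hcB := h.notMem_right
    have hcA := h.notMem_left
    have hd := disjoint_left.1 h.disj
    have e : S \ A = insert c B := by
      have := h.eq
      ext u
      have := @hd u
      grind
    have hBc : #(insert c B) = #B + 1 := card_insert_of_notMem hcB
    refine PathFactor.of_split (T := A) ?_ ?_ h.left_sub
    · exact ih A (by omega) (h.chainOn hS hc) (hc.mono h.left_sub) hA3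
    · rw [e]
      refine ih _ (by omega) (h.symm.chainOn_insert hS) (hc.mono ?_) (by omega)
      rw [← e]
      exact sdiff_subset
  by_cases hA3 : #A % 3 = 0
  · exact Or.inl (aux h hA3)
  by_cases hB3 : #B % 3 = 0
  · exact Or.inl (aux h.symm hB3)
  by_cases h1 : #A = 1 ∨ #B = 1
  · exact Or.inr ⟨by omega, by omega, h1⟩
  have aux2 : ∀ {A B : Finset V}, CutSplit G S A c B → #A % 3 = 1 → 1 < #B →
      ∃ a ∈ A, G.Adj c a ∧ PathFactor G (A.erase a) := by
    intro A B h hA3 hB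
    have hcard := h.card
    have hcB := h.notMem_right
    have hcA := h.notMem_left
    obtain ⟨b, hb, hcb⟩ := h.symm.exists_adj hS.1
    have hbA := disjoint_right.1 h.disj hb
    have hbc : b ≠ c := fun e => hcB (e ▸ hb)
    have hcard' : #(insert b (insert c A)) = #A + 2 := by
      rw [card_insert_of_notMem (by grind), card_insert_of_notMem hcA]
    refine PathFactor.exists_erase (ih _ (by omega) (h.chainOn_insert_insert hS hb hcb)
      (hc.mono ?_) (by omega)) hbA hcA hbc fun u hu hbu => h.not_adj u hu b hb hbu.symm
    have := h.eq
    grind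
  obtain ⟨a, ha, hca, hFA⟩ := aux2 h (by omega) (by omega)
  obtain ⟨b, hb, hcb, hFB⟩ := aux2 h.symm (by omega) (by omega)
  left
  have hd := disjoint_left.1 h.disj
  have hab : a ≠ b := fun e => hd ha (e ▸ hb)
  have hF := hFA.union hFB (disjoint_left.2 fun u hu hu' =>
    hd (mem_of_mem_erase hu) (mem_of_mem_erase hu'))
  refine PathFactor.of_split (T := {a, c, b}) (PathFactor.path hab hca.symm hcb) ?_ ?_
  · convert hF using 1
    have := h.eq
    ext u
    have := @hd u
    grind
  · have := h.eq
    grind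

/-! ### A 2-connected core with a pendant path and a pendant vertex -/

/-- Of three separated sets, at least two avoid `q`, and then also `c₂`. Each of these two sees `z`
because `B` is 2-connected. As there is no claw at `z` with leaf `c`, the vertex `c` sees one of the
two sets; its neighbours form a clique, so it misses the other, which is the set sought. -/
theorem exists_separated_of_two_pendants {B : Finset V} {c q c₂ z : V} (hB : TwoConnOn G B)
    (hc : ClawFreeOn G (insert c B)) (hcB : c ∉ B) (hqB : q ∉ B) (hc₂ : c₂ ∈ B)
    (hqc₂ : G.Adj q c₂)
    (hK : CliqueOn G fun u => u ∈ B ∧ G.Adj c u) (hz : z ∈ B) (hcz : G.Adj c z) (hzc₂ : z ≠ c₂)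
    (hno : ¬ ChainOn G (insert q (B.erase z))) :
    (∃ w ∈ B, w ≠ z ∧ G.Adj c w) ∧ ∃ Z ⊆ B.erase z, Z.Nonempty ∧ c₂ ∉ Z ∧ (∀ u ∈ Z, ¬ G.Adj c u) ∧
      ∃ m, ClosedUpTo G (B.erase z) Z m := by
  have hch := hB.erase_chainOn (hc.mono (subset_insert _ _)) hz
  have hc₂' : c₂ ∈ B.erase z := mem_erase.2 ⟨hzc₂.symm, hc₂⟩
  have hconn : ConnOn G (insert q (B.erase z)) := hch.1.insert_adj hc₂' hqc₂
  have key : ∀ T ⊆ insert q (B.erase z), ∀ t d, T.Nonempty → ClosedUpTo G (insert q (B.erase z)) T t →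
      q ∉ T → d ∈ insert q (B.erase z) → d ≠ q → d ∉ T → T ⊆ B.erase z ∧ c₂ ∉ T ∧
      ClosedUpTo G (B.erase z) T t ∧ ∃ u ∈ T, G.Adj z u := by
    intro T hT t d hn hcl hqT hd hdq hdT
    have hTB : T ⊆ B.erase z := by
      intro u hu
      exact mem_of_mem_insert_of_ne (hT hu) fun e => hqT (e ▸ hu)
    have hcl' : ClosedUpTo G (B.erase z) T t := fun u hu w hw huw =>
      hcl u hu w (mem_insert_of_mem hw) huw
    have hc₂T : c₂ ∉ T := by
      intro hcT
      have := (hcl c₂ hcT q (mem_insert_self _ _) hqc₂.symm).resolve_left hqT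
      subst this
      have := hch.1 T hTB hn fun u hu w hw huw =>
        (hcl' u hu w hw huw).resolve_right fun e => hqB (e ▸ mem_of_mem_erase hw)
      exact hdT (this (mem_of_mem_insert_of_ne hd hdq))
    refine ⟨hTB, hc₂T, hcl', ?_⟩
    by_contra hno
    push Not at hno
    refine hB.not_closedUpTo (hTB.trans (erase_subset _ _)) hn hz hc₂ hzc₂
      (fun e => (notMem_erase _ _ (hTB e))) hc₂T t fun u hu w hw huw => ?_
    by_cases hwz : w = z
    · exact (hno u hu (hwz ▸ huw.symm)).elim
    · exact hcl' u hu w (mem_erase.2 ⟨hwz, hw⟩) huw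
  have key2 : ∀ T T' T'' : Finset V, ∀ t t', T ⊆ insert q (B.erase z) → T' ⊆ insert q (B.erase z) →
      T'' ⊆ insert q (B.erase z) → T.Nonempty → T'.Nonempty → T''.Nonempty → Disjoint T T' →
      Disjoint T T'' → Disjoint T' T'' → ClosedUpTo G (insert q (B.erase z)) T t →
      ClosedUpTo G (insert q (B.erase z)) T' t' → q ∉ T → q ∉ T' →
      (∃ w ∈ B, w ≠ z ∧ G.Adj c w) ∧ ∃ Z ⊆ B.erase z, Z.Nonempty ∧ c₂ ∉ Z ∧
        (∀ u ∈ Z, ¬ G.Adj c u) ∧ ∃ m, ClosedUpTo G (B.erase z) Z m := by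
    rintro T T' T'' t t' hT hT' hT'' hn hn' ⟨d, hd⟩ d1 d2 d3 cl cl' hqT hqT'
    have nadj : ∀ u ∈ T, ∀ v ∈ T', ¬ G.Adj u v := fun u hu v hv =>
      hconn.not_adj hT hT' (hT'' hd) (disjoint_right.1 d2 hd) (disjoint_right.1 d3 hd) d1 cl cl' hu hv
    obtain ⟨e, he⟩ := hn
    obtain ⟨e', he'⟩ := hn'
    obtain ⟨s1, n1, k1, u, hu, hzu⟩ := key T hT t e' ⟨e, he⟩ cl hqT (hT' he')
      (fun h => hqT' (h ▸ he')) (disjoint_right.1 d1 he')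
    obtain ⟨s2, n2, k2, v, hv, hzv⟩ := key T' hT' t' e ⟨e', he'⟩ cl' hqT' (hT he)
      (fun h => hqT (h ▸ he)) (disjoint_left.1 d1 he)
    have huB := mem_of_mem_erase (s1 hu)
    have hvB := mem_of_mem_erase (s2 hv)
    have huv : u ≠ v := fun h => disjoint_left.1 d1 hu (h ▸ hv)
    have hclaw := hc z (by simp [hz]) c (by simp) u (by simp [huB]) v (by simp [hvB])
      (fun h => hcB (h ▸ huB)) (fun h => hcB (h ▸ hvB)) huv hcz.symm hzu hzv
    have side : ∀ T T' : Finset V, T ⊆ B.erase z → T' ⊆ B.erase z → Disjoint T T' →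
        (∀ u ∈ T, ∀ v ∈ T', ¬ G.Adj u v) →
        ∀ u ∈ T, G.Adj c u → ∀ v ∈ T', ¬ G.Adj c v := by
      intro T T' hT hT' hd hn u hu hcu v hv hcv
      exact hn u hu v hv (hK u v ⟨mem_of_mem_erase (hT hu), hcu⟩ ⟨mem_of_mem_erase (hT' hv), hcv⟩
        fun h => disjoint_left.1 hd hu (h ▸ hv))
    rcases hclaw with h | h | h
    · exact ⟨⟨u, huB, ne_of_mem_erase (s1 hu), h⟩, T', s2, ⟨v, hv⟩, n2,
        side T T' s1 s2 d1 nadj u hu h, t', k2⟩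
    · exact ⟨⟨v, hvB, ne_of_mem_erase (s2 hv), h⟩, T, s1, ⟨u, hu⟩, n1,
        side T' T s2 s1 d1.symm (fun a ha b hb hab => nadj b hb a ha hab.symm) v hv h, t, k1⟩
    · exact (nadj u hu v hv h).elim
  unfold ChainOn at hno
  push Not at hno
  obtain ⟨T₁, T₂, T₃, t₁, t₂, t₃, h₁, h₂, h₃, n₁, n₂, n₃, d₁₂, d₁₃, d₂₃, cl₁, cl₂, cl₃, -⟩ := hno hconn
  by_cases q₁ : q ∈ T₁
  · exact key2 T₂ T₃ T₁ t₂ t₃ h₂ h₃ h₁ n₂ n₃ n₁ d₂₃ d₁₂.symm d₁₃.symm cl₂ cl₃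
      (disjoint_left.1 d₁₂ q₁) (disjoint_left.1 d₁₃ q₁)
  by_cases q₂ : q ∈ T₂
  · exact key2 T₁ T₃ T₂ t₁ t₃ h₁ h₃ h₂ n₁ n₃ n₂ d₁₃ d₁₂ d₂₃.symm cl₁ cl₃ q₁
      (disjoint_left.1 d₂₃ q₂)
  · exact key2 T₁ T₂ T₃ t₁ t₂ h₁ h₂ h₃ n₁ n₂ n₃ d₁₂ d₁₃ d₂₃ cl₁ cl₂ q₁ q₂

/-- Attaching two pendant vertices to a connected graph gives a chain if each set attached through
at most one vertex meets one of the two attachments. -/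
theorem ConnOn.chainOn_of_two_pendants {D : Finset V} {p c q c₂ : V} (hconn : ConnOn G D)
    (hpq' : p ≠ q) (hc₂ : c₂ ∈ D) (hcD : c ∉ D) (hcn : ∃ u ∈ D, G.Adj c u)
    (hp : ∀ u ∈ insert p (insert c (insert q D)), G.Adj p u → u = c) (hpc : G.Adj p c)
    (hq : ∀ u ∈ insert p (insert c (insert q D)), G.Adj q u → u = c₂) (hqc₂ : G.Adj q c₂)
    (hT : ∀ T ⊆ D, T.Nonempty → c₂ ∉ T → (∀ u ∈ T, ¬ G.Adj c u) → ∀ v, ¬ ClosedUpTo G D T v) :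
    ChainOn G (insert p (insert c (insert q D))) := by
  obtain ⟨w', hw', hcw'⟩ := hcn
  have k1 : ConnOn G (insert q D) := hconn.insert_adj hc₂ hqc₂
  have k2 : ConnOn G (insert c (insert q D)) := k1.insert_adj (mem_insert_of_mem hw') hcw'
  have k3 : ConnOn G (insert p (insert c (insert q D))) := k2.insert_adj (by simp) hpc
  refine ChainOn.of_cliques k3 (· = p) (· = q) ?_ ?_ ?_
  · intro u v hu hv huv; exact (huv (hu.trans hv.symm)).elim
  · intro u v hu hv huv; exact (huv (hu.trans hv.symm)).elim
  intro T hTs hn v hv hvT hcl _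
  by_contra hcon
  simp only [exists_eq_right, not_or] at hcon
  obtain ⟨hpT, hqT⟩ := hcon
  -- If `T` contains the neighbour of a pendant vertex `b` but not `b`, then `b` is its attachment,
  -- and adding `b` exhausts everything. So `T` contains neither `c` nor `c₂`.
  have attach : ∀ a b, a ∈ T → b ∉ T → b ∈ insert p (insert c (insert q D)) → G.Adj a b →
      (∀ u ∈ insert p (insert c (insert q D)), G.Adj b u → u = a) →
      insert p (insert c (insert q D)) ⊆ insert b T := by
    intro a b ha hb hbW hab hbo
    have hbv := (hcl a ha b hbW hab).resolve_left hb
    refine k3 _ (insert_subset hbW hTs) (by simp) fun u hu x hx hux => ?_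
    rcases mem_insert.1 hu with rfl | hu
    · rw [hbo x hx hux]
      exact mem_insert_of_mem ha
    · rcases hcl u hu x hx hux with h | h
      · exact mem_insert_of_mem h
      · rw [h, hbv]
        exact mem_insert_self _ _
  have hcT : c ∉ T := by
    intro hcT
    have := attach c p hcT hpT (by simp) hpc.symm hp (by simp : q ∈ _)
    rw [mem_insert] at this
    tauto
  have hc₂T : c₂ ∉ T := by
    intro hcT
    have := attach c₂ q hcT hqT (by simp) hqc₂.symm hq (by simp : p ∈ _)
    rw [mem_insert] at this
    tauto
  have hTD : T ⊆ D := by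
    intro u hu
    have h1 : u ≠ p := fun e => hpT (e ▸ hu)
    have h2 : u ≠ c := fun e => hcT (e ▸ hu)
    have h3 : u ≠ q := fun e => hqT (e ▸ hu)
    have := hTs hu
    simpa [h1, h2, h3] using this
  have hclD : ClosedUpTo G D T v := fun u hu x hx hux => hcl u hu x (by simp [hx]) hux
  refine hT T hTD hn hc₂T ?_ v hclD
  intro u hu hcu
  have := (hcl u hu c (by simp) hcu.symm).resolve_left hcT
  subst this
  exact hc₂T (hconn T hTD hn (fun a ha b hb hab =>
    (hclD a ha b hb hab).resolve_right fun e => hcD (e ▸ hb)) hc₂)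

/-- `c` is attached to `B` at `z`, and `{z, m}` separates `Z` from `Y` in `B`, where `Y` contains
`c₂` and `Z` is a maximal part cut off from `c₂` in `B - z` and not adjacent to `c`. -/
structure PendantCut (G : SimpleGraph V) (B : Finset V) (c c₂ : V) (Z Y : Finset V) (z m : V) :
    Prop where
  twoConn : TwoConnOn G B
  claw : ClawFreeOn G (insert c B)
  notMem : c ∉ B
  adj : G.Adj c z
  left : TwoCut G B Z z m
  right : TwoCut G B Y z m
  cover : ∀ u ∈ B, u ∈ Z ∨ u = z ∨ u = m ∨ u ∈ Y
  disj : ∀ u ∈ Y, u ∉ Z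
  not_adj : ∀ u ∈ Z, ¬ G.Adj c u
  mem : c₂ ∈ Y
  max : ∀ (T : Finset V) (v : V), T ⊆ insert m Y → c₂ ∉ T → (∀ u ∈ T, ¬ G.Adj c u) →
    (∀ u ∈ T ∪ Z, ∀ w ∈ insert m Y, G.Adj u w → w ∈ T ∨ w = v) → T = ∅

namespace PendantCut

variable {B Y : Finset V} {c c₂ z m : V}

theorem not_adj_sides (h : PendantCut G B c c₂ Z Y z m) : ∀ u ∈ Z, ∀ v ∈ Y, ¬ G.Adj u v :=
  h.left.not_adj_of_disjoint h.right h.disj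

theorem clique_left_z (h : PendantCut G B c c₂ Z Y z m) :
    CliqueOn G fun u => u ∈ Z ∧ G.Adj z u :=
  h.left.cliqueOn_left h.right h.disj h.twoConn (h.claw.mono (subset_insert _ _))

theorem clique_left_m (h : PendantCut G B c c₂ Z Y z m) :
    CliqueOn G fun u => u ∈ Z ∧ G.Adj m u :=
  h.left.cliqueOn_right h.right h.disj h.twoConn (h.claw.mono (subset_insert _ _))

theorem clique_right_z (h : PendantCut G B c c₂ Z Y z m) :
    CliqueOn G fun u => u ∈ Y ∧ G.Adj z u :=
  h.right.cliqueOn_left h.left (fun u hu hu' => h.disj u hu' hu) h.twoConn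
    (h.claw.mono (subset_insert _ _))

theorem clique_right_m (h : PendantCut G B c c₂ Z Y z m) :
    CliqueOn G fun u => u ∈ Y ∧ G.Adj m u :=
  h.right.cliqueOn_right h.left (fun u hu hu' => h.disj u hu' hu) h.twoConn
    (h.claw.mono (subset_insert _ _))

/-- Among the neighbours `c`, `r`, `y` of `o`, only `c` and `y` can be adjacent. -/
theorem claw_at (h : PendantCut G B c c₂ Z Y z m) {o r y : V} (ho : o ∈ B) (hr : r ∈ Z) (hy : y ∈ Y)
    (hco : G.Adj c o) (hor : G.Adj o r) (hoy : G.Adj o y) : G.Adj c y := by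
  have hrB := h.left.sub hr
  have hyB := h.right.sub hy
  have h1 := h.not_adj r hr
  have h2 := h.not_adj_sides r hr y hy
  have := h.claw o (mem_insert_of_mem ho) c (mem_insert_self _ _) r (mem_insert_of_mem hrB) y
    (mem_insert_of_mem hyB) (fun e => h.notMem (e ▸ hrB)) (fun e => h.notMem (e ▸ hyB))
    (fun e => h.disj y hy (e ▸ hr)) hco.symm hor hoy
  tauto

theorem not_adj_z (h : PendantCut G B c c₂ Z Y z m) {u : V} (hu : u ∈ Y) (hcu : ¬ G.Adj c u) :
    ¬ G.Adj z u := by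
  intro hzu
  obtain ⟨s, hs, hzs⟩ := h.left.exists_adj_left h.twoConn
  exact hcu (h.claw_at h.left.left_mem hs hu h.adj hzs hzu)

theorem exists_adj_right (h : PendantCut G B c c₂ Z Y z m) {w : V} (hw : w ∈ B) (hwz : w ≠ z)
    (hcw : G.Adj c w) : ∃ u ∈ Y, G.Adj c u := by
  rcases h.cover w hw with e | e | rfl | e
  · exact (h.not_adj w e hcw).elim
  · exact (hwz e).elim
  · obtain ⟨r, hr, hwr⟩ := h.left.exists_adj_right h.twoConn
    obtain ⟨y, hy, hwy⟩ := h.right.exists_adj_right h.twoConn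
    exact ⟨y, hy, h.claw_at hw hr hy hcw hwr hwy⟩
  · exact ⟨w, e, hcw⟩

theorem not_closedUpTo_of_subset (h : PendantCut G B c c₂ Z Y z m) (hT : T ⊆ Y) (hn : T.Nonempty)
    (hcT : ∀ u ∈ T, ¬ G.Adj c u) {v : V} (hm : ∀ u ∈ T, G.Adj m u → m = v) :
    ¬ ClosedUpTo G Y T v := by
  intro hcl
  refine h.right.not_closedUpTo h.twoConn hT hn v fun u hu x hx hux => ?_
  rcases h.right.closed u (hT hu) x hx hux with e | rfl | rfl
  · exact hcl u hu x e hux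
  · exact (h.not_adj_z (hT hu) (hcT u hu) hux.symm).elim
  · exact Or.inr (hm u hu hux.symm)

/-- A set `T` containing `m` would enlarge `Z` to `T ∪ Z`, against maximality. A set avoiding `m`
lies in `Y` and is not seen by `z`, which sees no vertex of `Y` missed by `c`; so its single
attachment is one in `B`. -/
theorem not_closedUpTo (h : PendantCut G B c c₂ Z Y z m) {D : Finset V} (hYD : insert m Y ⊆ D)
    (hDY : D ⊆ insert z (insert m Y)) (hT : T ⊆ D) (hn : T.Nonempty) (hc₂ : c₂ ∉ T)
    (hcT : ∀ u ∈ T, ¬ G.Adj c u) (v : V) : ¬ ClosedUpTo G D T v := by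
  intro hcl
  have hzT : z ∉ T := fun e => hcT z e h.adj
  have hTm : T ⊆ insert m Y := fun u hu =>
    mem_of_mem_insert_of_ne (hDY (hT hu)) fun e => hzT (e ▸ hu)
  by_cases hmT : m ∈ T
  · have := h.max T v hTm hc₂ hcT (by
      intro u hu x hx hux
      rcases mem_union.1 hu with hu | hu
      · exact hcl u hu x (hYD hx) hux
      · rcases mem_insert.1 hx with rfl | hx
        · exact Or.inl hmT
        · exact (h.not_adj_sides u hu x hx hux).elim)
    exact hn.ne_empty this
  · have hTY : T ⊆ Y := fun u hu =>
      mem_of_mem_insert_of_ne (hTm hu) fun e => hmT (e ▸ hu)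
    refine h.not_closedUpTo_of_subset hTY hn hcT (v := v) (fun u hu hmu => ?_)
      fun u hu x hx hux => hcl u hu x (hYD (mem_insert_of_mem hx)) hux
    exact (hcl u hu m (hYD (mem_insert_self _ _)) hmu.symm).resolve_left hmT

/-- Here `m` has been removed as well. If `m` sees `T`, then `c` misses `m` by `claw_at`, and the
neighbours of `m` in `Y` form a clique, so `T` with `m` still has one attachment and would enlarge
`Z`. If `m` does not see `T`, its attachment is the only one in `B`. -/
theorem not_closedUpTo_right (h : PendantCut G B c c₂ Z Y z m) (hm : m ≠ c₂) (hT : T ⊆ Y)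
    (hn : T.Nonempty)
    (hc₂ : c₂ ∉ T) (hcT : ∀ u ∈ T, ¬ G.Adj c u) (v : V) : ¬ ClosedUpTo G Y T v := by
  intro hcl
  refine h.not_closedUpTo_of_subset hT hn hcT (fun u hu hmu => ?_) hcl
  exfalso
  obtain ⟨r, hr, hmr⟩ := h.left.exists_adj_right h.twoConn
  have hmB := h.left.right_mem
  have hcm : ¬ G.Adj c m := fun hcm => hcT u hu (h.claw_at hmB hr (hT hu) hcm hmr hmu)
  have := h.max (insert m T) v (insert_subset_insert _ hT)
    (by simp only [mem_insert, not_or]; exact ⟨hm.symm, hc₂⟩)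
    (by
      intro x hx
      rcases mem_insert.1 hx with rfl | hx
      · exact hcm
      · exact hcT x hx) (by
    intro a ha x hx hax
    rcases mem_insert.1 hx with rfl | hxY
    · exact Or.inl (mem_insert_self _ _)
    have close : ∀ a ∈ T, G.Adj a x → x ∈ insert m T ∨ x = v := by
      intro a ha hax
      rcases hcl a ha x hxY hax with e | e
      · exact Or.inl (mem_insert_of_mem e)
      · exact Or.inr e
    rcases mem_union.1 ha with ha | ha
    · rcases mem_insert.1 ha with rfl | ha
      · by_cases hxu : x = u
        · exact Or.inl (mem_insert_of_mem (hxu ▸ hu))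
        · exact close u hu (h.clique_right_m u x ⟨hT hu, hmu⟩ ⟨hxY, hax⟩ (Ne.symm hxu))
      · exact close a ha hax
    · exact (h.not_adj_sides a ha x hxY hax).elim)
  simp at this

theorem card (h : PendantCut G B c c₂ Z Y z m) : #B = #Y + #Z + 2 := by
  have e := h.left.card_both
  have hd : Disjoint (insert z (insert m Z)) Y := by
    rw [disjoint_left]
    intro u hu hu'
    rcases mem_insert.1 hu with rfl | hu
    · exact h.right.left_notMem hu'
    rcases mem_insert.1 hu with rfl | hu
    · exact h.right.right_notMem hu'
    · exact h.disj u hu' hu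
  have hB : B = insert z (insert m Z) ∪ Y := by
    ext u
    have h1 := h.cover u
    have h2 := @h.left.sub u
    have h3 := @h.right.sub u
    have h4 := h.left.left_mem
    have h5 := h.left.right_mem
    simp only [mem_union, mem_insert]
    constructor
    · tauto
    · rintro ((rfl | rfl | e) | e) <;> tauto
  rw [hB, card_union_of_disjoint hd]
  omega

end PendantCut

theorem exists_pendantCut {B Z₀ : Finset V} {c q c₂ z w : V} (hB : TwoConnOn G B)
    (hc : ClawFreeOn G (insert c (insert q B))) (hcB : c ∉ B) (hqB : q ∉ B)
    (hcq' : c ≠ q) (hcq : ¬ G.Adj c q) (hc₂ : c₂ ∈ B)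
    (hq : ∀ u ∈ B, G.Adj q u → u = c₂) (hqc₂ : G.Adj q c₂)
    (hz : z ∈ B) (hcz : G.Adj c z) (hzc₂ : z ≠ c₂) (hwB : w ∈ B) (hwz : w ≠ z) (hcw : G.Adj c w)
    (hZ₀ : Z₀ ⊆ B.erase z ∧ Z₀.Nonempty ∧ c₂ ∉ Z₀ ∧ (∀ u ∈ Z₀, ¬ G.Adj c u) ∧
      ∃ m, ClosedUpTo G (B.erase z) Z₀ m) :
    ∃ Z Y m, m ≠ c₂ ∧ PendantCut G B c c₂ Z Y z m := by
  have hBS : B ⊆ insert c (insert q B) := fun u hu => by simp [hu]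
  have hcS : c ∈ insert c (insert q B) := by simp
  have hqS : q ∈ insert c (insert q B) := by simp
  classical
  obtain ⟨Z, hZ, hmax'⟩ := exists_max_image (B.powerset.filter fun Z => Z ⊆ B.erase z ∧ Z.Nonempty ∧
    c₂ ∉ Z ∧ (∀ u ∈ Z, ¬ G.Adj c u) ∧ ∃ m, ClosedUpTo G (B.erase z) Z m) (fun Z => #Z)
    ⟨Z₀, by simp only [mem_filter, mem_powerset]; exact ⟨hZ₀.1.trans (erase_subset _ _), hZ₀⟩⟩
  simp only [mem_filter, mem_powerset] at hZ hmax'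
  obtain ⟨hZB, hZz, hZn, hc₂Z, hcZ, m, hZm⟩ := hZ
  have hmax : ∀ (Z' : Finset V) (m' : V), Z ⊆ Z' → Z' ⊆ B → z ∉ Z' → c₂ ∉ Z' → (∀ u ∈ Z', ¬ G.Adj c u) →
      (∀ u ∈ Z', ∀ w ∈ B, w ≠ z → G.Adj u w → w ∈ Z' ∨ w = m') → Z' = Z := by
    intro Z' m' hZZ' h1 h1' h3 h4 h5
    refine (eq_of_subset_of_card_le hZZ' (hmax' Z' ⟨h1, ?_, hZn.mono hZZ', h3, h4, m', ?_⟩)).symm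
    · intro u hu
      exact mem_erase.2 ⟨fun e => h1' (e ▸ hu), h1 hu⟩
    · intro u hu w hw huw
      exact h5 u hu w (mem_of_mem_erase hw) (ne_of_mem_erase hw) huw
  clear hmax' hZ₀
  have hzZ : z ∉ Z := fun e => notMem_erase _ _ (hZz e)
  have hconnz := (hB.erase_chainOn (hc.mono hBS) hz).1
  have hc₂z : c₂ ∈ B.erase z := mem_erase.2 ⟨hzc₂.symm, hc₂⟩
  have hm : m ∈ B.erase z ∧ m ∉ Z := by
    by_contra hcon
    refine hc₂Z (hconnz Z hZz hZn (fun u hu w hw huw => ?_) hc₂z)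
    rcases hZm u hu w hw huw with h | rfl
    · exact h
    · by_contra hmZ
      exact hcon ⟨hw, hmZ⟩
  obtain ⟨hmz', hmZ⟩ := hm
  obtain ⟨hmz, hmB⟩ := mem_erase.1 hmz'
  have hcut : TwoCut G B Z z m := by
    refine ⟨hZB, hZn, hz, hmB, hmz.symm, hzZ, hmZ, fun u hu w hw huw => ?_⟩
    by_cases hwz : w = z
    · exact Or.inr (Or.inl hwz)
    · have := hZm u hu w (mem_erase.2 ⟨hwz, hw⟩) huw
      tauto
  obtain ⟨r, hrZ, hmr⟩ := hcut.exists_adj_right hB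
  have hZout : ∀ u ∈ Z, ∀ v ∈ B, v ∉ Z → v ≠ z → v ≠ m → ¬ G.Adj u v := by
    intro u hu v hv hvZ hvz hvm huv
    rcases hcut.closed u hu v hv huv with h | h | h
    · exact hvZ h
    · exact hvz h
    · exact hvm h
  -- If `m = c₂`, the absence of a claw at `m` with leaves `q` and `r ∈ Z` confines the remaining
  -- neighbours of `m` in `B` to `Z` and `z`. Then `z` alone attaches `Z` with `m`, so nothing else
  -- is left in `B` and `w = m`; now `q`, `r`, `c` are the leaves of a claw at `m`.
  have hmc₂ : m ≠ c₂ := by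
    rintro rfl
    have h1 : ∀ u ∈ B, G.Adj m u → u ∈ Z ∨ u = z := by
      intro u hu hmu
      by_contra hcon
      push Not at hcon
      have hur : r ≠ u := fun e => hcon.1 (e ▸ hrZ)
      rcases hc m (hBS hmB) q hqS r (hBS (hZB hrZ)) u (hBS hu) (fun e => hqB (e ▸ hZB hrZ))
        (fun e => hqB (e ▸ hu)) hur hqc₂.symm hmr hmu with h | h | h
      · exact hmZ (hq r (hZB hrZ) h ▸ hrZ)
      · exact hmu.ne (hq u hu h).symm
      · exact hZout r hrZ u hu hcon.1 hcon.2 hmu.ne' h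
    have h2 := hB.2 (insert m Z) (by grind) (by simp) z (by
      intro u hu v hv huv
      rcases mem_insert.1 hu with rfl | hu
      · have := h1 v hv huv
        grind
      · have := hcut.closed u hu v hv huv
        grind)
    have hwm : w = m := by
      have := h2 hwB
      have := hcZ w
      grind
    subst hwm
    rcases hc w (hBS hmB) q hqS r (hBS (hZB hrZ)) c hcS (fun e => hqB (e ▸ hZB hrZ))
      hcq'.symm (fun e => hcB (e ▸ hZB hrZ)) hqc₂.symm hmr hcw.symm with h | h | h
    · exact hmZ (hq r (hZB hrZ) h ▸ hrZ)
    · exact hcq h.symm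
    · exact hcZ r hrZ h.symm
  have hc₂' : c₂ ∈ B \ insert z (insert m Z) := by
    simp only [mem_sdiff, mem_insert, not_or]
    exact ⟨hc₂, hzc₂.symm, hmc₂.symm, hc₂Z⟩
  have hcutY : TwoCut G B (B \ insert z (insert m Z)) z m := by
    refine ⟨sdiff_subset, ⟨c₂, hc₂'⟩, hz, hmB, hmz.symm, by simp, by simp, fun u hu v hv huv => ?_⟩
    have h1 := mem_sdiff.1 hu
    simp only [mem_insert, not_or] at h1
    have := fun h => hZout v h u h1.1 h1.2.2.2 h1.2.1 h1.2.2.1 huv.symm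
    simp only [mem_sdiff, mem_insert]
    tauto
  refine ⟨Z, B \ insert z (insert m Z), m, hmc₂, hB, hc.mono ?_, hcB, hcz, hcut, hcutY, ?_, ?_, hcZ, hc₂', ?_⟩
  · exact insert_subset_insert _ (subset_insert _ _)
  · intro u hu
    simp only [mem_sdiff, mem_insert]
    tauto
  · intro u hu
    simp only [mem_sdiff, mem_insert] at hu
    tauto
  · intro T v hT hc₂T hcT hcl
    have hTB : T ⊆ B := by
      intro u hu
      rcases mem_insert.1 (hT hu) with rfl | h
      · exact hmB
      · exact (mem_sdiff.1 h).1
    have hTZ : ∀ u ∈ T, u ∉ Z ∧ u ≠ z := by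
      intro u hu
      rcases mem_insert.1 (hT hu) with rfl | h
      · exact ⟨hmZ, hmz⟩
      · simp only [mem_sdiff, mem_insert] at h
        tauto
    have := hmax (T ∪ Z) v subset_union_right (union_subset hTB hZB) ?_ ?_ ?_ ?_
    · refine eq_empty_of_forall_notMem fun u hu => (hTZ u hu).1 ?_
      rw [← this]
      exact mem_union_left _ hu
    · simp only [mem_union, not_or]
      exact ⟨fun h => (hTZ z h).2 rfl, hzZ⟩
    · simp only [mem_union, not_or]
      exact ⟨hc₂T, hc₂Z⟩
    · intro u hu
      rcases mem_union.1 hu with hu | hu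
      · exact hcT u hu
      · exact hcZ u hu
    · intro u hu x hx hxz hux
      have := hcl u hu x
      simp only [mem_union, mem_sdiff, mem_insert] at this ⊢
      tauto

/-- One of `Z`, `Z + z`, `Z + z + m` has size divisible by three, and each of them is a chain. The
rest of `S` is a chain by `ConnOn.chainOn_of_two_pendants`, whose hypothesis is what the maximality
of `Z` provides. -/
theorem PendantCut.pathFactor {B Y : Finset V} {p c q c₂ z m : V}
    (h : PendantCut G B c c₂ Z Y z m) (hS : S = insert p (insert c (insert q B)))
    (hc : ClawFreeOn G S) (hpB : p ∉ B) (hqB : q ∉ B) (hpc' : p ≠ c) (hpq' : p ≠ q) (hcq' : c ≠ q)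
    (hmc₂ : m ≠ c₂) (hp : ∀ u ∈ S, G.Adj p u → u = c) (hpc : G.Adj p c)
    (hq : ∀ u ∈ S, G.Adj q u → u = c₂) (hqc₂ : G.Adj q c₂) (hcn : ∃ u ∈ Y, G.Adj c u)
    (h3 : #B % 3 = 0)
    (ih : ∀ T : Finset V, #T < #S → ChainOn G T → ClawFreeOn G T → #T % 3 = 0 → PathFactor G T) :
    PathFactor G S := by
  have hcB := h.notMem
  have hBS : B ⊆ S := by rw [hS]; intro u hu; simp [hu]
  have hcardS : #S = #B + 3 := by
    rw [hS, card_insert_of_notMem (by simp [hpc', hpq', hpB]),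
      card_insert_of_notMem (by simp [hcq', hcB]), card_insert_of_notMem hqB]
  have hcardY := h.card
  have finish : ∀ X D : Finset V, X ⊆ B → X.Nonempty → D = B \ X → Y ⊆ D →
      ChainOn G X → #X % 3 = 0 → ConnOn G D →
      (∀ T ⊆ D, T.Nonempty → c₂ ∉ T → (∀ u ∈ T, ¬ G.Adj c u) → ∀ v, ¬ ClosedUpTo G D T v) →
      PathFactor G S := by
    intro X D hXB hn hD hYD hcX hX3 hconn hT
    have hDB : D ⊆ B := by rw [hD]; exact sdiff_subset
    have hXpos := hn.card_pos
    have hXle := card_le_card hXB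
    have hDS : insert p (insert c (insert q D)) = S \ X := by
      have h1 : p ∉ X := fun h => hpB (hXB h)
      have h2 : c ∉ X := fun h => hcB (hXB h)
      have h3 : q ∉ X := fun h => hqB (hXB h)
      rw [hS, hD, insert_sdiff_of_notMem _ h1, insert_sdiff_of_notMem _ h2,
        insert_sdiff_of_notMem _ h3]
    have hDS' : insert p (insert c (insert q D)) ⊆ S := by rw [hDS]; exact sdiff_subset
    obtain ⟨w, hw, hcw⟩ := hcn
    have hch := hconn.chainOn_of_two_pendants hpq' (hYD h.mem) (fun h => hcB (hDB h))
      ⟨w, hYD hw, hcw⟩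
      (fun u hu => hp u (hDS' hu)) hpc (fun u hu => hq u (hDS' hu)) hqc₂ hT
    have hcardD : #(S \ X) = #S - #X := card_sdiff_of_subset (hXB.trans hBS)
    refine PathFactor.of_split (T := X) (ih X (by omega) hcX (hc.mono (hXB.trans hBS)) hX3) ?_
      (hXB.trans hBS)
    rw [hDS] at hch
    exact ih _ (by omega) hch (hc.mono sdiff_subset) (by omega)
  have hz := h.left.left_mem
  have hm := h.left.right_mem
  have hzm := h.left.ne
  have hcov : ∀ u, u ∈ B ↔ u ∈ Z ∨ u = z ∨ u = m ∨ u ∈ Y := fun u => by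
    refine ⟨h.cover u, ?_⟩
    rintro (e | rfl | rfl | e)
    exacts [h.left.sub e, hz, hm, h.right.sub e]
  have hd := h.disj
  have hzZ := h.left.left_notMem
  have hmZ := h.left.right_notMem
  have hzY := h.right.left_notMem
  have hmY := h.right.right_notMem
  have hcardz : #(insert z Z) = #Z + 1 := card_insert_of_notMem hzZ
  have hcardzm := h.left.card_both
  have hcase : #Z % 3 = 0 ∨ #Z % 3 = 2 ∨ #Z % 3 = 1 := by omega
  rcases hcase with h0 | h2 | h1
  · refine finish Z (insert z (insert m Y)) h.left.sub h.left.nonempty ?_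
      ((subset_insert _ _).trans (subset_insert _ _))
      (h.left.chainOn h.twoConn h.clique_left_z h.clique_left_m) h0
      (h.right.connOn_both h.twoConn)
      (fun T hT hn hc₂ hcT => h.not_closedUpTo (subset_insert _ _) subset_rfl hT hn hc₂ hcT)
    clear * - hcov hd hzZ hmZ hzY hmY hzm
    grind
  · refine finish (insert z Z) (insert m Y) (insert_subset hz h.left.sub) (by simp) ?_
      (subset_insert _ _)
      (h.left.chainOn_left h.twoConn h.clique_left_m) (by omega)
      (h.right.symm.connOn_left h.twoConn)
      (fun T hT hn hc₂ hcT => h.not_closedUpTo subset_rfl (subset_insert _ _) hT hn hc₂ hcT)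
    clear * - hcov hd hzZ hmZ hzY hmY hzm
    grind
  · refine finish (insert z (insert m Z)) Y (insert_subset hz (insert_subset hm h.left.sub))
      (by simp) ?_ subset_rfl
      (h.left.chainOn_both h.twoConn) (by omega)
      (h.right.chainOn h.twoConn h.clique_right_z h.clique_right_m).1
      (fun T hT hn hc₂ hcT => h.not_closedUpTo_right hmc₂ hT hn hc₂ hcT)
    clear * - hcov hd hzZ hmZ hzY hmY hzm
    grind

/-- Removing a path `p c z` with `z ≠ c₂` works if `B - z` with `q` is a chain. If it is not, the
obstruction yields a 2-cut `{z, m}` of `B` to which `PendantCut.pathFactor` applies. -/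
theorem pathFactor_of_two_pendants {B : Finset V} {p c q c₂ : V} (hB : TwoConnOn G B)
    (hS : S = insert p (insert c (insert q B)))
    (hc : ClawFreeOn G S) (hpB : p ∉ B) (hcB : c ∉ B) (hqB : q ∉ B) (hpc' : p ≠ c) (hpq' : p ≠ q)
    (hcq' : c ≠ q) (hc₂ : c₂ ∈ B) (hp : ∀ u ∈ S, G.Adj p u → u = c) (hpc : G.Adj p c)
    (hq : ∀ u ∈ S, G.Adj q u → u = c₂) (hqc₂ : G.Adj q c₂) (hcn : ∃ u ∈ B, G.Adj c u)
    (h3 : #B % 3 = 0)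
    (ih : ∀ T : Finset V, #T < #S → ChainOn G T → ClawFreeOn G T → #T % 3 = 0 → PathFactor G T) :
    PathFactor G S := by
  have hBS : B ⊆ S := by rw [hS]; intro u hu; simp [hu]
  have hpS : p ∈ S := by simp [hS]
  have hcS : c ∈ S := by simp [hS]
  have hqS : q ∈ S := by simp [hS]
  have hcardS : #S = #B + 3 := by
    rw [hS, card_insert_of_notMem (by grind), card_insert_of_notMem (by grind),
      card_insert_of_notMem hqB]
  have hcq : ¬ G.Adj c q := fun h => hcB (hq c hcS h.symm ▸ hc₂)
  have hK : CliqueOn G fun u => u ∈ B ∧ G.Adj c u := by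
    rintro u v ⟨hu, hcu⟩ ⟨hv, hcv⟩ huv
    have hpu : p ≠ u := fun e => hpB (e ▸ hu)
    have hpv : p ≠ v := fun e => hpB (e ▸ hv)
    rcases hc c hcS p hpS u (hBS hu) v (hBS hv) hpu hpv huv hpc.symm hcu hcv with h | h | h
    · exact (hcB (hp u (hBS hu) h ▸ hu)).elim
    · exact (hcB (hp v (hBS hv) h ▸ hv)).elim
    · exact h
  obtain ⟨o, ho, hoc₂, hc₂o⟩ : ∃ o ∈ B, o ≠ c₂ ∧ G.Adj c₂ o := by
    by_contra hno
    push Not at hno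
    have := hB.2 {c₂} (by simpa using hc₂) (by simp) c₂ (by
      intro u hu w hw huw
      rw [mem_singleton] at hu
      subst hu
      by_cases h : w = u
      · exact Or.inr h
      · exact (hno w hw h huw).elim)
    have h1 := card_le_card this
    have h2 := hB.1
    simp at h1
    omega
  -- If `c` saw only `c₂` in `B`, then `c`, `q` and `o` would be the leaves of a claw at `c₂`.
  obtain ⟨z, hz, hcz, hzc₂⟩ : ∃ z ∈ B, G.Adj c z ∧ z ≠ c₂ := by
    by_contra hno
    push Not at hno
    obtain ⟨u, hu, hcu⟩ := hcn
    have := hno u hu hcu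
    subst this
    have hco : c ≠ o := fun e => hcB (e ▸ ho)
    have hqo : q ≠ o := fun e => hqB (e ▸ ho)
    rcases hc u (hBS hu) c hcS q hqS o (hBS ho) hcq' hco hqo hcu.symm hqc₂.symm hc₂o with h | h | h
    · exact hcq h
    · exact hoc₂ (hno o ho h)
    · exact hoc₂ (hq o (hBS ho) h)
  by_cases hch : ChainOn G (insert q (B.erase z))
  · have hsub : insert q (B.erase z) ⊆ S := by
      intro u hu
      rcases mem_insert.1 hu with rfl | hu
      · exact hqS
      · exact hBS (mem_of_mem_erase hu)
    have hcard : #(insert q (B.erase z)) = #B := by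
      rw [card_insert_of_notMem (fun h => hqB (mem_of_mem_erase h)), card_erase_add_one hz]
    have hF := ih _ (by omega) hch (hc.mono hsub) (by omega)
    refine PathFactor.of_split (T := {p, c, z})
      (PathFactor.path (fun e => hpB (e ▸ hz)) hpc hcz) ?_ ?_
    · convert hF using 1
      rw [hS]
      have : p ≠ z := fun e => hpB (e ▸ hz)
      grind
    · have := hBS hz
      grind
  obtain ⟨⟨w, hwB, hwz, hcw⟩, Z₀, hZ₀⟩ := exists_separated_of_two_pendants hB
    (hc.mono (by rw [hS]; intro u; simp only [mem_insert]; tauto)) hcB hqB hc₂ hqc₂ hK hz hcz hzc₂ hch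
  obtain ⟨Z, Y, m, hmc₂, hP⟩ := exists_pendantCut hB
    (hc.mono (by rw [hS]; exact subset_insert _ _)) hcB hqB hcq' hcq hc₂
    (fun u hu => hq u (hBS hu)) hqc₂ hz hcz hzc₂ hwB hwz hcw hZ₀
  obtain ⟨w', hw'Y, hcw'⟩ := hP.exists_adj_right hwB hwz hcw
  clear hch hZ₀ hK
  exact hP.pathFactor hS hc hpB hqB hpc' hpq' hcq' hmc₂ hp hpc hq hqc₂ ⟨w', hw'Y, hcw'⟩ h3 ih

/-! ### Chains that are not 2-connected -/

set_option maxHeartbeats 800000 in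
/-- A chain of two vertex sets, one of which is a pendant vertex attached to a set `A` that is again
separated by a cut vertex `c₂`. -/
theorem ChainOn.pathFactor_of_pendant_of_cutSplit {A A₁ A₂ : Finset V} {p c c₂ : V}
    (hS : ChainOn G S) (hc : ClawFreeOn G S) (h3 : #S % 3 = 0) (h : CutSplit G S A c {p})
    (hA : CutSplit G A A₁ c₂ A₂) (hK : ∀ u ∈ A₂, ¬ G.Adj c u)
    (ih : ∀ T : Finset V, #T < #S → ChainOn G T → ClawFreeOn G T → #T % 3 = 0 → PathFactor G T) :
    PathFactor G S := by
  have hcard := h.card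
  have hAS := h.left_sub
  have hpA : p ∉ A := fun e => disjoint_left.1 h.disj e (mem_singleton_self p)
  have hcA := h.notMem_left
  have hpc' : p ≠ c := fun e => h.notMem_right (by simp [e])
  have hpc : G.Adj p c := by
    obtain ⟨u, hu, hcu⟩ := h.symm.exists_adj hS.1
    rw [mem_singleton] at hu
    subst hu
    exact hcu.symm
  have hpS : p ∈ S := h.right_sub (mem_singleton_self p)
  have hp : ∀ u ∈ S, G.Adj p u → u = c := by
    intro u hu hpu
    rcases h.symm.closedUpTo p (mem_singleton_self p) u hu hpu with e | e
    · rw [mem_singleton] at e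
      exact (hpu.ne e.symm).elim
    · exact e
  have hSmem : ∀ u, u ∈ S ↔ u = c ∨ u ∈ A ∨ u = p := by
    intro u
    rw [h.eq]
    simp only [mem_insert, mem_union, mem_singleton]
  have hAmem : ∀ u, u ∈ A ↔ u = c₂ ∨ u ∈ A₁ ∨ u ∈ A₂ := by
    intro u
    rw [hA.eq]
    simp
  have hAchain := h.chainOn hS hc
  have hd := disjoint_left.1 hA.disj
  have hc₂1 := hA.notMem_left
  have hc₂2 := hA.notMem_right
  have hcA₁ : c ∉ A₁ := fun e => hcA (hA.left_sub e)
  have hpA₁ : p ∉ A₁ := fun e => hpA (hA.left_sub e)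
  have hcA₂ : c ∉ A₂ := fun e => hcA (hA.right_sub e)
  have hpA₂ : p ∉ A₂ := fun e => hpA (hA.right_sub e)
  have hc₂A := hA.mem
  have hcc₂ : c ≠ c₂ := fun e => hcA (e ▸ hc₂A)
  have hpc₂ : p ≠ c₂ := fun e => hpA (e ▸ hc₂A)
  -- As `c` sees nothing of `A₂`, the vertex `c₂` separates `A₂` in all of `S`.
  have hsplit : CutSplit G S A₂ c₂ (insert p (insert c A₁)) := by
    refine ⟨?_, hA.right_nonempty, by simp, ?_, hc₂2, ?_, ?_⟩
    · ext u
      rw [hSmem, hAmem]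
      simp only [mem_insert, mem_union]
      tauto
    · rw [disjoint_left]
      intro u hu hu'
      rcases mem_insert.1 hu' with rfl | hu'
      · exact hpA₂ hu
      rcases mem_insert.1 hu' with rfl | hu'
      · exact hcA₂ hu
      · exact hd hu' hu
    · simp only [mem_insert, not_or]
      exact ⟨hpc₂.symm, hcc₂.symm, hc₂1⟩
    · intro u hu w hw huw
      rcases mem_insert.1 hw with rfl | hw
      · have := hp u (hAS (hA.right_sub hu)) huw.symm
        exact hcA₂ (this ▸ hu)
      rcases mem_insert.1 hw with rfl | hw
      · exact hK u hu huw.symm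
      · exact hA.not_adj w hw u hu huw.symm
  rcases hsplit.pathFactor_or hS hc h3 ih with hF | ⟨h1, h2, h4⟩
  · exact hF
  have hcard2 : #(insert p (insert c A₁)) = #A₁ + 2 := by
    rw [card_insert_of_notMem (by simp [hpc', hpA₁]), card_insert_of_notMem hcA₁]
  -- The other side contains `p`, `c` and a vertex of `A₁`, so the singleton side is `A₂`: a second
  -- pendant vertex.
  obtain ⟨q, rfl⟩ := card_eq_one.1 (show #A₂ = 1 by omega)
  clear h1 h2 h4
  simp only [mem_singleton] at hK hcA₂ hpA₂ hc₂2 hSmem hAmem hd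
  have hqc₂ : G.Adj q c₂ := by
    obtain ⟨u, hu, hcu⟩ := hsplit.exists_adj hS.1
    rw [mem_singleton] at hu
    subst hu
    exact hcu.symm
  have hqS : q ∈ S := hsplit.left_sub (mem_singleton_self q)
  have hq : ∀ u ∈ S, G.Adj q u → u = c₂ := by
    intro u hu hqu
    rcases hsplit.closedUpTo q (mem_singleton_self q) u hu hqu with e | e
    · rw [mem_singleton] at e
      exact (hqu.ne e.symm).elim
    · exact e
  have hcq : ¬ G.Adj c q := hK q rfl
  have hqA₁ : q ∉ A₁ := fun e => hd e rfl
  have hqB : q ∉ insert c₂ A₁ := by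
    simp only [mem_insert, not_or]
    exact ⟨fun e => hc₂2 e.symm, hqA₁⟩
  have hBS : insert c₂ A₁ ⊆ S := by
    intro u hu
    rw [hSmem, hAmem]
    rw [mem_insert] at hu
    tauto
  have hcB : c ∉ insert c₂ A₁ := by
    simp only [mem_insert, not_or]
    exact ⟨hcc₂, hcA₁⟩
  have hpB : p ∉ insert c₂ A₁ := by
    simp only [mem_insert, not_or]
    exact ⟨hpc₂, hpA₁⟩
  have hSB : ∀ u, u ∈ S ↔ u = c ∨ u = p ∨ u = q ∨ u ∈ insert c₂ A₁ := by
    intro u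
    rw [hSmem, hAmem, mem_insert]
    tauto
  have hcn : ∃ u ∈ insert c₂ A₁, G.Adj c u := by
    obtain ⟨u, hu, hcu⟩ := h.exists_adj hS.1
    refine ⟨u, ?_, hcu⟩
    rcases (hAmem u).1 hu with e | e | rfl
    · simp [e]
    · simp [e]
    · exact (hcq hcu).elim
  have hBcard : #(insert c₂ A₁) % 3 = 0 ∧ 3 ≤ #(insert c₂ A₁) := by
    rw [card_insert_of_notMem hc₂1]
    have := hsplit.card
    rw [hcard2, card_singleton] at this
    have := hA.left_nonempty.card_pos
    omega
  by_cases hT : TwoConnOn G (insert c₂ A₁)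
  · refine pathFactor_of_two_pendants hT ?_ hc hpB hcB hqB hpc' (fun e => hpA₂ e) (fun e => hcA₂ e)
      (mem_insert_self _ _) hp hpc hq hqc₂ hcn hBcard.1 ih
    ext u
    rw [hSB]
    simp only [mem_insert]
    clear * -
    tauto
  obtain ⟨U, v, W, hUW⟩ := (hA.connOn_insert hAchain.1).exists_cutSplit hBcard.2 hT
  have hclique := h.cliqueOn hS.1 hc
  -- Otherwise `U`, `{p}` and `{q}` would be three separated sets of the chain `S`.
  have tip : ∀ U W : Finset V, CutSplit G (insert c₂ A₁) U v W → c₂ ∉ U → (∃ u ∈ U, G.Adj c u) := by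
    intro U W hUW hc₂U
    by_contra hno
    push Not at hno
    refine hS.2 U {p} {q} v c c₂ (hUW.left_sub.trans hBS) (by simpa using hpS) (by simpa using hqS)
      hUW.left_nonempty (by simp) (by simp) ?_ ?_ ?_ ?_ h.symm.closedUpTo hsplit.closedUpTo
    · rw [disjoint_singleton_right]
      exact fun e => hpB (hUW.left_sub e)
    · rw [disjoint_singleton_right]
      exact fun e => hqB (hUW.left_sub e)
    · rw [disjoint_singleton_right, mem_singleton]
      exact fun e => hpA₂ e.symm
    · intro u hu w hw huw
      rcases (hSB w).1 hw with rfl | rfl | rfl | e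
      · exact (hno u hu huw.symm).elim
      · have := hp u (hBS (hUW.left_sub hu)) huw.symm
        exact (hcB (this ▸ hUW.left_sub hu)).elim
      · have := hq u (hBS (hUW.left_sub hu)) huw.symm
        exact (hc₂U (this ▸ hu)).elim
      · exact hUW.closedUpTo u hu w e huw
  -- The two pendants hang on different sides of `v`, so `v` cuts `S` into two sides with at least
  -- two vertices each, and the exception in `CutSplit.pathFactor_or` is excluded.
  have fin : ∀ U W : Finset V, CutSplit G (insert c₂ A₁) U v W → c₂ ∉ U → PathFactor G S := by
    intro U W hUW hc₂U
    obtain ⟨u, hu, hcu⟩ := tip U W hUW hc₂U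
    have hBA : insert c₂ A₁ ⊆ A := by
      intro a ha
      rw [hAmem]
      rw [mem_insert] at ha
      tauto
    have hKW : ∀ w ∈ W, ¬ G.Adj c w := by
      intro w hw hcw
      exact hUW.not_adj u hu w hw (hclique u w ⟨hBA (hUW.left_sub hu), hcu⟩
        ⟨hBA (hUW.right_sub hw), hcw⟩ fun e => disjoint_left.1 hUW.disj hu (e ▸ hw))
    have hc₂W : c₂ ∈ W := by
      by_contra hno
      obtain ⟨w, hw, hcw⟩ := tip W U hUW.symm hno
      exact hKW w hw hcw
    have hvB := hUW.mem
    have hs : CutSplit G S (insert p (insert c U)) v (insert q W) := by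
      refine ⟨?_, by simp, by simp, ?_, ?_, ?_, ?_⟩
      · ext a
        rw [hSB, hUW.eq]
        simp only [mem_insert, mem_union]
        clear * -
        tauto
      · rw [disjoint_left]
        intro a ha hb
        have hcase : (a = p ∨ a = c ∨ a ∈ U) ∧ (a = q ∨ a ∈ W) := by
          simpa [mem_insert] using And.intro ha hb
        rcases hcase with ⟨rfl | rfl | h1, rfl | h2⟩
        · exact hpA₂ rfl
        · exact hpB (hUW.right_sub h2)
        · exact hcA₂ rfl
        · exact hcB (hUW.right_sub h2)
        · exact hqB (hUW.left_sub h1)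
        · exact disjoint_left.1 hUW.disj h1 h2
      · simp only [mem_insert, not_or]
        exact ⟨fun e => hpB (e ▸ hvB), fun e => hcB (e ▸ hvB), hUW.notMem_left⟩
      · simp only [mem_insert, not_or]
        exact ⟨fun e => hqB (e ▸ hvB), hUW.notMem_right⟩
      · intro a ha b hb hab
        have hcase : (a = p ∨ a = c ∨ a ∈ U) ∧ (b = q ∨ b ∈ W) := by
          simpa [mem_insert] using And.intro ha hb
        rcases hcase with ⟨rfl | rfl | h1, rfl | h2⟩
        · exact hcA₂ (hp b hqS hab).symm
        · exact hcB (hp b (hBS (hUW.right_sub h2)) hab ▸ hUW.right_sub h2)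
        · exact hcq hab
        · exact hKW b h2 hab
        · exact hc₂U (hq a (hBS (hUW.left_sub h1)) hab.symm ▸ h1)
        · exact hUW.not_adj a h1 b h2 hab
    rcases hs.pathFactor_or hS hc h3 ih with hF | ⟨-, -, h4⟩
    · exact hF
    · have e1 : 1 < #(insert p (insert c U)) := one_lt_card.2 ⟨p, by simp, c, by simp, hpc'⟩
      have e2 : 1 < #(insert q W) := one_lt_card.2 ⟨q, by simp, c₂, by simp [hc₂W],
        fun e => hqB (by simp [e])⟩
      omega
  by_cases hc₂U : c₂ ∈ U
  · exact fin W U hUW.symm (disjoint_left.1 hUW.disj hc₂U)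
  · exact fin U W hUW hc₂U

/-- If `A` is a single vertex or 2-connected, removing a path `p c a` leaves the empty set or a
smaller chain. Otherwise `A` has a cut vertex, and one of its sides misses `c` because the
neighbours of `c` in `A` form a clique. -/
theorem ChainOn.pathFactor_of_pendant {A : Finset V} {p c : V}
    (hS : ChainOn G S) (hc : ClawFreeOn G S) (h3 : #S % 3 = 0) (h : CutSplit G S A c {p})
    (ih : ∀ T : Finset V, #T < #S → ChainOn G T → ClawFreeOn G T → #T % 3 = 0 → PathFactor G T) :
    PathFactor G S := by
  have hcard := h.card
  rw [card_singleton] at hcard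
  have hAS := h.left_sub
  have hApos := h.left_nonempty.card_pos
  have hpA : p ∉ A := fun e => disjoint_left.1 h.disj e (mem_singleton_self p)
  have hcA := h.notMem_left
  have hcp' : c ≠ p := fun e => h.notMem_right (by simp [e])
  have hcp : G.Adj c p := by
    obtain ⟨u, hu, hcu⟩ := h.symm.exists_adj hS.1
    rw [mem_singleton] at hu
    subst hu
    exact hcu
  obtain ⟨a, ha, hca⟩ := h.exists_adj hS.1
  have fin : PathFactor G (A.erase a) → PathFactor G S := by
    intro hF
    refine PathFactor.of_split (T := {p, c, a})
      (PathFactor.path (fun e => hpA (e ▸ ha)) hcp.symm hca) ?_ ?_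
    · convert hF using 1
      have := h.eq
      clear * - this hpA hcA
      ext u
      grind
    · have := h.eq
      clear * - this ha
      grind
  by_cases hA1 : #A = 1
  · apply fin
    obtain ⟨b, rfl⟩ := card_eq_one.1 hA1
    rw [mem_singleton] at ha
    subst ha
    simpa using PathFactor.empty
  by_cases hA : TwoConnOn G A
  · refine fin (ih _ ?_ (hA.erase_chainOn (hc.mono hAS) ha) (hc.mono ((erase_subset _ _).trans hAS))
      ?_)
    · rw [card_erase_of_mem ha]; omega
    · rw [card_erase_of_mem ha]; omega
  obtain ⟨A₁, c₂, A₂, hAA⟩ := (h.chainOn hS hc).1.exists_cutSplit (by omega) hA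
  by_cases hK : ∀ u ∈ A₂, ¬ G.Adj c u
  · exact hS.pathFactor_of_pendant_of_cutSplit hc h3 h hAA hK ih
  · push Not at hK
    obtain ⟨w, hw, hcw⟩ := hK
    refine hS.pathFactor_of_pendant_of_cutSplit hc h3 h hAA.symm (fun u hu hcu => ?_) ih
    exact hAA.not_adj u hu w hw (h.cliqueOn hS.1 hc u w ⟨hAA.left_sub hu, hcu⟩
      ⟨hAA.right_sub hw, hcw⟩ fun e => disjoint_left.1 hAA.disj hu (e ▸ hw))

theorem ChainOn.pathFactor_of_not_twoConnOn (hS : ChainOn G S) (hc : ClawFreeOn G S)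
    (h3 : #S % 3 = 0) (hno : ¬ TwoConnOn G S)
    (ih : ∀ T : Finset V, #T < #S → ChainOn G T → ClawFreeOn G T → #T % 3 = 0 → PathFactor G T) :
    PathFactor G S := by
  by_cases h0 : #S = 0
  · rw [card_eq_zero.1 h0]
    exact PathFactor.empty
  obtain ⟨A, c, B, h⟩ := hS.1.exists_cutSplit (by omega) hno
  rcases h.pathFactor_or hS hc h3 ih with hF | ⟨-, -, h1 | h1⟩
  · exact hF
  · obtain ⟨p, rfl⟩ := card_eq_one.1 h1
    exact hS.pathFactor_of_pendant hc h3 h.symm ih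
  · obtain ⟨p, rfl⟩ := card_eq_one.1 h1
    exact hS.pathFactor_of_pendant hc h3 h ih

end

/-! ### The two induction statements, and absorbing one vertex of a 2-cut into the other -/

/-- The graph obtained from `G` by joining `a` to all neighbours of `d`. -/
def absorb {V : Type*} (G : SimpleGraph V) (a d : V) : SimpleGraph V :=
  G ⊔ SimpleGraph.fromRel fun u v => u = a ∧ G.Adj d v

/-- Claw-free chains of blocks of fewer than `n` vertices have path factors. -/
def ChainFactorBelow (V : Type*) [DecidableEq V] (n : ℕ) : Prop :=
  ∀ (H : SimpleGraph V) (T : Finset V), #T < n → ChainOn H T → ClawFreeOn H T → #T % 3 = 0 →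
    PathFactor H T

/-- 2-connected claw-free graphs of fewer than `n` vertices have path factors avoiding any given
edge. -/
def EdgeFactorBelow (V : Type*) [DecidableEq V] (n : ℕ) : Prop :=
  ∀ (H : SimpleGraph V) (T : Finset V), #T < n → TwoConnOn H T → ClawFreeOn H T → #T % 3 = 0 →
    ∀ x ∈ T, ∀ y ∈ T, H.Adj x y → PathFactor (H.deleteEdges {s(x, y)}) T

section

variable {V : Type*} [DecidableEq V] {G G' : SimpleGraph V} {S T Z : Finset V}

theorem PathFactor.of_union {T' : Finset V} (hT : PathFactor G T) (hT' : PathFactor G T')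
    (hd : ∀ u ∈ T, u ∉ T') (hS : ∀ u, u ∈ S ↔ u ∈ T ∨ u ∈ T') : PathFactor G S := by
  have := hT.union hT' (disjoint_left.2 hd)
  convert this using 1
  ext u
  rw [hS, mem_union]

theorem PathFactor.deleteEdge {x y : V} (h : PathFactor G T) (hxy : x ∈ T → y ∉ T) :
    PathFactor (G.deleteEdges {s(x, y)}) T := by
  refine h.congr fun u hu v hv huv => ?_
  rw [deleteEdge_adj]
  refine ⟨huv, ?_, ?_⟩
  · rintro ⟨rfl, rfl⟩
    exact hxy hu hv
  · rintro ⟨rfl, rfl⟩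
    exact hxy hv hu

theorem ConnOn.congr (h : ConnOn G S) (hG : ∀ u ∈ S, ∀ v ∈ S, G.Adj u v → G'.Adj u v) :
    ConnOn G' S :=
  fun A hA hn hcl => h A hA hn fun u hu w hw huw => hcl u hu w hw (hG u (hA hu) w hw huw)

theorem absorb_adj {a d u v : V} : (absorb G a d).Adj u v ↔
    G.Adj u v ∨ u ≠ v ∧ (u = a ∧ G.Adj d v ∨ v = a ∧ G.Adj d u) := by
  simp [absorb]

theorem absorb_adj_of_ne {a d u v : V} (hu : u ≠ a) (hv : v ≠ a) :
    (absorb G a d).Adj u v ↔ G.Adj u v := by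
  simp [absorb_adj, hu, hv]

theorem absorb_adj_left {a d v : V} (hv : v ≠ a) :
    (absorb G a d).Adj a v ↔ G.Adj a v ∨ G.Adj d v := by
  simp [absorb_adj, hv, hv.symm]

namespace TwoCut

variable {Y : Finset V} {a d : V}

/-- The new `a` stands for `a`, `d` and `Z` together, so a separated set containing `a` is restored
in `S` by adding `d` and `Z`. A set avoiding `a` and attached elsewhere sees neither `a` nor `d` and
is separated in `S`. If it is attached only at `a` and is not all of `Y`, then it, its complement in
`Y`, and `Z` each contain a neighbour of `a`, which gives a claw. -/
theorem absorb_twoConnOn (h : TwoCut G S Y a d) (h' : TwoCut G S Z a d) (hd : ∀ u ∈ Y, u ∉ Z)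
    (hcov : ∀ u ∈ S, u ∈ Y ∨ u = a ∨ u = d ∨ u ∈ Z) (hS : TwoConnOn G S) (hc : ClawFreeOn G S)
    (hY : 2 ≤ #Y) : TwoConnOn (absorb G a d) (insert a Y) := by
  refine ⟨by rw [card_insert_of_notMem h.left_notMem]; omega, ?_⟩
  have haY := h.left_notMem
  have hdY := h.right_notMem
  have hYa : ∀ {u}, u ∈ Y → u ≠ a := fun hu e => haY (e ▸ hu)
  intro A hA hn c hcl
  have hA' : ∀ u ∈ A, u = a ∨ u ∈ Y := fun u hu => mem_insert.1 (hA hu)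
  by_cases haA : a ∈ A
  · have := hS.2 (insert d (A ∪ Z)) ?_ (by simp) c ?_
    · intro u hu
      have hdu : u ≠ d := by
        rcases mem_insert.1 hu with rfl | hu
        · exact h.ne
        · exact fun e => hdY (e ▸ hu)
      have huZ : u ∉ Z := by
        rcases mem_insert.1 hu with rfl | hu
        · exact h'.left_notMem
        · exact hd u hu
      have huS : u ∈ S := by
        rcases mem_insert.1 hu with rfl | hu
        · exact h.left_mem
        · exact h.sub hu
      have := this huS
      simp only [mem_insert, mem_union] at this ⊢
      tauto
    · intro u hu
      simp only [mem_insert, mem_union] at hu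
      rcases hu with rfl | hu | hu
      · exact h.right_mem
      · rcases hA' u hu with rfl | hu
        · exact h.left_mem
        · exact h.sub hu
      · exact h'.sub hu
    · intro u hu w hw huw
      simp only [mem_insert, mem_union] at hu ⊢
      have key : w ∈ Y → u ∉ Z → w ∈ A ∨ w = c := by
        intro hwY huZ
        rcases hu with rfl | hu | hu
        · exact hcl a haA w (mem_insert_of_mem hwY) ((absorb_adj_left (hYa hwY)).2 (Or.inr huw))
        · exact hcl u hu w (mem_insert_of_mem hwY) (absorb_adj.2 (Or.inl huw))
        · exact (huZ hu).elim
      rcases hcov w hw with hwY | rfl | rfl | hwZ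
      · have := fun e => h.not_adj_of_disjoint h' (fun v hv hv' => hd v hv' hv) w hwY u e huw.symm
        tauto
      · tauto
      · tauto
      · tauto
  have hAY : A ⊆ Y := by
    intro u hu
    rcases hA' u hu with rfl | e
    · exact (haA hu).elim
    · exact e
  by_cases hca : c = a
  · subst hca
    by_contra hno
    obtain ⟨v, hv, hvA⟩ := not_subset.1 hno
    have hvc : v ≠ c := fun e => hvA (by simp [e])
    have hvY := mem_of_mem_insert_of_ne hv hvc
    have hvA' : v ∉ A := fun e => hvA (mem_insert_of_mem e)
    have sep : ∀ p ∈ A, ∀ q ∈ Y \ A, ¬ G.Adj p q := by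
      intro p hp q hq hpq
      have hq' := mem_sdiff.1 hq
      rcases hcl p hp q (mem_insert_of_mem hq'.1) (absorb_adj.2 (Or.inl hpq)) with e | e
      · exact hq'.2 e
      · exact hYa hq'.1 e
    have t1 : TwoCut G S A c d := by
      refine ⟨hAY.trans h.sub, hn, h.left_mem, h.right_mem, h.ne, haA, fun e => hdY (hAY e), ?_⟩
      intro p hp q hq hpq
      rcases h.closed p (hAY hp) q hq hpq with e | e | e
      · by_cases hqA : q ∈ A
        · exact Or.inl hqA
        · exact (sep p hp q (mem_sdiff.2 ⟨e, hqA⟩) hpq).elim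
      · tauto
      · tauto
    have t2 : TwoCut G S (Y \ A) c d := by
      refine ⟨sdiff_subset.trans h.sub, ⟨v, mem_sdiff.2 ⟨hvY, hvA'⟩⟩, h.left_mem, h.right_mem, h.ne,
        fun e => haY (mem_sdiff.1 e).1, fun e => hdY (mem_sdiff.1 e).1, ?_⟩
      intro p hp q hq hpq
      rcases h.closed p (mem_sdiff.1 hp).1 q hq hpq with e | e | e
      · by_cases hqA : q ∈ A
        · exact (sep q hqA p hp hpq.symm).elim
        · exact Or.inl (mem_sdiff.2 ⟨e, hqA⟩)
      · tauto
      · tauto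
    obtain ⟨p, hp, hcp⟩ := t1.exists_adj_left hS
    obtain ⟨q, hq, hcq⟩ := t2.exists_adj_left hS
    obtain ⟨r, hr, hcr⟩ := h'.exists_adj_left hS
    have hqY := (mem_sdiff.1 hq).1
    have nadj := h.not_adj_of_disjoint h' (fun v hv hv' => hd v hv' hv)
    have n1 := sep p hp q hq
    have n2 := nadj p (hAY hp) r hr
    have n3 := nadj q hqY r hr
    have := hc c h.left_mem p (t1.sub hp) q (t2.sub hq) r (h'.sub hr)
      (fun e => (mem_sdiff.1 hq).2 (e ▸ hp)) (fun e => hd p (hAY hp) (e ▸ hr))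
      (fun e => hd q hqY (e ▸ hr)) hcp hcq hcr
    tauto
  · exfalso
    have hno : ∀ u ∈ A, ¬ (G.Adj a u ∨ G.Adj d u) := by
      intro u hu hau
      rcases hcl u hu a (mem_insert_self _ _)
        ((absorb_adj_left (hYa (hAY hu))).2 hau).symm with e | e
      · exact haA e
      · exact hca e.symm
    refine h.not_closedUpTo hS hAY hn c fun u hu w hw huw => ?_
    rcases h.closed u (hAY hu) w hw huw with e | rfl | rfl
    · exact hcl u hu w (mem_insert_of_mem e) (absorb_adj.2 (Or.inl huw))
    · exact (hno u hu (Or.inl huw.symm)).elim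
    · exact (hno u hu (Or.inr huw.symm)).elim

/-- The neighbours of the new `a` are covered by two cliques, the old neighbours of `a` and of `d`
in `Y`. A claw centred in `Y` with leaf `a` comes from a claw of `G` with leaf `a` or `d`. -/
theorem absorb_clawFreeOn (h : TwoCut G S Y a d) (h' : TwoCut G S Z a d) (hd : ∀ u ∈ Y, u ∉ Z)
    (hS : TwoConnOn G S) (hc : ClawFreeOn G S) : ClawFreeOn (absorb G a d) (insert a Y) := by
  have haY := h.left_notMem
  have hYa : ∀ {u}, u ∈ Y → u ≠ a := fun hu e => haY (e ▸ hu)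
  have hd' : ∀ u ∈ Z, u ∉ Y := fun v hv hv' => hd v hv' hv
  have c1 := h.cliqueOn_left h' hd' hS hc
  have c2 := h.cliqueOn_right h' hd' hS hc
  have up : ∀ {u v}, G.Adj u v → (absorb G a d).Adj u v := fun h => absorb_adj.2 (Or.inl h)
  have aux : ∀ c ∈ Y, ∀ y ∈ Y, ∀ z ∈ Y, y ≠ z → (absorb G a d).Adj c a → G.Adj c y →
      G.Adj c z → (absorb G a d).Adj a y ∨ (absorb G a d).Adj a z ∨ (absorb G a d).Adj y z := by
    intro c hcY y hy z hz hyz hca hcy hcz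
    have := hYa hcY
    rw [absorb_adj_left (hYa hy), absorb_adj_left (hYa hz)]
    have fin : ∀ o, (o = a ∨ o = d) → o ∈ S → G.Adj o c →
        (G.Adj a y ∨ G.Adj d y) ∨ (G.Adj a z ∨ G.Adj d z) ∨ (absorb G a d).Adj y z := by
      intro o ho hoS hoc
      have hoY : o ∉ Y := by
        rcases ho with rfl | rfl
        · exact haY
        · exact h.right_notMem
      rcases hc c (h.sub hcY) o hoS y (h.sub hy) z (h.sub hz) (fun e => hoY (e ▸ hy))
        (fun e => hoY (e ▸ hz)) hyz hoc.symm hcy hcz with e | e | e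
      · rcases ho with rfl | rfl <;> tauto
      · rcases ho with rfl | rfl <;> tauto
      · exact Or.inr (Or.inr (up e))
    rcases (absorb_adj_left (hYa hcY)).1 hca.symm with e | e
    · exact fin a (Or.inl rfl) h.left_mem e
    · exact fin d (Or.inr rfl) h.right_mem e
  intro c hcm x hx y hy z hz hxy hxz hyz hcx hcy hcz
  rcases mem_insert.1 hcm with rfl | hcY
  · have hx' := mem_of_mem_insert_of_ne hx hcx.ne'
    have hy' := mem_of_mem_insert_of_ne hy hcy.ne'
    have hz' := mem_of_mem_insert_of_ne hz hcz.ne'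
    rw [absorb_adj_left (hYa hx')] at hcx
    rw [absorb_adj_left (hYa hy')] at hcy
    rw [absorb_adj_left (hYa hz')] at hcz
    have k1 := fun u v hu hv huv hcu hcv => up (c1 u v ⟨hu, hcu⟩ ⟨hv, hcv⟩ huv)
    have k2 := fun u v hu hv huv hcu hcv => up (c2 u v ⟨hu, hcu⟩ ⟨hv, hcv⟩ huv)
    have a1 := k1 x y hx' hy' hxy
    have a2 := k1 x z hx' hz' hxz
    have a3 := k1 y z hy' hz' hyz
    have b1 := k2 x y hx' hy' hxy
    have b2 := k2 x z hx' hz' hxz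
    have b3 := k2 y z hy' hz' hyz
    rcases hcx with e1 | e1 <;> rcases hcy with e2 | e2 <;> rcases hcz with e3 | e3 <;>
      simp_all
  · have dn : ∀ {v}, v ∈ Y → (absorb G a d).Adj c v → G.Adj c v := fun hv e =>
      (absorb_adj_of_ne (hYa hcY) (hYa hv)).1 e
    rcases mem_insert.1 hx with rfl | hx'
    · have hy' := mem_of_mem_insert_of_ne hy hxy.symm
      have hz' := mem_of_mem_insert_of_ne hz hxz.symm
      exact aux c hcY y hy' z hz' hyz hcx (dn hy' hcy) (dn hz' hcz)
    rcases mem_insert.1 hy with rfl | hy'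
    · have hz' := mem_of_mem_insert_of_ne hz hyz.symm
      have := aux c hcY x hx' z hz' hxz hcy (dn hx' hcx) (dn hz' hcz)
      rw [(absorb G y d).adj_comm y x] at this
      tauto
    rcases mem_insert.1 hz with rfl | hz'
    · have := aux c hcY x hx' y hy' hxy hcz (dn hx' hcx) (dn hy' hcy)
      rw [(absorb G z d).adj_comm z x, (absorb G z d).adj_comm z y] at this
      tauto
    · rcases hc c (h.sub hcY) x (h.sub hx') y (h.sub hy') z (h.sub hz') hxy hxz hyz (dn hx' hcx)
        (dn hy' hcy) (dn hz' hcz) with e | e | e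
      · exact Or.inl (up e)
      · exact Or.inr (Or.inl (up e))
      · exact Or.inr (Or.inr (up e))

/-- The ends of the chain are `s` and `t`. Every edge meeting `a`, `d` or `Z` survives the deletion,
as `x` and `y` lie outside; at most an edge between `s` and `t` is lost, and it is not needed. -/
theorem deleteEdge_chainOn (h' : TwoCut G S Z a d) (hS : TwoConnOn G S) {x y s t : V}
    (hx : x ∉ insert a (insert d Z)) (hy : y ∉ insert a (insert d Z))
    (hs : s ∉ insert a (insert d Z)) (ht : t ∉ insert a (insert d Z)) (hst : s ≠ t)
    (has : G.Adj a s) (hdt : G.Adj d t) :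
    ChainOn (G.deleteEdges {s(x, y)}) (insert t (insert s (insert a (insert d Z)))) := by
  have hag : ∀ u ∈ insert a (insert d Z), ∀ v, G.Adj u v → (G.deleteEdges {s(x, y)}).Adj u v := by
    intro u hu v huv
    rw [deleteEdge_adj]
    refine ⟨huv, ?_, ?_⟩
    · rintro ⟨rfl, rfl⟩
      exact hx hu
    · rintro ⟨rfl, rfl⟩
      exact hy hu
  have has' := hag a (by simp) s has
  have hdt' := hag d (by simp) t hdt
  have c0 : ConnOn (G.deleteEdges {s(x, y)}) (insert a (insert d Z)) :=
    (h'.connOn_both hS).congr fun u hu v _ huv => hag u hu v huv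
  have c1 := c0.insert_adj (mem_insert_self _ _) has'.symm
  have c2 := c0.insert_adj (by simp) hdt'.symm
  have c3 := c1.insert_adj (by simp) hdt'.symm
  refine ChainOn.of_cliques c3 (· = s) (· = t) ?_ ?_ ?_
  · intro u v hu hv huv; exact (huv (hu.trans hv.symm)).elim
  · intro u v hu hv huv; exact (huv (hu.trans hv.symm)).elim
  intro T hT hn c hc hcT hcl _
  by_contra hcon
  simp only [exists_eq_right, not_or] at hcon
  obtain ⟨hsT, htT⟩ := hcon
  have hTW : T ⊆ insert a (insert d Z) := by
    intro u hu
    have := hT hu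
    rw [mem_insert, mem_insert] at this
    rcases this with rfl | rfl | e
    · exact (htT hu).elim
    · exact (hsT hu).elim
    · exact e
  have haT : a ∉ T := by
    intro ha
    have := (hcl a ha s (by simp) has').resolve_left hsT
    subst this
    refine htT (c2 T (hTW.trans (subset_insert _ _)) hn (fun u hu w hw huw => ?_) (by simp))
    rcases hcl u hu w (by rw [mem_insert] at hw ⊢; rw [mem_insert]; tauto) huw with e | rfl
    · exact e
    · rcases mem_insert.1 hw with e | e
      · exact (hst e).elim
      · exact (hs e).elim
  have hdT : d ∉ T := by
    intro hd
    have := (hcl d hd t (by simp) hdt').resolve_left htT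
    subst this
    refine hsT (c1 T (hTW.trans (subset_insert _ _)) hn (fun u hu w hw huw => ?_) (by simp))
    rcases hcl u hu w (mem_insert_of_mem hw) huw with e | rfl
    · exact e
    · rcases mem_insert.1 hw with e | e
      · exact (hst e.symm).elim
      · exact (ht e).elim
  have hTZ : T ⊆ Z := by
    intro u hu
    have := hTW hu
    rw [mem_insert, mem_insert] at this
    rcases this with rfl | rfl | e
    · exact (haT hu).elim
    · exact (hdT hu).elim
    · exact e
  refine h'.not_closedUpTo hS hTZ hn c fun u hu w hw huw => ?_
  refine hcl u hu w ?_ (hag u (hTW hu) w huw)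
  have := h'.closed u (hTZ hu) w hw huw
  simp only [mem_insert]
  tauto

end TwoCut

/-- A claw created by the deletion must have `x` and `y` among its leaves, so its centre is a common
neighbour. -/
theorem ClawFreeOn.deleteEdge (hc : ClawFreeOn G S) {x y : V}
    (h : ∀ w ∈ S, x ∈ S → y ∈ S → G.Adj w x → ¬ G.Adj w y) :
    ClawFreeOn (G.deleteEdges {s(x, y)}) S := by
  intro c hcS u hu v hv w hw huv huw hvw hcu hcv hcw
  have key : ∀ p ∈ S, ∀ q ∈ S, G.Adj c p → G.Adj c q → G.Adj p q →
      (G.deleteEdges {s(x, y)}).Adj p q := by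
    intro p hp q hq hcp hcq hpq
    rw [deleteEdge_adj]
    refine ⟨hpq, ?_, ?_⟩
    · rintro ⟨rfl, rfl⟩
      exact h c hcS hp hq hcp hcq
    · rintro ⟨rfl, rfl⟩
      exact h c hcS hq hp hcq hcp
  rw [deleteEdge_adj] at hcu hcv hcw
  rcases hc c hcS u hu v hv w hw huv huw hvw hcu.1 hcv.1 hcw.1 with e | e | e
  · exact Or.inl (key u hu v hv hcu.1 hcv.1 e)
  · exact Or.inr (Or.inl (key u hu w hw hcu.1 hcw.1 e))
  · exact Or.inr (Or.inr (key v hv w hw hcv.1 hcw.1 e))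

-- The factor of the absorbed graph on `Y + a` avoiding `x y` differs from one in `G` only in the
-- path through `a`. If that path uses edges of only one of the old vertices `a` and `d`, it is a
-- path of `G` through that vertex, and the other one goes with `Z`. If it is `s a t` with `s` seen
-- by `a` and `t` by `d`, then `s`, `t`, `a`, `d` and `Z` form a chain of size divisible by three.
set_option maxHeartbeats 1000000 in
theorem TwoCut.pathFactor_deleteEdge {Y : Finset V} {a d x y : V} (h : TwoCut G S Y a d)
    (h' : TwoCut G S Z a d) (hd : ∀ u ∈ Y, u ∉ Z)
    (hcov : ∀ u ∈ S, u ∈ Y ∨ u = a ∨ u = d ∨ u ∈ Z) (hS : TwoConnOn G S) (hc : ClawFreeOn G S)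
    (hY : #Y % 3 = 2) (hZ : #Z % 3 = 2) (hx : x ∈ Y) (hy : y ∈ Y) (hxy : G.Adj x y)
    (hax : G.Adj a x) (hay : Y ⊆ {x, y} → G.Adj a y)
    (ihA : ChainFactorBelow V #S) (ihB : EdgeFactorBelow V #S) :
    PathFactor (G.deleteEdges {s(x, y)}) S := by
  have haY := h.left_notMem
  have hdY := h.right_notMem
  have haZ := h'.left_notMem
  have hdZ := h'.right_notMem
  have hYa : ∀ {u}, u ∈ Y → u ≠ a := fun hu e => haY (e ▸ hu)
  have hYd : ∀ {u}, u ∈ Y → u ≠ d := fun hu e => hdY (e ▸ hu)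
  have had := h.ne
  have hSmem : ∀ u, u ∈ S ↔ u ∈ Y ∨ u = a ∨ u = d ∨ u ∈ Z := fun u => by
    refine ⟨hcov u, ?_⟩
    rintro (e | rfl | rfl | e)
    exacts [h.sub e, h.left_mem, h.right_mem, h'.sub e]
  have hYW : ∀ {u}, u ∈ Y → u ∉ insert a (insert d Z) := by
    intro u hu
    simp only [mem_insert, not_or]
    exact ⟨hYa hu, hYd hu, hd u hu⟩
  have hcard : #S = #Y + #Z + 2 := by
    have e : S = Y ∪ insert a (insert d Z) := by
      ext u
      rw [hSmem]
      simp only [mem_union, mem_insert]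
    rw [e, card_union_of_disjoint (disjoint_left.2 fun u hu => hYW hu), h'.card_both]
    omega
  have c1 := h'.cliqueOn_left h hd hS hc
  have c2 := h'.cliqueOn_right h hd hS hc
  have hZo : ∀ o o', (o = a ∧ o' = d ∨ o = d ∧ o' = a) →
      PathFactor (G.deleteEdges {s(x, y)}) (insert o' Z) := by
    have hxW := hYW hx
    simp only [mem_insert, not_or] at hxW
    rintro o o' (⟨rfl, rfl⟩ | ⟨rfl, rfl⟩)
    · refine (ihA G _ ?_ (h'.symm.chainOn_left hS c1)
        (hc.mono (insert_subset h.right_mem h'.sub)) ?_).deleteEdge fun e => ?_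
      · rw [card_insert_of_notMem hdZ]; omega
      · rw [card_insert_of_notMem hdZ]; omega
      · rw [mem_insert] at e; tauto
    · refine (ihA G _ ?_ (h'.chainOn_left hS c2)
        (hc.mono (insert_subset h.left_mem h'.sub)) ?_).deleteEdge fun e => ?_
      · rw [card_insert_of_notMem haZ]; omega
      · rw [card_insert_of_notMem haZ]; omega
      · rw [mem_insert] at e; tauto
  have fin : ∀ o o' s t, (o = a ∧ o' = d ∨ o = d ∧ o' = a) → s ∈ Y → t ∈ Y →
      PathFactor (G.deleteEdges {s(x, y)}) {o, s, t} →
      PathFactor (G.deleteEdges {s(x, y)}) (Y \ {s, t}) →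
      PathFactor (G.deleteEdges {s(x, y)}) S := by
    intro o o' s t ho hs ht hP hR
    have hPR : PathFactor (G.deleteEdges {s(x, y)}) (insert o Y) := by
      refine hP.of_union hR ?_ ?_
      · intro u hu
        simp only [mem_insert, mem_singleton, mem_sdiff] at hu ⊢
        rcases hu with rfl | hu
        · rcases ho with ⟨rfl, -⟩ | ⟨rfl, -⟩
          · exact fun e => haY e.1
          · exact fun e => hdY e.1
        · exact fun e => e.2 hu
      · intro u
        simp only [mem_insert, mem_singleton, mem_sdiff]
        clear * - hs ht
        constructor
        · tauto
        · rintro ((rfl | rfl | rfl) | e) <;> tauto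
    refine hPR.of_union (hZo o o' ho) ?_ ?_
    · intro u hu
      have := hYW (u := u)
      simp only [mem_insert] at hu this ⊢
      clear * - ho hu this haZ hdZ had
      rcases ho with ⟨rfl, rfl⟩ | ⟨rfl, rfl⟩
      · rcases hu with rfl | hu <;> tauto
      · rcases hu with rfl | hu
        · have := had.symm
          tauto
        · tauto
    · intro u
      rw [hSmem]
      simp only [mem_insert]
      rcases ho with ⟨rfl, rfl⟩ | ⟨rfl, rfl⟩
      · clear * -
        tauto
      · clear * -
        tauto
  have up : ∀ {u v}, u ∉ Y → G.Adj u v → (G.deleteEdges {s(x, y)}).Adj u v := by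
    intro u v hu huv
    rw [deleteEdge_adj]
    refine ⟨huv, ?_, ?_⟩
    · rintro ⟨rfl, -⟩
      exact hu hx
    · rintro ⟨rfl, -⟩
      exact hu hy
  have mixed : ∀ s t, s ∈ Y → t ∈ Y → s ≠ t → G.Adj a s → G.Adj d t →
      PathFactor (G.deleteEdges {s(x, y)}) (Y \ {s, t}) →
      PathFactor (G.deleteEdges {s(x, y)}) S := by
    intro s t hs ht hst has hdt hR
    have tri : ∀ o o', (o = a ∧ o' = d ∨ o = d ∧ o' = a) → G.Adj o x → G.Adj o y →
        ({s, t} : Finset V) = {x, y} → PathFactor (G.deleteEdges {s(x, y)}) S := by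
      intro o o' ho hox hoy e
      have hoY : o ∉ Y := by rcases ho with ⟨rfl, rfl⟩ | ⟨rfl, rfl⟩ <;> assumption
      refine fin o o' x y ho hx hy ?_ (e ▸ hR)
      have := PathFactor.path hxy.ne (up hoY hox).symm (up hoY hoy)
      convert this using 1
      exact Finset.insert_comm _ _ _
    -- Deleting `x y` could create a claw in this chain only at a common neighbour of `x` and `y`,
    -- that is, at `a` or `d`; in that case the triangle provides a path avoiding the edge.
    by_cases hcom : ({s, t} : Finset V) = {x, y} ∧ (G.Adj a x ∧ G.Adj a y ∨ G.Adj d x ∧ G.Adj d y)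
    · rcases hcom with ⟨e, e1 | e1⟩
      · exact tri a d (Or.inl ⟨rfl, rfl⟩) e1.1 e1.2 e
      · exact tri d a (Or.inr ⟨rfl, rfl⟩) e1.1 e1.2 e
    have hsW := hYW hs
    have htW := hYW ht
    have hch := h'.deleteEdge_chainOn hS (hYW hx) (hYW hy) hsW htW hst has hdt
    have hstx : x = s ∨ x = t → y = s ∨ y = t → ({s, t} : Finset V) = {x, y} := by
      have := hxy.ne
      rintro (rfl | rfl) (rfl | rfl)
      · exact (this rfl).elim
      · rfl
      · exact Finset.pair_comm _ _
      · exact (this rfl).elim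
    have hxW : x ∈ insert t (insert s (insert a (insert d Z))) → x = s ∨ x = t := by
      have := hYW hx
      simp only [mem_insert] at this ⊢
      clear * - this
      tauto
    have hyW : y ∈ insert t (insert s (insert a (insert d Z))) → y = s ∨ y = t := by
      have := hYW hy
      simp only [mem_insert] at this ⊢
      clear * - this
      tauto
    have hWS : insert t (insert s (insert a (insert d Z))) ⊆ S := by
      intro u hu
      rw [hSmem]
      simp only [mem_insert] at hu
      rcases hu with rfl | rfl | hu
      · exact Or.inl ht
      · exact Or.inl hs
      · exact Or.inr hu
    have hcl : ClawFreeOn (G.deleteEdges {s(x, y)}) (insert t (insert s (insert a (insert d Z)))) := by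
      refine (hc.mono hWS).deleteEdge fun w hw hxm hym hwx hwy => ?_
      have e := hstx (hxW hxm) (hyW hym)
      have hst' : ∀ u, u = s ∨ u = t → u = x ∨ u = y := by
        intro u hu
        have : u ∈ ({s, t} : Finset V) := by simpa using hu
        rw [e] at this
        simpa using this
      simp only [mem_insert] at hw
      rcases hw with hw | hw | rfl | rfl | hw
      · rcases hst' w (Or.inr hw) with rfl | rfl
        · exact hwx.ne rfl
        · exact hwy.ne rfl
      · rcases hst' w (Or.inl hw) with rfl | rfl
        · exact hwx.ne rfl
        · exact hwy.ne rfl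
      · exact hcom ⟨e, Or.inl ⟨hwx, hwy⟩⟩
      · exact hcom ⟨e, Or.inr ⟨hwx, hwy⟩⟩
      · exact h'.not_adj_of_disjoint h hd w hw x hx hwx
    have hcW : #(insert t (insert s (insert a (insert d Z)))) = #Z + 4 := by
      rw [card_insert_of_notMem (by rw [mem_insert]; exact not_or.2 ⟨hst.symm, htW⟩),
        card_insert_of_notMem hsW, h'.card_both]
    -- Needed for the chain to be smaller than `S`. If `Y = {s, t} = {x, y}`, then `a` sees both `x`
    -- and `y`, the case already treated.
    have hlt : 2 < #Y := by
      by_contra hle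
      have h2 : #({s, t} : Finset V) = 2 := card_pair hst
      have e1 : ({s, t} : Finset V) = Y :=
        eq_of_subset_of_card_le (insert_subset hs (by simpa using ht)) (by omega)
      have e2 : ({x, y} : Finset V) = Y :=
        eq_of_subset_of_card_le (insert_subset hx (by simpa using hy))
          (by rw [card_pair hxy.ne]; omega)
      exact hcom ⟨e1.trans e2.symm, Or.inl ⟨hax, hay e2.symm.subset⟩⟩
    refine (ihA _ _ (by omega) hch hcl (by omega)).of_union hR ?_ ?_
    · intro u hu
      have := hYW (u := u)
      simp only [mem_insert, mem_sdiff, mem_singleton] at hu this ⊢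
      clear * - hu this
      tauto
    · intro u
      rw [hSmem]
      simp only [mem_insert, mem_sdiff, mem_singleton]
      clear * - hs ht
      constructor
      · tauto
      · rintro ((rfl | rfl | e) | e) <;> tauto
  have hcY : #(insert a Y) = #Y + 1 := card_insert_of_notMem haY
  have hZpos := h'.nonempty.card_pos
  have hF := ihB (absorb G a d) (insert a Y) (by omega)
    (h.absorb_twoConnOn h' hd hcov hS hc (by omega)) (h.absorb_clawFreeOn h' hd hS hc) (by omega)
    x (mem_insert_of_mem hx) y (mem_insert_of_mem hy) (absorb_adj.2 (Or.inl hxy))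
  obtain ⟨p, q, r, hp, hq, hr, hpr, hpq, hqr, hm, hR⟩ := hF.exists_path (mem_insert_self a Y)
  have down : ∀ u ∈ Y, ∀ v ∈ Y, ((absorb G a d).deleteEdges {s(x, y)}).Adj u v →
      (G.deleteEdges {s(x, y)}).Adj u v := by
    intro u hu v hv huv
    rw [deleteEdge_adj] at huv ⊢
    rwa [absorb_adj_of_ne (hYa hu) (hYa hv)] at huv
  have downa : ∀ u ∈ insert a Y, ((absorb G a d).deleteEdges {s(x, y)}).Adj a u →
      u ∈ Y ∧ (G.Adj a u ∨ G.Adj d u) := by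
    intro u hu hau
    have huY := mem_of_mem_insert_of_ne hu hau.ne'
    rw [deleteEdge_adj, absorb_adj_left (hYa huY)] at hau
    exact ⟨huY, hau.1⟩
  have rest : ∀ s t, ({p, q, r} : Finset V) = {a, s, t} →
      PathFactor (G.deleteEdges {s(x, y)}) (Y \ {s, t}) := by
    intro s t e
    rw [e] at hR
    have e2 : insert a Y \ {a, s, t} = Y \ {s, t} := by
      ext u
      simp only [mem_sdiff, mem_insert, mem_singleton]
      constructor
      · rintro ⟨h1, h2⟩
        clear * - h1 h2
        tauto
      · rintro ⟨hu, hn⟩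
        have := hYa hu
        clear * - hu hn this
        tauto
    rw [e2] at hR
    exact hR.congr fun u hu v hv => down u (mem_sdiff.1 hu).1 v (mem_sdiff.1 hv).1
  have ending : ∀ s t, s ∈ insert a Y → t ∈ insert a Y → a ≠ t →
      ((absorb G a d).deleteEdges {s(x, y)}).Adj a s →
      ((absorb G a d).deleteEdges {s(x, y)}).Adj s t → ({p, q, r} : Finset V) = {a, s, t} →
      PathFactor (G.deleteEdges {s(x, y)}) S := by
    intro s t hs ht hat has hst e
    obtain ⟨hsY, has'⟩ := downa s hs has
    have htY := mem_of_mem_insert_of_ne ht hat.symm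
    have hst' := down s hsY t htY hst
    rcases has' with has' | has'
    · exact fin a d s t (Or.inl ⟨rfl, rfl⟩) hsY htY
        (PathFactor.path hat (up haY has') hst') (rest s t e)
    · exact fin d a s t (Or.inr ⟨rfl, rfl⟩) hsY htY
        (PathFactor.path (hYd htY).symm (up hdY has') hst') (rest s t e)
  rcases hm with rfl | rfl | rfl
  · exact ending q r hq hr hpr hpq hqr rfl
  · obtain ⟨hpY, hap⟩ := downa p hp hpq.symm
    obtain ⟨hrY, har⟩ := downa r hr hqr
    have e : ({p, a, r} : Finset V) = {a, p, r} := Finset.insert_comm _ _ _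
    have e' : ({p, a, r} : Finset V) = {a, r, p} := by rw [e, Finset.pair_comm]
    have mid : ∀ o o', (o = a ∧ o' = d ∨ o = d ∧ o' = a) → G.Adj o p → G.Adj o r →
        PathFactor (G.deleteEdges {s(x, y)}) S := by
      intro o o' ho hop hor
      have hoY : o ∉ Y := by rcases ho with ⟨rfl, rfl⟩ | ⟨rfl, rfl⟩ <;> assumption
      refine fin o o' p r ho hpY hrY ?_ (rest p r e)
      rw [Finset.insert_comm]
      exact PathFactor.path hpr (up hoY hop).symm (up hoY hor)
    rcases hap with h1 | h1 <;> rcases har with h2 | h2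
    · exact mid a d (Or.inl ⟨rfl, rfl⟩) h1 h2
    · exact mixed p r hpY hrY hpr h1 h2 (rest p r e)
    · exact mixed r p hrY hpY hpr.symm h2 h1 (rest r p e')
    · exact mid d a (Or.inr ⟨rfl, rfl⟩) h1 h2
  · refine ending q p hq hp hpr.symm hqr.symm hpq.symm ?_
    ext u
    simp only [mem_insert, mem_singleton]
    clear * -
    tauto

/-! ### Avoiding `x y` when deleting `x` leaves a cut vertex -/

theorem CutSplit.twoCut {A B : Finset V} {x c : V} (h : CutSplit G (S.erase x) A c B)
    (hx : x ∈ S) : TwoCut G S A x c := by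
  refine ⟨h.left_sub.trans (erase_subset _ _), h.left_nonempty, hx, mem_of_mem_erase h.mem,
    (ne_of_mem_erase h.mem).symm, fun e => notMem_erase _ _ (h.left_sub e), h.notMem_left, ?_⟩
  intro u hu w hw huw
  by_cases hwx : w = x
  · exact Or.inr (Or.inl hwx)
  · have := h.closedUpTo u hu w (mem_erase.2 ⟨hwx, hw⟩) huw
    tauto

theorem CutSplit.notMem_of_left {A B : Finset V} {c u : V} (h : CutSplit G S A c B)
    (hu : u ∈ A) : u ∉ B :=
  disjoint_left.1 h.disj hu

theorem CutSplit.mem_iff {A B : Finset V} {c : V} (h : CutSplit G S A c B) (u : V) :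
    u ∈ S ↔ u = c ∨ u ∈ A ∨ u ∈ B := by
  rw [h.eq]
  simp

theorem CutSplit.mem_iff_of_erase {A B : Finset V} {x c : V} (h : CutSplit G (S.erase x) A c B)
    (hx : x ∈ S) (u : V) : u ∈ S ↔ u = x ∨ u = c ∨ u ∈ A ∨ u ∈ B := by
  rw [← h.mem_iff, mem_erase]
  by_cases e : u = x
  · simp [e, hx]
  · simp [e]

theorem CutSplit.card_of_erase {A B : Finset V} {x c : V} (h : CutSplit G (S.erase x) A c B)
    (hx : x ∈ S) : #S = #A + #B + 2 := by
  have := h.card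
  have := card_erase_add_one hx
  omega

/-- The sizes of the sides add up to 1 modulo 3. If one is 0, the other side with `x` and `y` is
2-connected thanks to the edge, and the edge statement applies to it. If both are 2, adding `x` to
one side and `y` to the other puts the ends of the edge into different parts. -/
theorem TwoConnOn.pathFactor_of_cut_edge (hS : TwoConnOn G S) (hc : ClawFreeOn G S)
    (h3 : #S % 3 = 0) {x y : V} {Z₁ Z₂ : Finset V} (hx : x ∈ S) (hxy : G.Adj x y)
    (h : CutSplit G (S.erase x) Z₁ y Z₂) (ihA : ChainFactorBelow V #S)
    (ihB : EdgeFactorBelow V #S) : PathFactor (G.deleteEdges {s(x, y)}) S := by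
  have aux : ∀ Z₁ Z₂, CutSplit G (S.erase x) Z₁ y Z₂ → #Z₁ % 3 = 0 ∨ #Z₁ % 3 = 2 ∧ #Z₂ % 3 = 2 →
      PathFactor (G.deleteEdges {s(x, y)}) S := by
    intro Z₁ Z₂ h hcase
    have h1 := h.twoCut hx
    have h2 := h.symm.twoCut hx
    have hd : ∀ u ∈ Z₁, u ∉ Z₂ := fun u hu => h.notMem_of_left hu
    have hd' : ∀ u ∈ Z₂, u ∉ Z₁ := fun u hu => h.symm.notMem_of_left hu
    have hcard := h.card_of_erase hx
    have hmem := h.mem_iff_of_erase hx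
    have n1 := h1.nonempty.card_pos
    have n2 := h2.nonempty.card_pos
    have x1 := h1.left_notMem
    have x2 := h2.left_notMem
    have y1 := h1.right_notMem
    have y2 := h2.right_notMem
    have hne := hxy.ne
    have cx1 := h1.cliqueOn_left h2 hd' hS hc
    have cy1 := h1.cliqueOn_right h2 hd' hS hc
    have cx2 := h2.cliqueOn_left h1 hd hS hc
    have cy2 := h2.cliqueOn_right h1 hd hS hc
    rcases hcase with h0 | ⟨h0, h0'⟩
    · have f1 := (ihA G Z₁ (by omega) (h1.chainOn hS cx1 cy1) (hc.mono h1.sub) h0).deleteEdge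
        (x := x) (y := y) fun e => (x1 e).elim
      have f2 := ihB G (insert x (insert y Z₂)) (by rw [h2.card_both]; omega)
        (h2.twoConnOn hS hxy)
        (hc.mono (insert_subset hx (insert_subset h2.right_mem h2.sub)))
        (by rw [h2.card_both]; omega) x (by simp) y (by simp) hxy
      refine f1.of_union f2 ?_ ?_
      · intro u hu
        have := hd u hu
        simp only [mem_insert, not_or]
        exact ⟨fun e => x1 (e ▸ hu), fun e => y1 (e ▸ hu), this⟩
      · intro u
        rw [hmem]
        simp only [mem_insert]
        clear * -
        tauto
    · have f1 := (ihA G (insert x Z₁) (by rw [card_insert_of_notMem x1]; omega)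
        (h1.chainOn_left hS cy1) (hc.mono (insert_subset hx h1.sub))
        (by rw [card_insert_of_notMem x1]; omega)).deleteEdge
        (x := x) (y := y) fun _ e => by simp [hne.symm, y1] at e
      have f2 := (ihA G (insert y Z₂) (by rw [card_insert_of_notMem y2]; omega)
        (h2.symm.chainOn_left hS cx2) (hc.mono (insert_subset h2.right_mem h2.sub))
        (by rw [card_insert_of_notMem y2]; omega)).deleteEdge
        (x := x) (y := y) fun e => by simp [hne, x2] at e
      refine f1.of_union f2 ?_ ?_
      · intro u hu
        simp only [mem_insert, not_or]
        rcases mem_insert.1 hu with rfl | hu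
        · exact ⟨hne, x2⟩
        · exact ⟨fun e => y1 (e ▸ hu), hd u hu⟩
      · intro u
        rw [hmem]
        simp only [mem_insert]
        clear * -
        tauto
  have hcard := h.card_of_erase hx
  by_cases h0 : #Z₂ % 3 = 0
  · exact aux Z₂ Z₁ h.symm (Or.inl h0)
  · exact aux Z₁ Z₂ h (by omega)

/-- The two sides of a 2-cut `{x, d}` with an edge at `x` going into the side `Z₁`, when `Z₁` is
minimal. -/
theorem TwoConnOn.pathFactor_of_minimal_cut (hS : TwoConnOn G S) (hc : ClawFreeOn G S)
    (h3 : #S % 3 = 0) {x y d : V} {Z₁ Z₂ : Finset V} (hx : x ∈ S) (hxy : G.Adj x y)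
    (h : CutSplit G (S.erase x) Z₁ d Z₂) (hy : y ∈ Z₁)
    (hmin : ∀ T v T', CutSplit G (S.erase x) T v T' → y ∈ T → #Z₁ ≤ #T)
    (ihA : ChainFactorBelow V #S) (ihB : EdgeFactorBelow V #S)
    (h1 : #Z₁ % 3 = 1) : PathFactor (G.deleteEdges {s(x, y)}) S := by
  have t1 := h.twoCut hx
  have t2 := h.symm.twoCut hx
  have hd : ∀ u ∈ Z₁, u ∉ Z₂ := fun u hu => h.notMem_of_left hu
  have hd' : ∀ u ∈ Z₂, u ∉ Z₁ := fun u hu => h.symm.notMem_of_left hu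
  have hcard := h.card_of_erase hx
  have hmem := h.mem_iff_of_erase hx
  have n1 := t1.nonempty.card_pos
  have n2 := t2.nonempty.card_pos
  have x1 := t1.left_notMem
  have x2 := t2.left_notMem
  have d1 := t1.right_notMem
  have d2 := t2.right_notMem
  have hyd : y ≠ d := fun e => d1 (e ▸ hy)
  have hyS : y ∈ S := t1.sub hy
  have hHS : insert x (insert d Z₁) ⊆ S := insert_subset hx (insert_subset t1.right_mem t1.sub)
  by_cases hT : TwoConnOn G (insert x (insert d Z₁))
  · have f1 := ihB G _ (by rw [t1.card_both]; omega) hT (hc.mono hHS)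
      (by rw [t1.card_both]; omega) x (by simp) y (by simp [hy]) hxy
    have f2 := (ihA G Z₂ (by omega) (t2.chainOn hS (t2.cliqueOn_left t1 hd hS hc)
      (t2.cliqueOn_right t1 hd hS hc)) (hc.mono t2.sub) (by omega)).deleteEdge (x := x) (y := y)
        fun e => (x2 e).elim
    refine f1.of_union f2 ?_ ?_
    · intro u hu
      simp only [mem_insert] at hu
      rcases hu with rfl | rfl | hu
      exacts [x2, d2, hd u hu]
    · intro u
      rw [hmem]
      simp only [mem_insert]
      clear * -
      tauto
  obtain ⟨T₀, v, T₀', hsp₀⟩ := (t1.chainOn_both hS).1.exists_cutSplit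
    (by rw [t1.card_both]; omega) hT
  have side : ∀ T T', CutSplit G (insert x (insert d Z₁)) T v T' → x ∈ T ∨ d ∈ T := by
    intro T T' hsp
    by_contra hno
    push Not at hno
    have hTZ : T ⊆ Z₁ := by
      intro u hu
      have := hsp.left_sub hu
      simp only [mem_insert] at this
      rcases this with rfl | rfl | e
      exacts [(hno.1 hu).elim, (hno.2 hu).elim, e]
    exact t1.not_closedUpTo hS hTZ hsp.left_nonempty v (t1.closedUpTo_of_subset hTZ
      ((subset_insert _ _).trans (subset_insert _ _)) hsp.closedUpTo (by simp) (by simp))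
  have hsp : ∃ T T', CutSplit G (insert x (insert d Z₁)) T v T' ∧ x ∈ T ∧ d ∈ T' := by
    have s1 := side _ _ hsp₀
    have s2 := side _ _ hsp₀.symm
    have e : ∀ u ∈ T₀, u ∉ T₀' := fun u hu => hsp₀.notMem_of_left hu
    have e1 := e x
    have e2 := e d
    by_cases hxT : x ∈ T₀
    · exact ⟨T₀, T₀', hsp₀, hxT, by tauto⟩
    · exact ⟨T₀', T₀, hsp₀.symm, by tauto, by tauto⟩
  obtain ⟨T, T', hsp, hxT, hdT'⟩ := hsp
  clear hsp₀ side
  have hvx : v ≠ x := fun e => hsp.notMem_left (e ▸ hxT)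
  have hvd : v ≠ d := fun e => hsp.notMem_right (e ▸ hdT')
  have hvZ : v ∈ Z₁ := by
    have := hsp.mem
    simpa [hvx, hvd] using this
  have hyT' : y ∉ T' := fun e => hsp.not_adj x hxT y e hxy
  have hHmem := hsp.mem_iff
  have hTd : ∀ u ∈ T, u ∉ T' := fun u hu => hsp.notMem_of_left hu
  have hTZ : ∀ u ∈ T, u ≠ x → u ∈ Z₁ := by
    intro u hu hux
    have := hsp.left_sub hu
    simp only [mem_insert] at this
    rcases this with e | rfl | e
    exacts [(hux e).elim, (hTd u hu hdT').elim, e]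
  have hxT' := hTd x hxT
  have hsplit : (T.erase x).Nonempty → CutSplit G (S.erase x) (T.erase x) v (T' ∪ Z₂) := by
    intro hn
    refine ⟨?_, hn, ⟨d, by simp [hdT']⟩, ?_, ?_, ?_, ?_⟩
    · ext u
      have e1 := hHmem u
      have e2 := hmem u
      simp only [mem_erase, mem_insert, mem_union] at e1 e2 ⊢
      clear * - e1 e2 hvx x2 hxT'
      by_cases hux : u = x
      · subst hux
        tauto
      · tauto
    · rw [disjoint_left]
      intro u hu hu'
      have hu1 := mem_erase.1 hu
      rcases mem_union.1 hu' with e | e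
      · exact hTd u hu1.2 e
      · exact hd u (hTZ u hu1.2 hu1.1) e
    · exact fun e => hsp.notMem_left (mem_of_mem_erase e)
    · intro e
      rcases mem_union.1 e with e | e
      · exact hsp.notMem_right e
      · exact hd v hvZ e
    · intro u hu w hw huw
      have hu1 := mem_erase.1 hu
      rcases mem_union.1 hw with e | e
      · exact hsp.not_adj u hu1.2 w e huw
      · exact h.not_adj u (hTZ u hu1.2 hu1.1) w e huw
  -- The vertex `v` separates `x` from `d` in this piece, so what remains of `T` without `x` is a
  -- side of the cut `{x, v}` of `S`. It is smaller than `Z₁`, so minimality allows only `y = v`.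
  by_cases hn : (T.erase x).Nonempty
  · have hs := hsplit hn
    by_cases hyv : y = v
    · subst hyv
      exact hS.pathFactor_of_cut_edge hc h3 hx hxy hs ihA ihB
    · exfalso
      have hyT : y ∈ T.erase x := by
        have := (hHmem y).1 (by simp [hy])
        rw [mem_erase]
        exact ⟨hxy.ne', by tauto⟩
      have hle := hmin _ _ _ hs hyT
      have hlt : #(T.erase x) < #Z₁ := by
        refine card_lt_card ⟨fun u hu => hTZ u (mem_erase.1 hu).2 (mem_erase.1 hu).1, fun hs => ?_⟩
        exact hsp.notMem_left (mem_of_mem_erase (hs hvZ))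
      omega
  have hTx : ∀ u ∈ T, u = x := by
    intro u hu
    by_contra hux
    exact hn ⟨u, mem_erase.2 ⟨hux, hu⟩⟩
  have hxN : ∀ u ∈ insert x (insert d Z₁), G.Adj x u → u = v := by
    intro u hu hxu
    rcases (hHmem u).1 hu with e | e | e
    · exact e
    · exact (hxu.ne (hTx u e).symm).elim
    · exact (hsp.not_adj x hxT u e hxu).elim
  have hyv : y = v := hxN y (by simp [hy]) hxy
  subst hyv
  -- Now `y` is the only neighbour of `x` on this side. Without `x y` the set `S` is still a chain;
  -- it stays claw-free because `x` and `y` have no common neighbour, and `d` cuts it. Hence only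
  -- smaller chains of the reduced graph are used.
  refine (hS.deleteEdge_chainOn hxy hx hyS).pathFactor_of_not_twoConnOn
    (hc.deleteEdge fun w hw _ _ hwx hwy => ?_) h3 ?_ (fun T hT => ihA _ T hT)
  · have hwH : w ∈ insert x (insert d Z₁) := by
      have := t1.closed y hy w hw hwy.symm
      rw [mem_insert, mem_insert]
      clear * - this
      tauto
    exact hwy.ne (hxN w hwH hwx.symm)
  · intro hF
    have := hF.2 (insert x Z₂) (insert_subset hx t2.sub) (by simp) d (by
      intro u hu w hw huw
      rw [deleteEdge_adj] at huw
      rcases mem_insert.1 hu with rfl | hu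
      · rcases (hmem w).1 hw with rfl | rfl | e | e
        · simp
        · simp
        · exact (huw.2.1 ⟨rfl, hxN w (by simp [e]) huw.1⟩).elim
        · simp [e]
      · have := t2.closed u hu w hw huw.1
        rw [mem_insert]
        clear * - this
        tauto)
    have hy2 := this hyS
    simp only [mem_insert] at hy2
    rcases hy2 with e | e | e
    · exact hyd e
    · exact hxy.ne' e
    · exact hd y hy e

/-- If `y` is not the cut vertex `d`, it lies in a side `Z₁`. When the size of `Z₁` is 0 or 2 modulo
3, the vertices `x` and `d` can be distributed so that `x` and `y` are in different parts. Residue 1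
would keep them together; the minimal choice of `Z₁` is made for that case. -/
theorem TwoConnOn.pathFactor_of_not_twoConnOn_erase (hS : TwoConnOn G S) (hc : ClawFreeOn G S)
    (h3 : #S % 3 = 0) (hcard4 : 4 ≤ #S) {x y : V} (hx : x ∈ S) (hy : y ∈ S) (hxy : G.Adj x y)
    (hno : ¬ TwoConnOn G (S.erase x)) (ihA : ChainFactorBelow V #S)
    (ihB : EdgeFactorBelow V #S) : PathFactor (G.deleteEdges {s(x, y)}) S := by
  obtain ⟨A, c, B, hsp⟩ := (hS.erase_chainOn hc hx).1.exists_cutSplit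
    (by rw [card_erase_of_mem hx]; omega) hno
  have hyx : y ∈ S.erase x := mem_erase.2 ⟨hxy.ne', hy⟩
  by_cases hyc : y = c
  · subst hyc
    exact hS.pathFactor_of_cut_edge hc h3 hx hxy hsp ihA ihB
  have hex : ∃ n, ∃ Z₁ d Z₂, CutSplit G (S.erase x) Z₁ d Z₂ ∧ y ∈ Z₁ ∧ #Z₁ = n := by
    rcases hsp.mem_or hyx with e | e | e
    · exact (hyc e).elim
    · exact ⟨_, A, c, B, hsp, e, rfl⟩
    · exact ⟨_, B, c, A, hsp.symm, e, rfl⟩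
  classical
  obtain ⟨Z₁, d, Z₂, h, hyZ, hn⟩ := Nat.find_spec hex
  have hmin : ∀ T v T', CutSplit G (S.erase x) T v T' → y ∈ T → #Z₁ ≤ #T := by
    intro T v T' hT hyT
    rw [hn]
    exact Nat.find_min' hex ⟨T, v, T', hT, hyT, rfl⟩
  clear hn hsp hyc
  have t1 := h.twoCut hx
  have t2 := h.symm.twoCut hx
  have hd : ∀ u ∈ Z₁, u ∉ Z₂ := fun u hu => h.notMem_of_left hu
  have hd' : ∀ u ∈ Z₂, u ∉ Z₁ := fun u hu => h.symm.notMem_of_left hu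
  have hcard := h.card_of_erase hx
  have hmem := h.mem_iff_of_erase hx
  have n1 := t1.nonempty.card_pos
  have n2 := t2.nonempty.card_pos
  have x1 := t1.left_notMem
  have x2 := t2.left_notMem
  have d1 := t1.right_notMem
  have d2 := t2.right_notMem
  have hxd := t1.ne
  have hyd : y ≠ d := fun e => d1 (e ▸ hyZ)
  have cx1 := t1.cliqueOn_left t2 hd' hS hc
  have cd1 := t1.cliqueOn_right t2 hd' hS hc
  have cx2 := t2.cliqueOn_left t1 hd hS hc
  have cd2 := t2.cliqueOn_right t1 hd hS hc
  have hcase : #Z₁ % 3 = 0 ∨ #Z₁ % 3 = 2 ∨ #Z₁ % 3 = 1 := by omega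
  rcases hcase with h0 | h0 | h0
  · have f1 := (ihA G Z₁ (by omega) (t1.chainOn hS cx1 cd1) (hc.mono t1.sub) h0).deleteEdge
      (x := x) (y := y) fun e => (x1 e).elim
    have f2 := (ihA G (insert x (insert d Z₂)) (by rw [t2.card_both]; omega)
      (t2.chainOn_both hS) (hc.mono (insert_subset hx (insert_subset t2.right_mem t2.sub)))
      (by rw [t2.card_both]; omega)).deleteEdge (x := x) (y := y) fun _ e => by
        simp only [mem_insert] at e
        rcases e with e | e | e
        exacts [hxy.ne' e, hyd e, hd y hyZ e]
    refine f1.of_union f2 ?_ ?_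
    · intro u hu
      simp only [mem_insert, not_or]
      exact ⟨fun e => x1 (e ▸ hu), fun e => d1 (e ▸ hu), hd u hu⟩
    · intro u
      rw [hmem]
      simp only [mem_insert]
      clear * -
      tauto
  · have f1 := (ihA G (insert d Z₁) (by rw [card_insert_of_notMem d1]; omega)
      (t1.symm.chainOn_left hS cx1) (hc.mono (insert_subset t1.right_mem t1.sub))
      (by rw [card_insert_of_notMem d1]; omega)).deleteEdge
      (x := x) (y := y) fun e => by simp [hxd, x1] at e
    have f2 := (ihA G (insert x Z₂) (by rw [card_insert_of_notMem x2]; omega)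
      (t2.chainOn_left hS cd2) (hc.mono (insert_subset hx t2.sub))
      (by rw [card_insert_of_notMem x2]; omega)).deleteEdge
      (x := x) (y := y) fun _ e => by simp [hxy.ne', hd y hyZ] at e
    refine f1.of_union f2 ?_ ?_
    · intro u hu
      simp only [mem_insert, not_or]
      rcases mem_insert.1 hu with rfl | hu
      · exact ⟨hxd.symm, d2⟩
      · exact ⟨fun e => x1 (e ▸ hu), hd u hu⟩
    · intro u
      rw [hmem]
      simp only [mem_insert]
      clear * -
      tauto
  · exact hS.pathFactor_of_minimal_cut hc h3 hx hxy h hyZ hmin ihA ihB h0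

/-! ### Avoiding `x y` when deleting `x` leaves a 2-connected graph -/

theorem TwoConnOn.exists_adj_ne (hS : TwoConnOn G S) {x : V} (hx : x ∈ S) (y : V) :
    ∃ a ∈ S, G.Adj x a ∧ a ≠ y := by
  by_contra hno
  push Not at hno
  have := hS.2 {x} (by simpa using hx) (by simp) y (by
    intro u hu w hw huw
    rw [mem_singleton] at hu
    subst hu
    exact Or.inr (hno w hw huw))
  have := card_le_card this
  have := card_le_two (a := y) (b := x)
  have := hS.1
  omega

theorem TwoConnOn.exists_adj_pair_ne (hS : TwoConnOn G S) (h4 : 4 ≤ #S) {x a : V} (hx : x ∈ S)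
    (ha : a ∈ S) (y : V) :
    ∃ b ∈ S, b ≠ x ∧ b ≠ a ∧ b ≠ y ∧ (G.Adj x b ∨ G.Adj a b) := by
  by_contra hno
  push Not at hno
  have := hS.2 {x, a} (by simp [insert_subset_iff, hx, ha]) (by simp) y (by
    intro u hu w hw huw
    simp only [mem_insert, mem_singleton] at hu ⊢
    by_contra hw'
    push Not at hw'
    have := hno w hw hw'.1.1 hw'.1.2 hw'.2
    rcases hu with rfl | rfl
    exacts [this.1 huw, this.2 huw])
  have := card_le_card this
  have := card_le_three (a := y) (b := x) (c := a)
  omega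

/-- A path on `x`, `a` and a further vertex `b ≠ y` puts `x` and `y` into different parts, and
removing `b` from the 2-connected rest leaves a chain. -/
theorem TwoConnOn.pathFactor_of_twoConnOn_erase_erase (hS : TwoConnOn G S) (hc : ClawFreeOn G S)
    (h3 : #S % 3 = 0) (h4 : 4 ≤ #S) {x y a : V} (hx : x ∈ S) (ha : a ∈ S)
    (hxy : G.Adj x y) (hxa : G.Adj x a) (hay : a ≠ y) (hT : TwoConnOn G ((S.erase x).erase a))
    (ihA : ChainFactorBelow V #S) : PathFactor (G.deleteEdges {s(x, y)}) S := by
  obtain ⟨b, hb, hbx, hba, hby, hadj⟩ := hS.exists_adj_pair_ne h4 hx ha y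
  have hbT : b ∈ (S.erase x).erase a := by simp [*]
  have haT : a ∈ S.erase x := mem_erase.2 ⟨hxa.ne', ha⟩
  have c1 := card_erase_add_one hx
  have c2 := card_erase_add_one haT
  have c3 := card_erase_add_one hbT
  have f2 := (ihA G (((S.erase x).erase a).erase b) (by omega)
    (hT.erase_chainOn (hc.mono ((erase_subset _ _).trans (erase_subset _ _))) hbT)
    (hc.mono ((erase_subset _ _).trans ((erase_subset _ _).trans (erase_subset _ _)))) (by omega)
    ).deleteEdge (x := x) (y := y) fun e => by simp at e
  have f1 : PathFactor G {x, a, b} := by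
    rcases hadj with e | e
    · rw [Finset.insert_comm]
      exact PathFactor.path hba.symm hxa.symm e
    · exact PathFactor.path hbx.symm hxa e
  refine (f1.deleteEdge (x := x) (y := y) fun _ e => ?_).of_union f2 ?_ ?_
  · simp only [mem_insert, mem_singleton] at e
    rcases e with e | e | e
    exacts [hxy.ne' e, hay e.symm, hby e.symm]
  · intro u hu
    simp only [mem_insert, mem_singleton] at hu
    simp only [mem_erase]
    clear * - hu
    tauto
  · intro u
    simp only [mem_insert, mem_singleton, mem_erase]
    by_cases e1 : u = x
    · simp [e1, hx]
    by_cases e2 : u = a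
    · simp [e2, ha]
    by_cases e3 : u = b
    · simp [e3, hb]
    · simp [e1, e2, e3]

/-- The sizes of the sides add up to 0 modulo 3. If both are 0, one side is set apart and the other
with `x`, `a`, `y` is 2-connected, so the edge statement applies. If they are 1 and 2, then `x` and
`a` join the first and `y` the second. -/
theorem TwoConnOn.pathFactor_of_cut_edge_erase {x y a : V}
    (hS : TwoConnOn G (S.erase x)) (hc : ClawFreeOn G S)
    (h3 : #S % 3 = 0) {Z₁ Z₂ : Finset V} (hx : x ∈ S) (ha : a ∈ S)
    (hxy : G.Adj x y) (hxa : G.Adj x a) (h : CutSplit G ((S.erase x).erase a) Z₁ y Z₂)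
    (ihA : ChainFactorBelow V #S) (ihB : EdgeFactorBelow V #S) :
    PathFactor (G.deleteEdges {s(x, y)}) S := by
  have haT : a ∈ S.erase x := mem_erase.2 ⟨hxa.ne', ha⟩
  have aux : ∀ Z₁ Z₂, CutSplit G ((S.erase x).erase a) Z₁ y Z₂ →
      #Z₁ % 3 = 0 ∧ #Z₂ % 3 = 0 ∨ #Z₁ % 3 = 1 ∧ #Z₂ % 3 = 2 →
      PathFactor (G.deleteEdges {s(x, y)}) S := by
    intro Z₁ Z₂ h hcase
    have hsub : S.erase x ⊆ S := erase_subset _ _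
    have hcx := hc.mono hsub
    have t1 := h.twoCut haT
    have t2 := h.symm.twoCut haT
    have hd : ∀ u ∈ Z₁, u ∉ Z₂ := fun u hu => h.notMem_of_left hu
    have hd' : ∀ u ∈ Z₂, u ∉ Z₁ := fun u hu => h.symm.notMem_of_left hu
    have hcard := h.card_of_erase haT
    have hcard' := card_erase_add_one hx
    have hmem := h.mem_iff_of_erase haT
    have hmemS : ∀ u, u ∈ S ↔ u = x ∨ u = a ∨ u = y ∨ u ∈ Z₁ ∨ u ∈ Z₂ := by
      intro u
      rw [← hmem, mem_erase]
      by_cases e : u = x <;> simp [e, hx]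
    have n1 := t1.nonempty.card_pos
    have n2 := t2.nonempty.card_pos
    have a1 := t1.left_notMem
    have a2 := t2.left_notMem
    have y1 := t1.right_notMem
    have y2 := t2.right_notMem
    have hay := t1.ne
    have x1 : x ∉ Z₁ := fun e => notMem_erase x S (t1.sub e)
    have x2 : x ∉ Z₂ := fun e => notMem_erase x S (t2.sub e)
    have hyS := hsub t1.right_mem
    have cy1 := t1.cliqueOn_right t2 hd' hS hcx
    have ca1 := t1.cliqueOn_left t2 hd' hS hcx
    have ca2 := t2.cliqueOn_left t1 hd hS hcx
    have xy2 : x ∉ insert y Z₂ := by simp [hxy.ne, x2]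
    have xa1 : x ∉ insert a Z₁ := by simp [hxa.ne, x1]
    have xay2 : x ∉ insert a (insert y Z₂) := by simp [hxy.ne, x2, hxa.ne]
    have k1 : #(insert x (insert a (insert y Z₂))) = #Z₂ + 3 := by
      rw [card_insert_of_notMem xay2, t2.card_both]
    have k2 : #(insert x (insert a Z₁)) = #Z₁ + 2 := by
      rw [card_insert_of_notMem xa1, card_insert_of_notMem a1]
    have k3 : #(insert y Z₂) = #Z₂ + 1 := card_insert_of_notMem y2
    rcases hcase with ⟨h0, h0'⟩ | ⟨h0, h0'⟩
    · have f1 := (ihA G Z₁ (by omega) (t1.chainOn hS ca1 cy1) (hcx.mono t1.sub) h0).deleteEdge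
        (x := x) (y := y) fun e => (x1 e).elim
      have f2 := ihB G _ (by omega)
        (t2.twoConnOn_insert hS (notMem_erase x S) hxa hxy)
        (hc.mono (insert_subset hx (insert_subset ha (insert_subset hyS (t2.sub.trans hsub)))))
        (by omega) x (by simp) y (by simp) hxy
      refine f1.of_union f2 ?_ ?_
      · intro u hu
        simp only [mem_insert, not_or]
        exact ⟨fun e => x1 (e ▸ hu), fun e => a1 (e ▸ hu), fun e => y1 (e ▸ hu), hd u hu⟩
      · intro u
        rw [hmemS]
        simp only [mem_insert]
        clear * -
        tauto
    · have f1 := (ihA G (insert x (insert a Z₁)) (by omega)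
        (t1.chainOn_left_insert hS cy1 hxa)
        (hc.mono (insert_subset hx (insert_subset ha (t1.sub.trans hsub))))
        (by omega)).deleteEdge
        (x := x) (y := y) fun _ e => by simp [hxy.ne', y1, hay.symm] at e
      have f2 := (ihA G (insert y Z₂) (by omega)
        (t2.symm.chainOn_left hS ca2) (hcx.mono (insert_subset t2.right_mem t2.sub))
        (by omega)).deleteEdge (x := x) (y := y) fun e => (xy2 e).elim
      refine f1.of_union f2 ?_ ?_
      · intro u hu
        simp only [mem_insert, not_or]
        rcases mem_insert.1 hu with rfl | hu
        · exact ⟨hxy.ne, x2⟩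
        rcases mem_insert.1 hu with rfl | hu
        · exact ⟨hay, a2⟩
        · exact ⟨fun e => y1 (e ▸ hu), hd u hu⟩
      · intro u
        rw [hmemS]
        simp only [mem_insert]
        clear * -
        tauto
  have hcard := h.card_of_erase haT
  have hcard' := card_erase_add_one hx
  by_cases h0 : #Z₁ % 3 = 2
  · exact aux Z₂ Z₁ h.symm (by omega)
  · exact aux Z₁ Z₂ h (by omega)

/-- A vertex attached to a side `Z₂` of a 2-cut that is minimal among the sides avoiding `y`. -/
theorem CutSplit.chainOn_insert_of_minimal {Z₁ Z₂ : Finset V} {x y d : V}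
    (h : CutSplit G S Z₁ d Z₂) (hy : y ∈ Z₁) (hx : x ∉ S)
    (hmin : ∀ A v B, CutSplit G S A v B → y ∈ A → #Z₂ ≤ #B) (hconn : ConnOn G Z₂)
    (hcl : CliqueOn G fun u => u ∈ Z₂ ∧ G.Adj d u) (hxZ : ∃ u ∈ Z₂, G.Adj x u) :
    ChainOn G (insert x Z₂) := by
  have hd : ∀ u ∈ Z₁, u ∉ Z₂ := fun u hu => h.notMem_of_left hu
  obtain ⟨w, hw, hxw⟩ := hxZ
  refine ChainOn.of_cliques (hconn.insert_adj hw hxw) (· = x) _ (fun u v hu hv huv =>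
    (huv (hu.trans hv.symm)).elim) hcl ?_
  intro T hT hn c hcS hcT hcl hne
  by_contra hno
  push Not at hno
  obtain ⟨hxT, hdT⟩ := hno
  have hTZ : T ⊆ Z₂ := fun u hu => (mem_insert.1 (hT hu)).resolve_left (hxT u hu)
  have hdT' : ∀ u ∈ T, ¬ G.Adj d u := fun u hu => hdT u hu (hTZ hu)
  by_cases hcx : c = x
  · subst hcx
    have := hconn T hTZ hn fun u hu w hw huw =>
      (hcl u hu w (by simp [hw]) huw).resolve_right fun e => hx (h.right_sub (e ▸ hw))
    exact hne (insert_subset_insert _ this)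
  have hcZ := (mem_insert.1 hcS).resolve_left hcx
  have hlt : #T < #Z₂ := card_lt_card ⟨hTZ, fun hs => hcT (hs hcZ)⟩
  -- As `d` does not see `T`, the vertex `c` cuts `T` off in `S`, leaving `y` on the other side: a
  -- smaller choice than `Z₂`.
  have hsp : CutSplit G S (S \ insert c T) c T := by
    refine ⟨?_, ⟨d, ?_⟩, hn, ?_, by simp, hcT, ?_⟩
    · have := h.right_sub hcZ
      have := hTZ.trans h.right_sub
      ext u
      simp only [mem_insert, mem_union, mem_sdiff]
      by_cases e1 : u = c
      · simp_all
      by_cases e2 : u ∈ T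
      · simp [e2, this e2]
      · simp [e1, e2]
    · simp only [mem_sdiff, mem_insert, not_or]
      exact ⟨h.mem, fun e => h.notMem_right (e ▸ hcZ), fun e => h.notMem_right (hTZ e)⟩
    · rw [disjoint_left]
      intro u hu hu'
      simp [hu'] at hu
    · intro u hu v hv huv
      simp only [mem_sdiff, mem_insert, not_or] at hu
      rcases h.mem_or hu.1 with rfl | e | e
      · exact hdT' v hv huv
      · exact h.not_adj u e v (hTZ hv) huv
      · have := hcl v hv u (mem_insert_of_mem e) huv.symm
        tauto
  have := hmin _ _ _ hsp (by
    simp only [mem_sdiff, mem_insert, not_or]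
    exact ⟨h.left_sub hy, fun e => hd y hy (e ▸ hcZ), fun e => hd y hy (hTZ e)⟩)
  omega

/-- A cut vertex `d` of `S - x - a` leaves `y` in a side `Z₁`. Except for residues 1 and 2, the
vertices `x` and `a`, with `d` where needed, can join `Z₂` to form a chain. In the exceptional case
`x` alone can join `Z₂`, provided it sees `Z₂`; the minimal choice of `Z₂` makes the result a chain.
-/
theorem TwoConnOn.pathFactor_of_twoConnOn_erase (hS : TwoConnOn G S) (hc : ClawFreeOn G S)
    (h3 : #S % 3 = 0) (h4 : 4 ≤ #S) {x y : V} (hx : x ∈ S) (hy : y ∈ S) (hxy : G.Adj x y)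
    (hSx : TwoConnOn G (S.erase x)) (ihA : ChainFactorBelow V #S)
    (ihB : EdgeFactorBelow V #S) : PathFactor (G.deleteEdges {s(x, y)}) S := by
  obtain ⟨a, ha, hxa, hay⟩ := hS.exists_adj_ne hx y
  by_cases hT : TwoConnOn G ((S.erase x).erase a)
  · exact hS.pathFactor_of_twoConnOn_erase_erase hc h3 h4 hx ha hxy hxa hay hT ihA
  have hsub : S.erase x ⊆ S := erase_subset _ _
  have hcx := hc.mono hsub
  have haT : a ∈ S.erase x := mem_erase.2 ⟨hxa.ne', ha⟩
  have hyT : y ∈ (S.erase x).erase a := by simp [hay.symm, hxy.ne', hy]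
  have hcard' := card_erase_add_one hx
  have hcard'' := card_erase_add_one haT
  obtain ⟨A, c, B, hsp⟩ := (hSx.erase_chainOn hcx haT).1.exists_cutSplit (by omega) hT
  by_cases hyc : y = c
  · subst hyc
    exact hSx.pathFactor_of_cut_edge_erase hc h3 hx ha hxy hxa hsp ihA ihB
  have hex : ∃ n, ∃ Z₁ d Z₂, CutSplit G ((S.erase x).erase a) Z₁ d Z₂ ∧ y ∈ Z₁ ∧ #Z₂ = n := by
    rcases hsp.mem_or hyT with e | e | e
    · exact (hyc e).elim
    · exact ⟨_, A, c, B, hsp, e, rfl⟩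
    · exact ⟨_, B, c, A, hsp.symm, e, rfl⟩
  classical
  obtain ⟨Z₁, d, Z₂, h, hyZ, hn⟩ := Nat.find_spec hex
  have hmin : ∀ T v T', CutSplit G ((S.erase x).erase a) T v T' → y ∈ T → #Z₂ ≤ #T' := by
    intro T v T' hT hyT
    rw [hn]
    exact Nat.find_min' hex ⟨T, v, T', hT, hyT, rfl⟩
  clear hn hsp hyc
  have t1 := h.twoCut haT
  have t2 := h.symm.twoCut haT
  have hd : ∀ u ∈ Z₁, u ∉ Z₂ := fun u hu => h.notMem_of_left hu
  have hd' : ∀ u ∈ Z₂, u ∉ Z₁ := fun u hu => h.symm.notMem_of_left hu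
  have hcard := h.card_of_erase haT
  have hmem := h.mem_iff_of_erase haT
  have hmemS : ∀ u, u ∈ S ↔ u = x ∨ u = a ∨ u = d ∨ u ∈ Z₁ ∨ u ∈ Z₂ := by
    intro u
    rw [← hmem, mem_erase]
    by_cases e : u = x <;> simp [e, hx]
  have n1 := t1.nonempty.card_pos
  have n2 := t2.nonempty.card_pos
  have a1 := t1.left_notMem
  have a2 := t2.left_notMem
  have d1 := t1.right_notMem
  have d2 := t2.right_notMem
  have had := t1.ne
  have hxS := notMem_erase x S
  have hxd : x ≠ d := fun e => hxS (e ▸ t1.right_mem)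
  have hyd : y ≠ d := fun e => d1 (e ▸ hyZ)
  have hy2 := hd y hyZ
  have x1 : x ∉ Z₁ := fun e => hxS (t1.sub e)
  have x2 : x ∉ Z₂ := fun e => hxS (t2.sub e)
  have hdS := hsub t1.right_mem
  have cd1 := t1.cliqueOn_right t2 hd' hSx hcx
  have ca1 := t1.cliqueOn_left t2 hd' hSx hcx
  have cd2 := t2.cliqueOn_right t1 hd hSx hcx
  have ca2 := t2.cliqueOn_left t1 hd hSx hcx
  have xa2 : x ∉ insert a Z₂ := by simp [hxa.ne, x2]
  have xd1 : x ∉ insert d Z₁ := by simp [hxd, x1]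
  have xad1 : x ∉ insert a (insert d Z₁) := by simp [hxd, x1, hxa.ne]
  have xad2 : x ∉ insert a (insert d Z₂) := by simp [hxd, x2, hxa.ne]
  have yxa2 : y ∉ insert x (insert a Z₂) := by simp [hxy.ne', hay.symm, hy2]
  have yxad2 : y ∉ insert x (insert a (insert d Z₂)) := by
    simp [hxy.ne', hyd, hy2, hay.symm]
  have k1 : #(insert x (insert a (insert d Z₂))) = #Z₂ + 3 := by
    rw [card_insert_of_notMem xad2, t2.card_both]
  have k2 : #(insert x (insert a Z₂)) = #Z₂ + 2 := by
    rw [card_insert_of_notMem xa2, card_insert_of_notMem a2]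
  have k3 : #(insert d Z₁) = #Z₁ + 1 := card_insert_of_notMem d1
  have k4 : #(insert x Z₂) = #Z₂ + 1 := card_insert_of_notMem x2
  have k5 := t1.card_both
  have hcase : #Z₁ % 3 = 0 ∧ #Z₂ % 3 = 0 ∨ #Z₁ % 3 = 2 ∧ #Z₂ % 3 = 1 ∨
      #Z₁ % 3 = 1 ∧ #Z₂ % 3 = 2 := by omega
  rcases hcase with ⟨h0, h0'⟩ | ⟨h0, h0'⟩ | ⟨h0, h0'⟩
  · have f1 := (ihA G Z₁ (by omega) (t1.chainOn hSx ca1 cd1) (hcx.mono t1.sub) h0).deleteEdge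
      (x := x) (y := y) fun e => (x1 e).elim
    have f2 := (ihA G _ (by omega) (t2.chainOn_both_insert hSx hxa)
      (hc.mono (insert_subset hx (insert_subset ha (insert_subset hdS (t2.sub.trans hsub)))))
      (by omega)).deleteEdge (x := x) (y := y) fun _ => yxad2
    refine f1.of_union f2 ?_ ?_
    · intro u hu
      simp only [mem_insert, not_or]
      exact ⟨fun e => x1 (e ▸ hu), fun e => a1 (e ▸ hu), fun e => d1 (e ▸ hu), hd u hu⟩
    · intro u
      rw [hmemS]
      simp only [mem_insert]
      clear * -
      tauto
  · have f1 := (ihA G (insert d Z₁) (by omega) (t1.symm.chainOn_left hSx ca1)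
      (hcx.mono (insert_subset t1.right_mem t1.sub)) (by omega)).deleteEdge
      (x := x) (y := y) fun e => (xd1 e).elim
    have f2 := (ihA G _ (by omega) (t2.chainOn_left_insert hSx cd2 hxa)
      (hc.mono (insert_subset hx (insert_subset ha (t2.sub.trans hsub))))
      (by omega)).deleteEdge (x := x) (y := y) fun _ => yxa2
    refine f1.of_union f2 ?_ ?_
    · intro u hu
      simp only [mem_insert, not_or]
      rcases mem_insert.1 hu with rfl | hu
      · exact ⟨hxd.symm, had.symm, d2⟩
      · exact ⟨fun e => x1 (e ▸ hu), fun e => a1 (e ▸ hu), hd u hu⟩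
    · intro u
      rw [hmemS]
      simp only [mem_insert]
      clear * -
      tauto
  by_cases hxZ : ∃ u ∈ Z₂, G.Adj x u
  · have f1 := (ihA G _ (by omega) (t1.chainOn_both hSx)
      (hcx.mono (insert_subset haT (insert_subset t1.right_mem t1.sub))) (by omega)).deleteEdge
      (x := x) (y := y) fun e => (xad1 e).elim
    have f2 := (ihA G (insert x Z₂) (by omega)
      (h.chainOn_insert_of_minimal hyZ (fun e => hxS (mem_of_mem_erase e)) hmin
        (t2.chainOn hSx ca2 cd2).1 cd2 hxZ)
      (hc.mono (insert_subset hx (t2.sub.trans hsub)))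
      (by omega)).deleteEdge (x := x) (y := y) fun _ e => by simp [hxy.ne', hy2] at e
    refine f1.of_union f2 ?_ ?_
    · intro u hu
      simp only [mem_insert, not_or]
      rcases mem_insert.1 hu with rfl | hu
      · exact ⟨hxa.ne', a2⟩
      rcases mem_insert.1 hu with rfl | hu
      · exact ⟨hxd.symm, d2⟩
      · exact ⟨fun e => x1 (e ▸ hu), hd u hu⟩
    · intro u
      rw [hmemS]
      simp only [mem_insert]
      clear * -
      tauto
  -- Since `x` does not see `Z₂`, the pair `{a, d}` is a 2-cut of `S` itself, with sides `Z₁ + x`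
  -- and `Z₂`, both of size 2 modulo 3.
  push Not at hxZ
  have t2' : TwoCut G S Z₂ a d := by
    refine ⟨t2.sub.trans hsub, t2.nonempty, ha, hdS, had, a2, d2, fun u hu w hw huw => ?_⟩
    by_cases hwx : w = x
    · exact (hxZ u hu (hwx ▸ huw.symm)).elim
    · exact t2.closed u hu w (mem_erase.2 ⟨hwx, hw⟩) huw
  have t1' : TwoCut G S (insert x Z₁) a d := by
    refine ⟨insert_subset hx (t1.sub.trans hsub), by simp, ha, hdS, had, by simp [hxa.ne', a1],
      by simp [hxd.symm, d1], fun u hu w hw huw => ?_⟩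
    rcases (hmemS w).1 hw with e | e | e | e | e
    · simp [e]
    · simp [e]
    · simp [e]
    · simp [e]
    · rcases mem_insert.1 hu with rfl | hu
      · exact (hxZ w e huw).elim
      · exact (h.not_adj u hu w e huw).elim
  refine t1'.pathFactor_deleteEdge t2' ?_ ?_ hS hc (by rw [card_insert_of_notMem x1]; omega) h0'
    (by simp) (by simp [hyZ]) hxy hxa.symm ?_ ihA ihB
  · intro u hu
    rcases mem_insert.1 hu with rfl | hu
    exacts [x2, hd u hu]
  · intro u hu
    have := (hmemS u).1 hu
    rw [mem_insert]
    clear * - this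
    tauto
  -- If the side is just `{x, y}`, then `y` is the only vertex of `Z₁`, and `a` sees `Z₁`.
  · intro hY
    obtain ⟨u, hu, hau⟩ := t1.exists_adj_left hSx
    have := hY (mem_insert_of_mem hu)
    simp only [mem_insert, mem_singleton] at this
    rcases this with rfl | rfl
    exacts [(x1 hu).elim, hau]

/-! ### The simultaneous induction -/

theorem TwoConnOn.pathFactor_deleteEdge_of_card_eq_three (hS : TwoConnOn G S) (h3 : #S = 3)
    {x y : V} (hx : x ∈ S) (hy : y ∈ S) (hxy : G.Adj x y) :
    PathFactor (G.deleteEdges {s(x, y)}) S := by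
  obtain ⟨w, hw, hxw, hwy⟩ := hS.exists_adj_ne hx y
  obtain ⟨v, hv, hyv, hvx⟩ := hS.exists_adj_ne hy x
  have hcard : #({x, w, y} : Finset V) = 3 :=
    card_eq_three.2 ⟨x, w, y, hxw.ne, hxy.ne, hwy, rfl⟩
  have hSeq : {x, w, y} = S :=
    eq_of_subset_of_card_le (by simp [insert_subset_iff, hx, hw, hy]) (by omega)
  have hvw : v = w := by
    rw [← hSeq] at hv
    simp only [mem_insert, mem_singleton] at hv
    rcases hv with e | e | e
    exacts [(hvx e).elim, e, (hyv.ne' e).elim]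
  subst hvw
  rw [← hSeq]
  refine PathFactor.path hxy.ne ?_ ?_
  · rw [deleteEdge_adj]
    exact ⟨hxw, fun e => hwy e.2, fun e => hxy.ne e.1⟩
  · rw [deleteEdge_adj]
    exact ⟨hyv.symm, fun e => hvx e.1, fun e => hwy e.1⟩

theorem edgeFactorBelow_succ {n : ℕ} (ihA : ChainFactorBelow V n) (ihB : EdgeFactorBelow V n) :
    EdgeFactorBelow V (n + 1) := by
  intro H T hT hS hc h3 x hx y hy hxy
  have h3' := hS.1
  by_cases h4 : #T = 3
  · exact hS.pathFactor_deleteEdge_of_card_eq_three h4 hx hy hxy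
  have ihA' : ChainFactorBelow V #T := fun G' S h => ihA G' S (by omega)
  have ihB' : EdgeFactorBelow V #T := fun G' S h => ihB G' S (by omega)
  by_cases hno : TwoConnOn H (T.erase x)
  · exact hS.pathFactor_of_twoConnOn_erase hc h3 (by omega) hx hy hxy hno ihA' ihB'
  · exact hS.pathFactor_of_not_twoConnOn_erase hc h3 (by omega) hx hy hxy hno ihA' ihB'

/-- Chains that are 2-connected rely on the edge statement at the same size, whose own proof uses
only smaller chains; so there is no circularity. -/
theorem chainFactorBelow_succ {n : ℕ} (ihA : ChainFactorBelow V n)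
    (ihB : EdgeFactorBelow V (n + 1)) : ChainFactorBelow V (n + 1) := by
  intro H T hT hS hc h3
  by_cases h2 : TwoConnOn H T
  · have := h2.1
    obtain ⟨x, hx⟩ : T.Nonempty := card_pos.1 (by omega)
    -- Excluding `x` itself is no restriction: any neighbour will do.
    obtain ⟨y, hy, hxy, -⟩ := h2.exists_adj_ne hx x
    exact (ihB H T hT h2 hc h3 x hx y hy hxy).congr fun u _ v _ huv => (deleteEdge_adj.1 huv).1
  · exact hS.pathFactor_of_not_twoConnOn hc h3 h2 fun S hS => ihA H S (by omega)

theorem chainFactorBelow_and_edgeFactorBelow (n : ℕ) : ChainFactorBelow V n ∧ EdgeFactorBelow V n := by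
  induction n with
  | zero => exact ⟨fun _ _ h => by omega, fun _ _ h => by omega⟩
  | succ n ih =>
    have := edgeFactorBelow_succ ih.1 ih.2
    exact ⟨chainFactorBelow_succ ih.1 this, this⟩

theorem TwoConnOn.pathFactor_deleteEdge (hS : TwoConnOn G S) (hc : ClawFreeOn G S)
    (h3 : #S % 3 = 0) {x y : V} (hx : x ∈ S) (hy : y ∈ S) (hxy : G.Adj x y) :
    PathFactor (G.deleteEdges {s(x, y)}) S :=
  (chainFactorBelow_and_edgeFactorBelow (#S + 1)).2 G S (by omega) hS hc h3 x hx y hy hxy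

/-! ### From vertex sets back to graphs and subgraphs -/

/-- The map sending each vertex to the middle vertex of its path. -/
theorem PathFactor.exists_middle (h : PathFactor G S) : ∃ m : V → V,
    (∀ v ∈ S, m v ∈ S ∧ m (m v) = m v ∧ (v = m v ∨ G.Adj v (m v))) ∧
    ∀ b ∈ S, m b = b → ∃ a ∈ S, ∃ c ∈ S, a ≠ b ∧ c ≠ b ∧ a ≠ c ∧
      ∀ v ∈ S, m v = b ↔ v = a ∨ v = b ∨ v = c := by
  induction h with
  | empty => exact ⟨id, by simp, by simp⟩
  | cons S a b c _ ha hb hc hac hab hbc ih =>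
    obtain ⟨m, h1, h2⟩ := ih
    have hm : ∀ v, v ∈ S → v ≠ a ∧ v ≠ b ∧ v ≠ c := fun v hv =>
      ⟨fun e => ha (e ▸ hv), fun e => hb (e ▸ hv), fun e => hc (e ▸ hv)⟩
    refine ⟨fun v => if v = a ∨ v = b ∨ v = c then b else m v, ?_, ?_⟩
    · intro v hv
      by_cases e : v = a ∨ v = b ∨ v = c
      · simp only [e, if_true]
        refine ⟨by simp, by simp, ?_⟩
        rcases e with rfl | rfl | rfl
        exacts [Or.inr hab, Or.inl rfl, Or.inr hbc.symm]
      · have hvS : v ∈ S := by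
          simp only [mem_insert] at hv
          tauto
        obtain ⟨i1, i2, i3⟩ := h1 v hvS
        have := hm _ i1
        simp only [e, if_false]
        refine ⟨by simp [i1], by simp [this, i2], i3⟩
    · intro v hv hvb
      by_cases e : v = a ∨ v = b ∨ v = c
      · simp only [e, if_true] at hvb
        subst hvb
        refine ⟨a, by simp, c, by simp, hab.ne, hbc.ne', hac, fun w hw => ?_⟩
        by_cases e : w = a ∨ w = b ∨ w = c
        · simp [e]
        · have hwS : w ∈ S := by
            simp only [mem_insert] at hw
            tauto
          have := hm _ (h1 w hwS).1
          simp [e, this]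
      · have hvS : v ∈ S := by
          simp only [mem_insert] at hv
          tauto
        simp only [e, if_false] at hvb
        obtain ⟨p, hpS, r, hrS, hp, hr, hpr, hf⟩ := h2 v hvS hvb
        refine ⟨p, by simp [hpS], r, by simp [hrS], hp, hr, hpr, fun w hw => ?_⟩
        have := hm v hvS
        by_cases e : w = a ∨ w = b ∨ w = c
        · have hw1 : ∀ q ∈ S, w ≠ q := fun q hq e' => by
            have := hm q hq
            rw [← e'] at this
            tauto
          simp [e, hw1 p hpS, hw1 r hrS, hw1 v hvS, this.2.1.symm]
        · have hwS : w ∈ S := by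
            simp only [mem_insert] at hw
            tauto
          simp [e, hf w hwS]

theorem mem_of_reachable {V : Type*} {G : SimpleGraph V} {A : Set V}
    (hA : ∀ u ∈ A, ∀ w, G.Adj u w → w ∈ A) {u w : V} (h : G.Reachable u w) (hu : u ∈ A) :
    w ∈ A := by
  obtain ⟨p⟩ := h
  induction p with
  | nil => exact hu
  | cons hadj _ ih => exact ih (hA _ hu _ hadj)

/-- The subgraph joins each vertex to the middle of its path. Its components are the fibres of the
middle map, each a star with two leaves. -/
theorem PathFactor.hasFactor {V : Type*} [Fintype V] [DecidableEq V] {G : SimpleGraph V}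
    (h : PathFactor G univ) : HasFactor Lambda G := by
  obtain ⟨m, h1, h2⟩ := h.exists_middle
  let P : G.Subgraph :=
    { verts := Set.univ
      Adj := fun u v => u ≠ v ∧ m u = m v ∧ (u = m u ∨ v = m v)
      adj_sub := by
        rintro u v ⟨hne, hm, e | e⟩
        · have := (h1 v (mem_univ v)).2.2
          rw [← hm, ← e] at this
          exact (this.resolve_left hne.symm).symm
        · have := (h1 u (mem_univ u)).2.2
          rw [hm, ← e] at this
          exact this.resolve_left hne
      edge_vert := fun _ => Set.mem_univ _
      symm := ⟨fun u v ⟨hne, hm, e⟩ => ⟨hne.symm, hm.symm, e.symm⟩⟩ }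
  have hadj : ∀ u v : P.verts, P.coe.Adj u v ↔
      u.1 ≠ v.1 ∧ m u = m v ∧ (u.1 = m u ∨ v.1 = m v) := fun u v => Iff.rfl
  refine ⟨P, fun C => ?_, rfl⟩
  obtain ⟨v, hv⟩ := C.exists_rep
  have hmem : ∀ w : P.verts, w ∈ C ↔ m w = m v := by
    intro w
    have hw : w ∈ C ↔ P.coe.Reachable w v := by
      rw [← hv]
      exact SimpleGraph.ConnectedComponent.eq
    rw [hw]
    constructor
    · intro hr
      exact mem_of_reachable (A := {u : P.verts | m u = m v})
        (fun u hu w huw => ((hadj u w).1 huw).2.1.symm.trans hu) hr.symm rfl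
    · intro hwv
      have key : ∀ u : P.verts, P.coe.Reachable u ⟨m u, Set.mem_univ _⟩ := by
        intro u
        by_cases e : u.1 = m u
        · have : u = ⟨m u, Set.mem_univ _⟩ := Subtype.ext e
          rw [← this]
        · have hmu := (h1 u (mem_univ _)).2.1
          exact SimpleGraph.Adj.reachable ((hadj _ _).2 ⟨e, hmu.symm, Or.inr hmu.symm⟩)
      have := (key w)
      simp only [hwv] at this
      exact this.trans (key v).symm
  have hmv := (h1 v (mem_univ _)).2.1
  obtain ⟨a, -, c, -, hab, hcb, hac, hf⟩ := h2 (m v) (mem_univ _) hmv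
  have ha : m a = m v := (hf a (mem_univ _)).2 (by simp)
  have hc : m c = m v := (hf c (mem_univ _)).2 (by simp)
  let f : Fin 3 → C := ![⟨⟨a, Set.mem_univ _⟩, (hmem _).2 ha⟩,
    ⟨⟨m v, Set.mem_univ _⟩, (hmem _).2 hmv⟩, ⟨⟨c, Set.mem_univ _⟩, (hmem _).2 hc⟩]
  have hfb : Function.Bijective f := by
    constructor
    · intro i j hij
      have : ((f i).1.1 : V) = (f j).1.1 := by rw [hij]
      fin_cases i <;> fin_cases j <;> simp_all [f]
    · rintro ⟨⟨w, hw⟩, hwC⟩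
      rcases (hf w (mem_univ _)).1 ((hmem _).1 hwC) with rfl | rfl | rfl
      exacts [⟨0, rfl⟩, ⟨1, rfl⟩, ⟨2, rfl⟩]
  refine ⟨SimpleGraph.Iso.symm ⟨Equiv.ofBijective f hfb, ?_⟩⟩
  intro i j
  change (f i).1.1 ≠ (f j).1.1 ∧ m (f i).1.1 = m (f j).1.1 ∧
    ((f i).1.1 = m (f i).1.1 ∨ (f j).1.1 = m (f j).1.1) ↔ (SimpleGraph.pathGraph 3).Adj i j
  rw [SimpleGraph.pathGraph_adj]
  fin_cases i <;> fin_cases j <;>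
    simp [f, ha, hc, hmv, hab, hcb, hac, hab.symm, hcb.symm, hac.symm]

theorem IsTwoConnected.twoConnOn {V : Type*} [Fintype V] [DecidableEq V] {G : SimpleGraph V}
    (h : IsTwoConnected G) : TwoConnOn G univ := by
  refine ⟨h.1, fun A _ ⟨u, hu⟩ c hcl w _ => ?_⟩
  by_contra hw
  rw [mem_insert, not_or] at hw
  -- If `c ∈ A`, no edge leaves `A`, and connectivity of `G` suffices; otherwise `A` has no outgoing
  -- edge after `c` is deleted.
  by_cases hc : c ∈ A
  · refine hw.2 (mem_of_reachable (A := {v | v ∈ A}) (fun p hp q hpq => ?_)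
      (h.2.1.preconnected u w) hu)
    rcases hcl p hp q (mem_univ _) hpq with e | rfl
    exacts [e, hc]
  · refine hw.2 (mem_of_reachable (A := {v : ({c}ᶜ : Set V) | v.1 ∈ A}) (fun p hp q hpq => ?_)
      ((h.2.2 c).preconnected ⟨u, fun e => hc (e ▸ hu)⟩ ⟨w, hw.1⟩) hu)
    exact (hcl p hp q (mem_univ _) hpq).resolve_right q.2

theorem IsClawFree.clawFreeOn {V : Type*} {G : SimpleGraph V} (h : IsClawFree G)
    (S : Finset V) : ClawFreeOn G S := by
  intro c _ x _ y _ z _ hxy hxz hyz hcx hcy hcz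
  by_contra hno
  push Not at hno
  obtain ⟨nxy, nxz, nyz⟩ := hno
  have nyx : ¬ G.Adj y x := fun e => nxy e.symm
  have nzx : ¬ G.Adj z x := fun e => nxz e.symm
  have nzy : ¬ G.Adj z y := fun e => nyz e.symm
  refine h ⟨⟨⟨Sum.elim (fun _ => c) ![x, y, z], ?_⟩, ?_⟩⟩
  · rintro (i | i) (j | j) hij <;> fin_cases i <;> fin_cases j <;>
      simp_all [hcx.ne, hcy.ne, hcz.ne, hcx.ne', hcy.ne', hcz.ne']
  · intro i j
    change G.Adj (Sum.elim (fun _ => c) ![x, y, z] i) (Sum.elim (fun _ => c) ![x, y, z] j) ↔ _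
    rcases i with i | i <;> rcases j with j | j <;> fin_cases i <;> fin_cases j <;>
      simp [hcx, hcy, hcz, hcx.symm, hcy.symm, hcz.symm, nxy, nxz, nyz, nyx, nzx, nzy]

end

theorem mainTheorem7 {V : Type*} [Fintype V] (G : SimpleGraph V)
    (hconn : IsTwoConnected G) (hclaw : IsClawFree G)
    (hcard : Fintype.card V % 3 = 0) (e : Sym2 V) (he : e ∈ G.edgeSet) :
    HasFactor Lambda (G.deleteEdges {e}) := by
  classical
  induction e with
  | h x y =>
    exact (hconn.twoConnOn.pathFactor_deleteEdge (hclaw.clawFreeOn univ) hcard (mem_univ x)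
      (mem_univ y) he).hasFactor
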